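/- Conventions. Metrics on product spacetimes have "mostly minus" signature: a Lorentzian metric has signature $(+,-,\dots,-)$ and, correspondingly, the metric $g$ of a Riemannian (in particular Kähler) manifold is taken to be negative definite. For a metric $h$ and $k$-forms $\alpha,\beta$ put $\langle\alpha,\beta\rangle_h=\frac1{k!}\sum \alpha_{i_1\dots i_k}\beta_{j_1\dots j_k}h^{i_1j_1}\cdots h^{i_kj_k}$ and $\|\alpha\|_h^2=\langle\alpha,\alpha\rangle_h$; on an oriented manifold the Hodge star is defined by $\alpha\wedge\star\beta=\langle\alpha,\beta\rangle_h\,\mathrm{vol}$. The Ricci tensor is $\mathrm{Ric}(Y,Z)=\mathrm{tr}\,(X\mapsto R(X,Y)Z)$ with $R(X,Y)=[\nabla_X,\nabla_Y]-\nabla_{[X,Y]}$, and a metric $g$ is Einstein with Einstein constant $\lambda$ if $\mathrm{Ric}_g=\lambda g$. A Kähler manifold $(M,g,\omega)$ is a manifold with an integrable complex structure $J$, a (here negative definite) $J$-invariant metric $g$, and closed Kähler form $\omega$ given by $\omega(X,JY)=g(X,Y)$. A bosonic supergravity background is an oriented eleven-dimensional Lorentzian manifold $(X,h)$ of signature $(1,10)$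 with a smooth $4$-form $F$ such that $$dF=0,\qquad d\star F=\tfrac12 F\wedge F,\qquad \mathrm{Ric}_h(Y,Z)=-\tfrac12\langle Y\lrcorner F,Z\lrcorner F\rangle_h+\tfrac16 h(Y,Z)\|F\|_h^2$$ for all tangent vectors $Y,Z$. Theorem. Let $(\widetilde M^{1,4},\tilde g)$ be a nonempty oriented five-dimensional Lorentzian manifold, let $(M^6,g,\omega)$ be a nonempty oriented Kähler manifold of real dimension six, and let $c\in\mathbb R$. Equip $X=\widetilde M\times M$ with the metric $h=\tilde g+g$, the orientation given by $\mathrm{vol}_X=\mathrm{vol}_{\widetilde M}\wedge\mathrm{vol}_M$, and the $4$-form $F=c\star_6\omega$ (pulled back from $M$), where $\star_6$ is the Hodge star of $(M,g)$. Then $(X,h,F)$ is a bosonic supergravity background if and only if $\mathrm{Ric}_{\tilde g}=\frac{c^2}{2}\tilde g$ and $\mathrm{Ric}_g=-\frac{c^2}{2}g$, i.e. $\tilde g$ and $g$ are Einstein with Einstein constants $\frac{c^2}{2}$ and $-\frac{c^2}{2}$. -/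

import Mathlib

set_option maxSynthPendingDepth 3

open scoped Manifold ContDiff Topology

noncomputable section

namespace Sugra

/-! ### Linear algebra of alternating forms on a finite-dimensional space with a scalar product -/

section Pointwise

variable {E : Type*} [NormedAddCommGroup E] [NormedSpace ℝ E]

/-- The multilinear map `(v₁, …, v_{k+l}) ↦ α(v₁, …, v_k) β(v_{k+1}, …, v_{k+l})`. -/
def formMul {k l : ℕ} (α : E [⋀^Fin k]→L[ℝ] ℝ) (β : E [⋀^Fin l]→L[ℝ] ℝ) :
    ContinuousMultilinearMap ℝ (fun _ : Fin (k + l) => E) ℝ where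
  toFun v := α (fun i => v (Fin.castAdd l i)) * β (fun j => v (Fin.natAdd k j))
  map_update_add' := by
    intro inst v i x y
    obtain rfl : inst = instDecidableEqFin (k + l) := Subsingleton.elim _ _
    refine Fin.addCases (fun a => ?_) (fun b => ?_) i
    · have h1 : ∀ z : E, (fun i => Function.update v (Fin.castAdd l a) z (Fin.castAdd l i)) =
          Function.update (fun i => v (Fin.castAdd l i)) a z := by
        intro z; funext i
        simp [Function.update_apply]
      have h2 : ∀ z : E, (fun j => Function.update v (Fin.castAdd l a) z (Fin.natAdd k j)) =
          fun j => v (Fin.natAdd k j) := by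
        intro z; funext j
        have : Fin.natAdd k j ≠ Fin.castAdd l a := by
          intro h; have := congrArg Fin.val h; simp at this; omega
        simp [this]
      simp only [h1, h2, α.map_update_add, add_mul]
    · have h1 : ∀ z : E, (fun i => Function.update v (Fin.natAdd k b) z (Fin.castAdd l i)) =
          fun i => v (Fin.castAdd l i) := by
        intro z; funext j
        have : Fin.castAdd l j ≠ Fin.natAdd k b := by
          intro h; have := congrArg Fin.val h; simp at this; omega
        simp [this]
      have h2 : ∀ z : E, (fun j => Function.update v (Fin.natAdd k b) z (Fin.natAdd k j)) =
          Function.update (fun j => v (Fin.natAdd k j)) b z := by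
        intro z; funext i
        simp [Function.update_apply]
      simp only [h1, h2, β.map_update_add, mul_add]
  map_update_smul' := by
    intro inst v i c x
    obtain rfl : inst = instDecidableEqFin (k + l) := Subsingleton.elim _ _
    refine Fin.addCases (fun a => ?_) (fun b => ?_) i
    · have h1 : ∀ z : E, (fun i => Function.update v (Fin.castAdd l a) z (Fin.castAdd l i)) =
          Function.update (fun i => v (Fin.castAdd l i)) a z := by
        intro z; funext i
        simp [Function.update_apply]
      have h2 : ∀ z : E, (fun j => Function.update v (Fin.castAdd l a) z (Fin.natAdd k j)) =
          fun j => v (Fin.natAdd k j) := by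
        intro z; funext j
        have : Fin.natAdd k j ≠ Fin.castAdd l a := by
          intro h; have := congrArg Fin.val h; simp at this; omega
        simp [this]
      simp only [h1, h2, α.map_update_smul, smul_eq_mul, mul_assoc]
    · have h1 : ∀ z : E, (fun i => Function.update v (Fin.natAdd k b) z (Fin.castAdd l i)) =
          fun i => v (Fin.castAdd l i) := by
        intro z; funext j
        have : Fin.castAdd l j ≠ Fin.natAdd k b := by
          intro h; have := congrArg Fin.val h; simp at this; omega
        simp [this]
      have h2 : ∀ z : E, (fun j => Function.update v (Fin.natAdd k b) z (Fin.natAdd k j)) =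
          Function.update (fun j => v (Fin.natAdd k j)) b z := by
        intro z; funext i
        simp [Function.update_apply]
      simp only [h1, h2, β.map_update_smul, smul_eq_mul, mul_left_comm]
  cont := by
    refine Continuous.mul ?_ ?_
    · exact α.cont.comp (by fun_prop)
    · exact β.cont.comp (by fun_prop)

/-- The wedge product, with the usual normalisation
`(α ∧ β)(v) = 1/(k! l!) ∑_σ sign(σ) α(v_{σ 1}, …, v_{σ k}) β(v_{σ (k+1)}, …, v_{σ (k+l)})`. -/
def wedge {k l : ℕ} (α : E [⋀^Fin k]→L[ℝ] ℝ) (β : E [⋀^Fin l]→L[ℝ] ℝ) :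
    E [⋀^Fin (k + l)]→L[ℝ] ℝ :=
  ((k.factorial * l.factorial : ℝ)⁻¹) • ContinuousMultilinearMap.alternatization (formMul α β)

/-- `insertVectors k τ w` is the form `τ(w₁, …, w_k, ·, …, ·)`. -/
def insertVectors {m : ℕ} :
    (k : ℕ) → (E [⋀^Fin (m + k)]→L[ℝ] ℝ) → (Fin k → E) → (E [⋀^Fin m]→L[ℝ] ℝ)
  | 0, τ, _ => τ
  | k + 1, τ, w =>
      insertVectors k (ContinuousAlternatingMap.curryLeft (n := m + k) τ (w 0)) (Fin.tail w)

variable [FiniteDimensional ℝ E]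

/-- For a basis `b` of `E` and a scalar product with matrix `g_{ij} = g(b_i, b_j)` and inverse
matrix `g^{ij}`, the vector `b^i = ∑_j g^{ij} b_j`. The basis is the fixed basis
`Module.finBasis ℝ E`; none of the notions below depends on this choice. -/
def raisedBasis (g : E →L[ℝ] E →L[ℝ] ℝ) (i : Fin (Module.finrank ℝ E)) : E :=
  ∑ j, ((Matrix.of fun a b => g (Module.finBasis ℝ E a) (Module.finBasis ℝ E b))⁻¹ i j) •
    Module.finBasis ℝ E j

/-- The scalar product `⟨α, β⟩ = 1/k! ∑ α_{i₁…i_k} β_{j₁…j_k} g^{i₁j₁} ⋯ g^{i_kj_k}` of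
`k`-forms. -/
def formInner (g : E →L[ℝ] E →L[ℝ] ℝ) {k : ℕ} (α β : E [⋀^Fin k]→L[ℝ] ℝ) : ℝ :=
  (k.factorial : ℝ)⁻¹ * ∑ i : Fin k → Fin (Module.finrank ℝ E),
    α (fun a => Module.finBasis ℝ E (i a)) * β (fun a => raisedBasis g (i a))

/-- The Hodge star `(⋆β)_{j₁…j_m} = 1/k! β^{i₁…i_k} vol_{i₁…i_k j₁…j_m}` with respect to the
scalar product `g` and the volume form `vol`. It is the operator
characterised by `α ∧ ⋆β = ⟨α, β⟩ vol` for all `k`-forms `α`. -/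
def hodge (g : E →L[ℝ] E →L[ℝ] ℝ) {m k : ℕ} (vol : E [⋀^Fin (m + k)]→L[ℝ] ℝ)
    (β : E [⋀^Fin k]→L[ℝ] ℝ) : E [⋀^Fin m]→L[ℝ] ℝ :=
  (k.factorial : ℝ)⁻¹ • ∑ i : Fin k → Fin (Module.finrank ℝ E),
    β (fun a => raisedBasis g (i a)) • insertVectors k vol (fun a => Module.finBasis ℝ E (i a))

end Pointwise

/-! ### Curvature of a metric on (an open subset of) a vector space -/

section Flat

variable {E : Type*} [NormedAddCommGroup E] [NormedSpace ℝ E]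

/-- Christoffel symbols with lowered index:
`(u, v, w) ↦ ½ (∂_u G(v, w) + ∂_v G(u, w) - ∂_w G(u, v))`. -/
def christoffelLower (G : E → E →L[ℝ] E →L[ℝ] ℝ) (p : E) : E →L[ℝ] E →L[ℝ] E →L[ℝ] ℝ :=
  let D : E →L[ℝ] E →L[ℝ] E →L[ℝ] ℝ := fderiv ℝ G p
  let swap : (E →L[ℝ] E →L[ℝ] ℝ) →L[ℝ] (E →L[ℝ] E →L[ℝ] ℝ) :=
    (ContinuousLinearMap.flipₗᵢ ℝ E E ℝ).toContinuousLinearEquiv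
  (1 / 2 : ℝ) • (D + D.flip - swap.comp D.flip)

theorem christoffelLower_apply (G : E → E →L[ℝ] E →L[ℝ] ℝ) (p u v w : E) :
    christoffelLower G p u v w =
      1 / 2 * (fderiv ℝ G p u v w + fderiv ℝ G p v u w - fderiv ℝ G p w u v) := rfl

/-- Christoffel symbols `Γ(u, v)`, determined by
`G(Γ(u, v), w) = ½ (∂_u G(v, w) + ∂_v G(u, w) - ∂_w G(u, v))`. -/
def christoffel (G : E → E →L[ℝ] E →L[ℝ] ℝ) (p : E) : E →L[ℝ] E →L[ℝ] E :=
  ContinuousLinearMap.compL ℝ E (E →L[ℝ] ℝ) E (ContinuousLinearMap.inverse (G p)) ∘L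
    christoffelLower G p

/-- The endomorphism `u ↦ R(u, v) w = ∇_u ∇_v w - ∇_v ∇_u w` (for constant `u, v, w`), where `R` is
the curvature tensor of the Levi-Civita connection of `G`. -/
def curvatureEnd (G : E → E →L[ℝ] E →L[ℝ] ℝ) (p v w : E) : E →ₗ[ℝ] E where
  toFun u := fderiv ℝ (christoffel G) p u v w - fderiv ℝ (christoffel G) p v u w
    + christoffel G p u (christoffel G p v w) - christoffel G p v (christoffel G p u w)
  map_add' x y := by
    simp only [map_add, add_apply]; abel
  map_smul' c x := by
    simp only [map_smul, smul_apply, RingHom.id_apply, smul_sub, smul_add]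

/-- The Ricci tensor `Ric(v, w) = tr (u ↦ R(u, v) w)`. -/
def ricciFlat (G : E → E →L[ℝ] E →L[ℝ] ℝ) (p v w : E) : ℝ :=
  LinearMap.trace ℝ E (curvatureEnd G p v w)

end Flat

/-! ### Tensor fields on manifolds -/

section Manifold

variable {E : Type*} [NormedAddCommGroup E] [NormedSpace ℝ E]
  {H : Type*} [TopologicalSpace H] (I : ModelWithCorners ℝ E H)
  (M : Type*) [TopologicalSpace M] [ChartedSpace H M]

/-- Differential forms of degree `k` (without regularity). -/
abbrev DiffForm (k : ℕ) : Type _ := ∀ x : M, TangentSpace I x [⋀^Fin k]→L[ℝ] ℝ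

/-- Covariant 2-tensor fields (without regularity). -/
abbrev BilinField : Type _ := ∀ x : M, TangentSpace I x →L[ℝ] TangentSpace I x →L[ℝ] ℝ

/-- Fields of endomorphisms of the tangent spaces (without regularity). -/
abbrev EndField : Type _ := ∀ x : M, TangentSpace I x →L[ℝ] TangentSpace I x

end Manifold

section Pullback

variable {E : Type*} [NormedAddCommGroup E] [NormedSpace ℝ E]
  {H : Type*} [TopologicalSpace H] {I : ModelWithCorners ℝ E H}
  {M : Type*} [TopologicalSpace M] [ChartedSpace H M]
  {E' : Type*} [NormedAddCommGroup E'] [NormedSpace ℝ E']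
  {H' : Type*} [TopologicalSpace H'] {I' : ModelWithCorners ℝ E' H'}
  {M' : Type*} [TopologicalSpace M'] [ChartedSpace H' M']

/-- The pullback `f^* α` of a differential form. -/
def DiffForm.pullback {k : ℕ} (f : M → M') (α : DiffForm I' M' k) : DiffForm I M k :=
  fun x => (α (f x)).compContinuousLinearMap (mfderiv I I' f x)

/-- The pullback `f^* g` of a covariant 2-tensor field. -/
def BilinField.pullback (f : M → M') (g : BilinField I' M') : BilinField I M :=
  fun x => ContinuousLinearMap.bilinearComp (E := E') (F := E') (E' := E) (F' := E) (g (f x))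
    (mfderiv I I' f x) (mfderiv I I' f x)

end Pullback

section Tensors

variable {E : Type*} [NormedAddCommGroup E] [NormedSpace ℝ E]
  {H : Type*} [TopologicalSpace H] {I : ModelWithCorners ℝ E H}
  {M : Type*} [TopologicalSpace M] [ChartedSpace H M]

/-- The coordinate expression of a form in the chart around `x`. -/
def DiffForm.inChart {k : ℕ} (α : DiffForm I M k) (x : M) : E → E [⋀^Fin k]→L[ℝ] ℝ :=
  DiffForm.pullback (I := 𝓘(ℝ, E)) (extChartAt I x).symm α

/-- The coordinate expression of a covariant 2-tensor field in the chart around `x`. -/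
def BilinField.inChart (g : BilinField I M) (x : M) : E → E →L[ℝ] E →L[ℝ] ℝ :=
  BilinField.pullback (I := 𝓘(ℝ, E)) (extChartAt I x).symm g

/-- The coordinate expression of a field of endomorphisms in the chart around `x`. -/
def EndField.inChart (J : EndField I M) (x : M) : E → E →L[ℝ] E := fun p =>
  (mfderiv I 𝓘(ℝ, E) (extChartAt I x) ((extChartAt I x).symm p)).comp
    ((J ((extChartAt I x).symm p)).comp (mfderiv 𝓘(ℝ, E) I (extChartAt I x).symm p))

/-- A form is smooth if its coordinate expressions are. -/
def DiffForm.Smooth {k : ℕ} (α : DiffForm I M k) : Prop :=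
  ∀ x : M, ContDiffOn ℝ ∞ (α.inChart x) (extChartAt I x).target

/-- A covariant 2-tensor field is smooth if its coordinate expressions are. -/
def BilinField.Smooth (g : BilinField I M) : Prop :=
  ∀ x : M, ContDiffOn ℝ ∞ (g.inChart x) (extChartAt I x).target

/-- A field of endomorphisms is smooth if its coordinate expressions are. -/
def EndField.Smooth (J : EndField I M) : Prop :=
  ∀ x : M, ContDiffOn ℝ ∞ (J.inChart x) (extChartAt I x).target

/-- The exterior derivative, computed at `x` in the chart around `x`. -/
def DiffForm.d {k : ℕ} (α : DiffForm I M k) : DiffForm I M (k + 1) := fun x =>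
  (extDeriv (α.inChart x) (extChartAt I x x)).compContinuousLinearMap
    (mfderiv I 𝓘(ℝ, E) (extChartAt I x) x)

/-- The wedge product of differential forms. -/
def DiffForm.wedge {k l : ℕ} (α : DiffForm I M k) (β : DiffForm I M l) : DiffForm I M (k + l) :=
  fun x => Sugra.wedge (E := E) (α x) (β x)

/-- The contraction `X ⌟ α` at a point with a tangent vector at that point. -/
def DiffForm.contract {k : ℕ} (α : DiffForm I M (k + 1)) (x : M) (X : TangentSpace I x) :
    TangentSpace I x [⋀^Fin k]→L[ℝ] ℝ :=
  ContinuousAlternatingMap.curryLeft (E := E) (α x) X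

/-- The Ricci tensor of a metric, computed at `x` in the chart around `x`. -/
def BilinField.ricci (g : BilinField I M) (x : M) (v w : TangentSpace I x) : ℝ :=
  ricciFlat (g.inChart x) (extChartAt I x x)
    (mfderiv I 𝓘(ℝ, E) (extChartAt I x) x v) (mfderiv I 𝓘(ℝ, E) (extChartAt I x) x w)

/-- `g` is a pseudo-Riemannian metric of signature `(p, q)`: a smooth covariant 2-tensor field
such that every tangent space has a basis orthogonal for `g`, of which `p` vectors have square
`1` and `q` vectors have square `-1`. -/
structure IsMetric (g : BilinField I M) (p q : ℕ) : Prop where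
  smooth : g.Smooth
  orthonormal : ∀ x : M, ∃ b : Module.Basis (Fin p ⊕ Fin q) ℝ (TangentSpace I x),
    (∀ i j, i ≠ j → g x (b i) (b j) = 0) ∧
    (∀ i, g x (b (Sum.inl i)) (b (Sum.inl i)) = 1) ∧
    (∀ i, g x (b (Sum.inr i)) (b (Sum.inr i)) = -1)

/-- `vol` is a volume form of the metric `g` on an `n`-dimensional manifold: a smooth `n`-form with
`|vol| = √|det g|`. Such a form is the same thing as an orientation of the manifold. -/
structure IsVolumeForm (g : BilinField I M) {n : ℕ} (vol : DiffForm I M n) : Prop where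
  smooth : vol.Smooth
  sq_eq : ∀ (x : M) (v : Fin n → TangentSpace I x),
    (vol x v) ^ 2 = |(Matrix.of fun i j => g x (v i) (v j)).det|

/-- `g` is an Einstein metric with Einstein constant `c`: `Ric_g = c g`. -/
def IsEinstein (g : BilinField I M) (c : ℝ) : Prop :=
  ∀ (x : M) (v w : TangentSpace I x), g.ricci x v w = c * g x v w

/-- `J` is an integrable almost complex structure: around every point there is a chart of the
smooth manifold in whose coordinates `J` is constant (so that these charts, composed with a linear
identification of the model space with a complex vector space, form a holomorphic atlas). -/
structure IsComplexStructure (J : EndField I M) : Prop where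
  smooth : J.Smooth
  sq_eq : ∀ (x : M) (v : TangentSpace I x), J x (J x v) = -v
  integrable : ∀ x : M, ∃ e ∈ IsManifold.maximalAtlas I ∞ M, x ∈ e.source ∧
    ∃ J₀ : E →L[ℝ] E, ∀ y ∈ e.source, ∀ v : TangentSpace I y,
      (mfderiv I 𝓘(ℝ, E) (e.extend I) y (J y v) : E) =
        J₀ (mfderiv I 𝓘(ℝ, E) (e.extend I) y v)

/-- `(g, J, ωM)` is a Kähler structure: `J` is a complex structure, `g` is
`J`-invariant, and the Kähler form `ωM`, given by `ωM(u, J v) = g(u, v)`, is closed. (The metric is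
specified separately, it is negative definite for the convention in use.) -/
structure IsKahler (g : BilinField I M) (J : EndField I M) (ωM : DiffForm I M 2) : Prop where
  complex : IsComplexStructure J
  hermitian : ∀ (x : M) (u v : TangentSpace I x), g x (J x u) (J x v) = g x u v
  form_smooth : ωM.Smooth
  form_eq : ∀ (x : M) (u v : TangentSpace I x), ωM x ![u, J x v] = g x u v
  closed : ωM.d = 0

variable [FiniteDimensional ℝ E]

/-- The Hodge star on differential forms. -/
def DiffForm.star {m k : ℕ} (g : BilinField I M) (vol : DiffForm I M (m + k))
    (β : DiffForm I M k) : DiffForm I M m :=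
  fun x => hodge (E := E) (g x) (vol x) (β x)

/-- The scalar product on `k`-forms on the tangent space at `x`. -/
def BilinField.inner (g : BilinField I M) (x : M) {k : ℕ}
    (α β : TangentSpace I x [⋀^Fin k]→L[ℝ] ℝ) : ℝ :=
  formInner (E := E) (g x) α β

/-- Bosonic backgrounds of eleven-dimensional supergravity: an oriented
Lorentzian manifold with metric `h` of signature `(+, -, …, -)`, volume form `vol`, and a flux
4-form `F` with `dF = 0`, `d ⋆ F = ½ F ∧ F` and
`Ric(X, Y) = -½ ⟨X ⌟ F, Y ⌟ F⟩ + ⅙ h(X, Y) ‖F‖²`. -/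
structure IsBosonicBackground (h : BilinField I M) (vol : DiffForm I M 11)
    (F : DiffForm I M 4) : Prop where
  lorentzian : IsMetric h 1 10
  volumeForm : IsVolumeForm h vol
  smooth : F.Smooth
  closed : F.d = 0
  maxwell : (DiffForm.star (m := 7) (k := 4) h vol F).d =
    ((1 / 2 : ℝ) • DiffForm.wedge F F : DiffForm I M 8)
  einstein : ∀ (x : M) (X Y : TangentSpace I x),
    h.ricci x X Y = -(1 / 2) * h.inner x (F.contract x X) (F.contract x Y) +
      1 / 6 * h x X Y * h.inner x (F x) (F x)

end Tensors

end Sugra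

end

/-!
The flux is `F = c ⋆₆ω`, pulled back from the Kähler factor, and the field equations decouple.

Pointwise, `⋆₆ω = ±½ ω ∧ ω` (`exists_hodge_eq_halfSq`), which is checked in a unitary basis. The three
algebraic facts about `φ = ⋆₆ω` used below are `⟨Y ⌟ φ, Z ⌟ φ⟩ = 2 g(Y, Z)`, `‖φ‖² = 3` and
`⋆₆φ = ω` (`IsHermitian6.formInner_contract`, `IsHermitian6.formInner_self`,
`IsHermitian6.hodge_hodge`). They are obtained by index contractions with dual families, a notion
(`IsDualPair`) in terms of which scalar products and Hodge stars can be computed without reference to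
a basis, and which behaves well under isometries and orthogonal sums.

The equations for `F` alone always hold. `dF = 0` follows from `dω = 0`, as `F` is locally a constant
multiple of `ω ∧ ω` (`IsKahler.extDeriv_star`). `F ∧ F` is an eight-form pulled back from a
six-dimensional manifold, hence zero. The eleven-dimensional `⋆F` is a constant multiple of
`vol ∧ ⋆₆F`, that is, of `vol ∧ ω`, where `vol` is the volume form of the Lorentzian factor
(`exists_hodge_comp_snd_apply`, `hodge_comp_snd_eq_zero`); it is closed because both `vol` and `ω` are
(`extDeriv_eq_zero_of_prod`).

The Einstein equation remains. The Ricci tensor of the product metric is the sum of the Ricci tensors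
of the factors (`BilinField.ricci_prodMetric`), and by the algebraic identities above its right-hand
side is `-½ · 2c² g + ⅙ · 3c² (gN + g) = ½c² gN - ½c² g` (`einstein_rhs`). Comparing the components
along the two factors gives the two Einstein conditions.
-/

namespace Sugra

/-! ### Dual families and invariance of contractions -/

section DualFamilies

/-- Two finite families of pairs of vectors represent the same element of `E ⊗ E'`. -/
def SameTensor {E E' ι κ : Type*} [AddCommGroup E] [Module ℝ E] [AddCommGroup E'] [Module ℝ E']
    [Fintype ι] [Fintype κ] (u : ι → E) (v : ι → E') (u' : κ → E) (v' : κ → E') : Prop :=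
  ∀ B : E →ₗ[ℝ] E' →ₗ[ℝ] ℝ, ∑ i, B (u i) (v i) = ∑ j, B (u' j) (v' j)

theorem sum_fin_succ_fun {A ι : Type*} [AddCommMonoid A] [Fintype ι] {k : ℕ}
    (f : (Fin (k + 1) → ι) → A) :
    ∑ i, f i = ∑ a, ∑ i : Fin k → ι, f (Fin.cons a i) := by
  rw [← Fintype.sum_prod_type']
  exact (Equiv.sum_comp (Fin.consEquiv fun _ => ι) f).symm

theorem sum_fin_two_fun {A κ : Type*} [AddCommMonoid A] [Fintype κ] (f : (Fin 2 → κ) → A) :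
    ∑ i, f i = ∑ i, ∑ j, f ![i, j] := by
  rw [sum_fin_succ_fun]
  refine Finset.sum_congr rfl fun i _ => ?_
  rw [sum_fin_succ_fun]
  refine Finset.sum_congr rfl fun j _ => ?_
  rw [Finset.univ_unique, Finset.sum_singleton]
  rfl

theorem sum_fin_three_fun {A κ : Type*} [AddCommMonoid A] [Fintype κ] (f : (Fin 3 → κ) → A) :
    ∑ i, f i = ∑ i, ∑ j, ∑ k, f ![i, j, k] := by
  rw [sum_fin_succ_fun]
  refine Finset.sum_congr rfl fun i _ => ?_
  rw [sum_fin_two_fun]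
  rfl

theorem sum_fin_four_fun {A κ : Type*} [AddCommMonoid A] [Fintype κ] (f : (Fin 4 → κ) → A) :
    ∑ i, f i = ∑ i, ∑ j, ∑ k, ∑ l, f ![i, j, k, l] := by
  rw [sum_fin_succ_fun]
  refine Finset.sum_congr rfl fun i _ => ?_
  rw [sum_fin_three_fun]
  rfl

/-- Full contractions of two multilinear maps depend only on the tensor along which they are
contracted. -/
theorem SameTensor.sum_mul {E E' ι κ : Type*} [AddCommGroup E] [Module ℝ E] [AddCommGroup E']
    [Module ℝ E'] [Fintype ι] [Fintype κ] {u : ι → E} {v : ι → E'} {u' : κ → E} {v' : κ → E'}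
    (H : SameTensor u v u' v') {k : ℕ} (α : MultilinearMap ℝ (fun _ : Fin k => E) ℝ)
    (β : MultilinearMap ℝ (fun _ : Fin k => E') ℝ) :
    ∑ i : Fin k → ι, α (fun a => u (i a)) * β (fun a => v (i a)) =
      ∑ j : Fin k → κ, α (fun a => u' (j a)) * β (fun a => v' (j a)) := by
  induction k with
  | zero =>
    simp only [Finset.univ_unique, Finset.sum_singleton]
    congr 2 <;> exact Subsingleton.elim _ _
  | succ k ih =>
    rw [sum_fin_succ_fun, sum_fin_succ_fun]
    have h1 : ∀ a : ι, ∑ i : Fin k → ι, α (fun b => u ((Fin.cons a i : Fin (k + 1) → ι) b)) *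
          β (fun b => v ((Fin.cons a i : Fin (k + 1) → ι) b)) =
        ∑ j : Fin k → κ, α (Fin.cons (u a) fun b => u' (j b)) *
          β (Fin.cons (v a) fun b => v' (j b)) := by
      intro a
      have := ih (α.curryLeft (u a)) (β.curryLeft (v a))
      simp only [MultilinearMap.curryLeft_apply] at this
      rw [← this]
      refine Finset.sum_congr rfl fun i _ => ?_
      congr 2 <;> (funext b; refine Fin.cases ?_ (fun b => ?_) b <;> simp)
    rw [Finset.sum_congr rfl fun a _ => h1 a, Finset.sum_comm]
    rw [Finset.sum_comm (s := (Finset.univ : Finset κ))]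
    refine Finset.sum_congr rfl fun j _ => ?_
    have : ∑ i, α (Fin.cons (u i) fun b => u' (j b)) * β (Fin.cons (v i) fun b => v' (j b)) =
        ∑ i, α (Fin.cons (u' i) fun b => u' (j b)) * β (Fin.cons (v' i) fun b => v' (j b)) :=
      H (LinearMap.mk₂ ℝ
      (fun x y => α (Fin.cons x fun b => u' (j b)) * β (Fin.cons y fun b => v' (j b)))
      (fun x x' y => by
        simp only [← MultilinearMap.curryLeft_apply, map_add, add_apply, add_mul])
      (fun c x y => by
        simp only [← MultilinearMap.curryLeft_apply, map_smul, smul_apply,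
          smul_eq_mul, mul_assoc])
      (fun x y y' => by
        simp only [← MultilinearMap.curryLeft_apply, map_add, add_apply, mul_add])
      (fun c x y => by
        simp only [← MultilinearMap.curryLeft_apply, map_smul, smul_apply,
          smul_eq_mul, mul_left_comm]))
    rw [this]
    refine Finset.sum_congr rfl fun i _ => ?_
    congr 2 <;> (funext b; refine Fin.cases ?_ (fun b => ?_) b <;> simp)

variable {E : Type*} [NormedAddCommGroup E] [NormedSpace ℝ E]

/-- A nondegenerate symmetric bilinear form. -/
structure IsScalarProduct (g : E →L[ℝ] E →L[ℝ] ℝ) : Prop where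
  symm : ∀ x y, g x y = g y x
  nondeg : ∀ x, (∀ y, g x y = 0) → x = 0

/-- The families `u` and `v` are dual for `g`: `∑ᵢ uᵢ ⊗ vᵢ` and `∑ᵢ vᵢ ⊗ uᵢ` are the inverse
of `g`. The families need not be bases. -/
structure IsDualPair (g : E →L[ℝ] E →L[ℝ] ℝ) {ι : Type*} [Fintype ι] (u v : ι → E) : Prop where
  sum_left : ∀ w, ∑ i, g w (u i) • v i = w
  sum_right : ∀ w, ∑ i, g w (v i) • u i = w

theorem IsDualPair.swap {g : E →L[ℝ] E →L[ℝ] ℝ} {ι : Type*} [Fintype ι] {u v : ι → E}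
    (h : IsDualPair g u v) : IsDualPair g v u := ⟨h.sum_right, h.sum_left⟩

/-- Any two pairs of dual families represent the same tensor, the inverse of `g`. -/
theorem IsDualPair.sameTensor {g : E →L[ℝ] E →L[ℝ] ℝ} (hs : ∀ x y, g x y = g y x)
    {ι κ : Type*} [Fintype ι] [Fintype κ]
    {u v : ι → E} {u' v' : κ → E} (h : IsDualPair g u v) (h' : IsDualPair g u' v') :
    SameTensor u v u' v' := by
  intro B
  calc ∑ i, B (u i) (v i) = ∑ i, B (u i) (∑ j, g (v i) (u' j) • v' j) := by
        simp only [h'.sum_left]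
    _ = ∑ j, B (∑ i, g (u' j) (v i) • u i) (v' j) := by
        simp only [map_sum, map_smul, LinearMap.sum_apply, LinearMap.smul_apply]
        rw [Finset.sum_comm]
        simp only [hs]
    _ = _ := by simp only [h.sum_right]

theorem IsDualPair.isScalarProduct {g : E →L[ℝ] E →L[ℝ] ℝ} (hs : ∀ x y, g x y = g y x)
    {ι : Type*} [Fintype ι] {u v : ι → E} (h : IsDualPair g u v) : IsScalarProduct g :=
  ⟨hs, fun x hx => by rw [← h.sum_left x]; simp [hx]⟩

/-- A basis orthogonal for `g` consisting of vectors of square `±1`, together with the basis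
rescaled by these squares. -/
theorem IsDualPair.of_orthonormal {g : E →L[ℝ] E →L[ℝ] ℝ} {ι : Type*} [Fintype ι]
    (b : Module.Basis ι ℝ E) (h0 : ∀ i j, i ≠ j → g (b i) (b j) = 0)
    (h1 : ∀ i, g (b i) (b i) * g (b i) (b i) = 1) :
    IsDualPair g b (fun i => g (b i) (b i) • b i) := by
  classical
  constructor
  · intro w
    have : ((∑ i, (LinearMap.smulRight ((g.flip (b i)) : E →ₗ[ℝ] ℝ) (g (b i) (b i) • b i))) :
        E →ₗ[ℝ] E) = LinearMap.id := by
      refine b.ext fun j => ?_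
      simp only [LinearMap.sum_apply, LinearMap.smulRight_apply, LinearMap.id_apply]
      rw [Finset.sum_eq_single j]
      · simp [smul_smul, h1]
      · intro i _ hij
        simp [h0 j i (Ne.symm hij)]
      · simp
    have := LinearMap.congr_fun this w
    simpa using this
  · intro w
    have : ((∑ i, (LinearMap.smulRight ((g.flip (g (b i) (b i) • b i)) : E →ₗ[ℝ] ℝ) (b i))) :
        E →ₗ[ℝ] E) = LinearMap.id := by
      refine b.ext fun j => ?_
      simp only [LinearMap.sum_apply, LinearMap.smulRight_apply, LinearMap.id_apply]
      rw [Finset.sum_eq_single j]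
      · simp [h1]
      · intro i _ hij
        simp [h0 j i (Ne.symm hij)]
      · simp
    have := LinearMap.congr_fun this w
    simpa using this

/-- Dual families are carried to dual families by an isometry. -/
theorem IsDualPair.map {E' : Type*} [NormedAddCommGroup E'] [NormedSpace ℝ E']
    {g : E →L[ℝ] E →L[ℝ] ℝ} {g' : E' →L[ℝ] E' →L[ℝ] ℝ} (L : E ≃L[ℝ] E')
    (hL : ∀ x y, g x y = g' (L x) (L y)) {ι : Type*} [Fintype ι] {u v : ι → E}
    (h : IsDualPair g u v) : IsDualPair g' (fun i => L (u i)) (fun i => L (v i)) := by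
  constructor
  · intro w
    have := congrArg L (h.sum_left (L.symm w))
    simpa [hL] using this
  · intro w
    have := congrArg L (h.sum_right (L.symm w))
    simpa [hL] using this

/-! ### Forms: the scalar product and the Hodge star in terms of dual families -/

variable [FiniteDimensional ℝ E]

theorem IsScalarProduct.det_ne_zero {g : E →L[ℝ] E →L[ℝ] ℝ} (hg : IsScalarProduct g) :
    (Matrix.of fun a b => g (Module.finBasis ℝ E a) (Module.finBasis ℝ E b)).det ≠ 0 := by
  set b := Module.finBasis ℝ E
  intro h0
  obtain ⟨x, hx, hx'⟩ := Matrix.exists_mulVec_eq_zero_iff.2 h0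
  apply hx
  have hw : ∑ j, x j • b j = 0 := by
    apply hg.nondeg
    intro y
    have h1 : ∀ i, g (∑ j, x j • b j) (b i) = 0 := by
      intro i
      have := congrFun hx' i
      rw [hg.symm]
      simpa [Matrix.mulVec, dotProduct, mul_comm] using this
    rw [← b.sum_repr y, map_sum]
    exact Finset.sum_eq_zero fun i _ => by rw [map_smul, h1, smul_zero]
  have := b.linearIndependent
  rw [Fintype.linearIndependent_iff] at this
  funext i
  exact this x hw i

/-- The basis used to define contractions and its raised companion are dual families; every
contraction may thus be computed with a pair of dual families chosen at will. -/
theorem IsScalarProduct.isDualPair_raisedBasis {g : E →L[ℝ] E →L[ℝ] ℝ} (hg : IsScalarProduct g) :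
    IsDualPair g (Module.finBasis ℝ E) (raisedBasis g) := by
  classical
  set b := Module.finBasis ℝ E with hb
  set G : Matrix (Fin (Module.finrank ℝ E)) (Fin (Module.finrank ℝ E)) ℝ :=
    Matrix.of fun i j => g (b i) (b j) with hG
  have hsymm : G.transpose = G := by
    ext i j; simp [hG, hg.symm (b i) (b j)]
  have hdet : IsUnit G.det := isUnit_iff_ne_zero.2 hg.det_ne_zero
  have hmul : G * G⁻¹ = 1 := Matrix.mul_nonsing_inv _ hdet
  have hinvsymm : (G⁻¹).transpose = G⁻¹ := by rw [Matrix.transpose_nonsing_inv, hsymm]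
  have key : ∀ a i, g (b a) (raisedBasis g i) = (1 : Matrix _ _ ℝ) a i := by
    intro a i
    rw [← hmul, Matrix.mul_apply]
    simp only [raisedBasis, map_sum, map_smul, smul_eq_mul]
    refine Finset.sum_congr rfl fun j _ => ?_
    rw [mul_comm]
    congr 1
    exact congrFun (congrFun hinvsymm j) i
  constructor
  · intro w
    have : ((∑ i, (LinearMap.smulRight ((g.flip (b i)) : E →ₗ[ℝ] ℝ) (raisedBasis g i))) :
        E →ₗ[ℝ] E) = LinearMap.id := by
      refine b.ext fun a => ?_
      simp only [LinearMap.sum_apply, LinearMap.smulRight_apply, LinearMap.id_apply,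
        ContinuousLinearMap.coe_coe, ContinuousLinearMap.flip_apply]
      simp only [raisedBasis, Finset.smul_sum, smul_smul]
      rw [Finset.sum_comm]
      have : ∀ j, ∑ i, (g (b a) (b i) * G⁻¹ i j) • b j = (1 : Matrix _ _ ℝ) a j • b j := by
        intro j
        rw [← Finset.sum_smul, ← hmul, Matrix.mul_apply]
        rfl
      refine (Finset.sum_congr rfl fun j _ => this j).trans ?_
      simp [Matrix.one_apply]
    have := LinearMap.congr_fun this w
    simpa using this
  · intro w
    have : ((∑ i, (LinearMap.smulRight ((g.flip (raisedBasis g i)) : E →ₗ[ℝ] ℝ) (b i))) :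
        E →ₗ[ℝ] E) = LinearMap.id := by
      refine b.ext fun a => ?_
      simp only [LinearMap.sum_apply, LinearMap.smulRight_apply, LinearMap.id_apply,
        ContinuousLinearMap.coe_coe, ContinuousLinearMap.flip_apply, key]
      simp [Matrix.one_apply]
    have := LinearMap.congr_fun this w
    simpa using this

/-- The scalar product of forms may be computed with any pair of dual families. -/
theorem formInner_eq_sum {g : E →L[ℝ] E →L[ℝ] ℝ} (hs : ∀ x y, g x y = g y x)
    {ι : Type*} [Fintype ι] {u v : ι → E} (h : IsDualPair g u v) {k : ℕ}
    (α β : E [⋀^Fin k]→L[ℝ] ℝ) :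
    formInner g α β = (k.factorial : ℝ)⁻¹ *
      ∑ i : Fin k → ι, α (fun a => u (i a)) * β (fun a => v (i a)) := by
  have := ((h.isScalarProduct hs).isDualPair_raisedBasis.sameTensor hs h).sum_mul
    α.toMultilinearMap β.toMultilinearMap
  unfold formInner
  congr 1

/-- The concatenation `(w₁, …, w_k, v₁, …, v_m)`, indexed by `Fin (m + k)`. -/
def appendVec {X : Type*} {m k : ℕ} (w : Fin k → X) (v : Fin m → X) : Fin (m + k) → X :=
  fun i => Fin.append w v (Fin.cast (Nat.add_comm m k) i)

omit [FiniteDimensional ℝ E] in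
theorem insertVectors_apply {m : ℕ} : ∀ (k : ℕ) (τ : E [⋀^Fin (m + k)]→L[ℝ] ℝ) (w : Fin k → E)
    (v : Fin m → E), insertVectors k τ w v = τ (appendVec w v)
  | 0, τ, w, v => by
    unfold insertVectors
    congr 1
    funext i
    have : (Fin.cast (Nat.add_comm m 0) i) = Fin.natAdd 0 (i : Fin m) := by
      ext; simp
    simp only [appendVec, this, Fin.append_right]
  | k + 1, τ, w, v => by
    have hjlt : ∀ j : Fin (m + k), (j : ℕ) < m + k := fun j => j.2
    unfold insertVectors
    rw [insertVectors_apply k]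
    change τ (Fin.cons (w 0) _) = _
    congr 1
    funext i
    refine Fin.cases ?_ (fun j => ?_) (i : Fin (m + k + 1))
    · have : (Fin.cast (Nat.add_comm m (k + 1)) (0 : Fin (m + k + 1))) = Fin.castAdd m 0 := by
        ext; simp
      simp only [appendVec, Fin.cons_zero]
      erw [this]
      rw [Fin.append_left]
    · have := hjlt j
      simp only [appendVec, Fin.cons_succ]
      rcases lt_or_ge j.val k with hj | hj
      · have e1 : (Fin.cast (Nat.add_comm m k) j) = Fin.castAdd m ⟨j, hj⟩ := by ext; simp
        have e2 : (Fin.cast (Nat.add_comm m (k + 1)) j.succ) =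
          Fin.castAdd m ⟨j + 1, by omega⟩ := by ext; simp
        rw [e1, Fin.append_left]
        erw [e2]
        rw [Fin.append_left]
        rfl
      · have e1 : (Fin.cast (Nat.add_comm m k) j) = Fin.natAdd k ⟨j - k, by omega⟩ := by
          ext; simp; omega
        have e2 : (Fin.cast (Nat.add_comm m (k + 1)) j.succ) =
          Fin.natAdd (k + 1) ⟨j - k, by omega⟩ := by ext; simp; omega
        rw [e1, Fin.append_right]
        erw [e2]
        rw [Fin.append_right]

omit [FiniteDimensional ℝ E] in
/-- A form with its last arguments fixed is multilinear in the remaining ones. -/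
theorem exists_multilinear_appendVec {m k : ℕ} (τ : E [⋀^Fin (m + k)]→L[ℝ] ℝ) (v : Fin m → E) :
    ∃ μ : MultilinearMap ℝ (fun _ : Fin k => E) ℝ, ∀ w, μ w = τ (appendVec w v) := by
  let e : Fin (m + k) ≃ Fin m ⊕ Fin k :=
    (finCongr (Nat.add_comm m k)).trans (finSumFinEquiv.symm.trans (Equiv.sumComm _ _))
  refine ⟨(τ.toMultilinearMap.domDomCongr e).currySum v, fun w => ?_⟩
  rw [MultilinearMap.currySum_apply, MultilinearMap.domDomCongr_apply]
  change τ _ = _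
  congr 1
  funext i
  obtain ⟨j, rfl⟩ := e.symm.surjective i
  rcases j with j | j
  · simp [e, appendVec]
  · simp [e, appendVec]

theorem hodge_apply {g : E →L[ℝ] E →L[ℝ] ℝ} {m k : ℕ} (vol : E [⋀^Fin (m + k)]→L[ℝ] ℝ)
    (β : E [⋀^Fin k]→L[ℝ] ℝ) (w : Fin m → E) :
    hodge g vol β w = (k.factorial : ℝ)⁻¹ * ∑ i : Fin k → Fin (Module.finrank ℝ E),
      β (fun a => raisedBasis g (i a)) *
        insertVectors k vol (fun a => Module.finBasis ℝ E (i a)) w := by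
  simp only [hodge, ContinuousAlternatingMap.smul_apply, ContinuousAlternatingMap.sum_apply,
    smul_eq_mul]

/-- The Hodge star may be computed with any pair of dual families. -/
theorem hodge_eq_sum {g : E →L[ℝ] E →L[ℝ] ℝ} (hs : ∀ x y, g x y = g y x)
    {ι : Type*} [Fintype ι] {u v : ι → E} (h : IsDualPair g u v) {m k : ℕ}
    (vol : E [⋀^Fin (m + k)]→L[ℝ] ℝ) (β : E [⋀^Fin k]→L[ℝ] ℝ) (w : Fin m → E) :
    hodge g vol β w = (k.factorial : ℝ)⁻¹ * ∑ i : Fin k → ι,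
      β (fun a => v (i a)) * insertVectors k vol (fun a => u (i a)) w := by
  obtain ⟨μ, hμ⟩ := exists_multilinear_appendVec vol w
  have := ((h.isScalarProduct hs).isDualPair_raisedBasis.sameTensor hs h).sum_mul
    μ β.toMultilinearMap
  rw [hodge_apply]
  congr 1
  simp only [hμ, ← insertVectors_apply] at this
  simp only [mul_comm (β _)]
  exact this

/-- The Hodge star is natural under linear isomorphisms. -/
theorem hodge_comp {E' : Type*} [NormedAddCommGroup E'] [NormedSpace ℝ E']
    [FiniteDimensional ℝ E'] {g : E →L[ℝ] E →L[ℝ] ℝ} {g' : E' →L[ℝ] E' →L[ℝ] ℝ}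
    (hg' : IsScalarProduct g') (L : E ≃L[ℝ] E')
    (hL : ∀ x y, g x y = g' (L x) (L y)) {m k : ℕ}
    (vol : E' [⋀^Fin (m + k)]→L[ℝ] ℝ) (β : E' [⋀^Fin k]→L[ℝ] ℝ) :
    (hodge g' vol β).compContinuousLinearMap (L : E →L[ℝ] E') =
      hodge g (vol.compContinuousLinearMap (L : E →L[ℝ] E'))
        (β.compContinuousLinearMap (L : E →L[ℝ] E')) := by
  have hg : IsScalarProduct g := by
    refine ⟨fun x y => by rw [hL, hL, hg'.symm], fun x hx => ?_⟩
    apply L.injective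
    rw [map_zero]
    refine hg'.nondeg _ fun y => ?_
    have := hx (L.symm y)
    rwa [hL, L.apply_symm_apply] at this
  ext w
  rw [ContinuousAlternatingMap.compContinuousLinearMap_apply,
    hodge_eq_sum hg'.symm (hg.isDualPair_raisedBasis.map L hL), hodge_apply]
  congr 1
  refine Finset.sum_congr rfl fun i _ => ?_
  simp only [ContinuousAlternatingMap.compContinuousLinearMap_apply, insertVectors_apply]
  congr 2
  funext a
  simp only [appendVec, Function.comp]
  generalize Fin.cast (Nat.add_comm m k) a = a
  refine Fin.addCases (fun a => ?_) (fun a => ?_) a <;> simp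

end DualFamilies

/-! ### Wedge products -/

section Wedge

variable {E : Type*} [NormedAddCommGroup E] [NormedSpace ℝ E]

theorem wedge_apply {k l : ℕ} (α : E [⋀^Fin k]→L[ℝ] ℝ) (β : E [⋀^Fin l]→L[ℝ] ℝ)
    (v : Fin (k + l) → E) :
    wedge α β v = ((k.factorial * l.factorial : ℝ)⁻¹) * ∑ σ : Equiv.Perm (Fin (k + l)),
      Equiv.Perm.sign σ • (α (fun i => v (σ (Fin.castAdd l i))) *
        β (fun j => v (σ (Fin.natAdd k j)))) := by
  simp only [wedge, ContinuousAlternatingMap.smul_apply, smul_eq_mul,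
    ContinuousMultilinearMap.alternatization_apply_apply]
  rfl

/-- If `α` vanishes as soon as one of its arguments is among the last `l` vectors, only the
permutations preserving the two blocks contribute to the wedge product. -/
theorem wedge_apply_of_vanish {k l : ℕ} (α : E [⋀^Fin k]→L[ℝ] ℝ) (β : E [⋀^Fin l]→L[ℝ] ℝ)
    (v : Fin (k + l) → E)
    (hα : ∀ (w : Fin k → E) (a : Fin k) (j : Fin l), w a = v (Fin.natAdd k j) → α w = 0) :
    wedge α β v = α (fun i => v (Fin.castAdd l i)) * β (fun j => v (Fin.natAdd k j)) := by
  classical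
  rw [wedge_apply]
  let e : Equiv.Perm (Fin k ⊕ Fin l) ≃ Equiv.Perm (Fin (k + l)) := finSumFinEquiv.permCongr
  rw [← Equiv.sum_comp e]
  have hsub : ∀ σ : Equiv.Perm (Fin k ⊕ Fin l), σ ∉ (Equiv.Perm.sumCongrHom (Fin k) (Fin l)).range →
      Equiv.Perm.sign (e σ) • (α (fun i => v (e σ (Fin.castAdd l i))) *
        β (fun j => v (e σ (Fin.natAdd k j)))) = 0 := by
    intro σ hσ
    have : ¬ Set.MapsTo σ (Set.range Sum.inl) (Set.range Sum.inl) := fun h =>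
      hσ (Equiv.Perm.mem_sumCongrHom_range_of_perm_mapsTo_inl h)
    simp only [Set.MapsTo, not_forall] at this
    obtain ⟨x, ⟨a, rfl⟩, hx⟩ := this
    obtain ⟨j, hj⟩ : ∃ j, σ (Sum.inl a) = Sum.inr j := by
      rcases h : σ (Sum.inl a) with b | b
      · exact absurd ⟨b, h.symm⟩ hx
      · exact ⟨b, rfl⟩
    rw [hα _ a j, zero_mul, smul_zero]
    simp [e, Equiv.permCongr_apply, hj]
  rw [← Finset.sum_subset (Finset.subset_univ
    (Finset.univ.image (Equiv.Perm.sumCongrHom (Fin k) (Fin l)))) (fun σ _ hσ => hsub σ (by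
      simpa [MonoidHom.mem_range] using hσ)),
    Finset.sum_image (Equiv.Perm.sumCongrHom_injective.injOn)]
  have hterm : ∀ p : Equiv.Perm (Fin k) × Equiv.Perm (Fin l),
      Equiv.Perm.sign (e (Equiv.Perm.sumCongrHom _ _ p)) •
        (α (fun i => v (e (Equiv.Perm.sumCongrHom _ _ p) (Fin.castAdd l i))) *
        β (fun j => v (e (Equiv.Perm.sumCongrHom _ _ p) (Fin.natAdd k j)))) =
      α (fun i => v (Fin.castAdd l i)) * β (fun j => v (Fin.natAdd k j)) := by
    rintro ⟨p, q⟩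
    have hs : Equiv.Perm.sign (e (Equiv.Perm.sumCongrHom _ _ (p, q))) =
        Equiv.Perm.sign p * Equiv.Perm.sign q := by
      simp only [e]
      rw [Equiv.Perm.sign_permCongr, Equiv.Perm.sumCongrHom_apply, Equiv.Perm.sign_sumCongr]
    have h1 : (fun i => v (e (Equiv.Perm.sumCongrHom _ _ (p, q)) (Fin.castAdd l i))) =
        (fun i => v (Fin.castAdd l i)) ∘ p := by
      funext i; simp [e, Equiv.permCongr_apply]
    have h2 : (fun i => v (e (Equiv.Perm.sumCongrHom _ _ (p, q)) (Fin.natAdd k i))) =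
        (fun i => v (Fin.natAdd k i)) ∘ q := by
      funext i; simp [e, Equiv.permCongr_apply]
    rw [hs, h1, h2]
    have e1 := α.toAlternatingMap.map_perm (fun i => v (Fin.castAdd l i)) p
    have e2 := β.toAlternatingMap.map_perm (fun i => v (Fin.natAdd k i)) q
    simp only [ContinuousAlternatingMap.coe_toAlternatingMap] at e1 e2
    rw [e1, e2, smul_mul_smul_comm, smul_smul]
    rcases Int.units_eq_one_or (Equiv.Perm.sign p) with h | h <;>
      rcases Int.units_eq_one_or (Equiv.Perm.sign q) with h' | h' <;> simp [h, h']
  rw [Finset.sum_congr rfl fun p _ => hterm p, Finset.sum_const, Finset.card_univ,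
    Fintype.card_prod, Fintype.card_perm, Fintype.card_perm, Fintype.card_fin, Fintype.card_fin,
    nsmul_eq_mul]
  have := Nat.factorial_ne_zero k
  have := Nat.factorial_ne_zero l
  push_cast
  field_simp

end Wedge

/-! ### Products of spaces with scalar product -/

section Product

variable {E₁ : Type*} [NormedAddCommGroup E₁] [NormedSpace ℝ E₁]
  {E₂ : Type*} [NormedAddCommGroup E₂] [NormedSpace ℝ E₂]

/-- The orthogonal sum of two bilinear forms. -/
noncomputable def prodScalar (g₁ : E₁ →L[ℝ] E₁ →L[ℝ] ℝ) (g₂ : E₂ →L[ℝ] E₂ →L[ℝ] ℝ) :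
    (E₁ × E₂) →L[ℝ] (E₁ × E₂) →L[ℝ] ℝ :=
  g₁.bilinearComp (.fst ℝ E₁ E₂) (.fst ℝ E₁ E₂) + g₂.bilinearComp (.snd ℝ E₁ E₂) (.snd ℝ E₁ E₂)

@[simp] theorem prodScalar_apply (g₁ : E₁ →L[ℝ] E₁ →L[ℝ] ℝ) (g₂ : E₂ →L[ℝ] E₂ →L[ℝ] ℝ)
    (x y : E₁ × E₂) : prodScalar g₁ g₂ x y = g₁ x.1 y.1 + g₂ x.2 y.2 := rfl

theorem IsScalarProduct.prod {g₁ : E₁ →L[ℝ] E₁ →L[ℝ] ℝ} {g₂ : E₂ →L[ℝ] E₂ →L[ℝ] ℝ}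
    (h₁ : IsScalarProduct g₁) (h₂ : IsScalarProduct g₂) : IsScalarProduct (prodScalar g₁ g₂) := by
  refine ⟨fun x y => by simp [h₁.symm x.1, h₂.symm x.2], fun x hx => Prod.ext ?_ ?_⟩
  · refine h₁.nondeg _ fun y => ?_
    simpa using hx (y, 0)
  · refine h₂.nondeg _ fun y => ?_
    simpa using hx (0, y)

theorem IsDualPair.snd {g₁ : E₁ →L[ℝ] E₁ →L[ℝ] ℝ} {g₂ : E₂ →L[ℝ] E₂ →L[ℝ] ℝ}
    {ι : Type*} [Fintype ι] {u v : ι → E₁ × E₂} (h : IsDualPair (prodScalar g₁ g₂) u v) :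
    IsDualPair g₂ (fun i => (u i).2) (fun i => (v i).2) := by
  constructor
  · intro w
    have := congrArg Prod.snd (h.sum_left (0, w))
    simpa [Prod.snd_sum] using this
  · intro w
    have := congrArg Prod.snd (h.sum_right (0, w))
    simpa [Prod.snd_sum] using this

/-- With the second leg projected to the second factor, the inverse of an orthogonal sum is the inverse
of the second summand; this is why contractions with a form pulled back from the second factor only
see that factor. -/
theorem IsDualPair.sameTensor_snd {g₁ : E₁ →L[ℝ] E₁ →L[ℝ] ℝ} {g₂ : E₂ →L[ℝ] E₂ →L[ℝ] ℝ}
    (hs : ∀ x y, g₂ x y = g₂ y x)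
    {ι κ : Type*} [Fintype ι] [Fintype κ] {u v : ι → E₁ × E₂} {u' v' : κ → E₂}
    (h : IsDualPair (prodScalar g₁ g₂) u v) (h' : IsDualPair g₂ u' v') :
    SameTensor u (fun i => (v i).2) (fun j => ((0 : E₁), u' j)) v' := by
  intro B
  calc ∑ i, B (u i) (v i).2 = ∑ i, B (u i) (∑ j, g₂ (v i).2 (u' j) • v' j) := by
        simp only [h'.sum_left]
    _ = ∑ j, B (∑ i, prodScalar g₁ g₂ ((0 : E₁), u' j) (v i) • u i) (v' j) := by
        simp only [map_sum, map_smul, LinearMap.sum_apply, LinearMap.smul_apply]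
        rw [Finset.sum_comm]
        simp [hs]
    _ = _ := by simp only [h.sum_right]

theorem wedge_prod_apply {k l : ℕ} (A : E₁ [⋀^Fin k]→L[ℝ] ℝ) (B : E₂ [⋀^Fin l]→L[ℝ] ℝ)
    (v : Fin (k + l) → E₁ × E₂) (hv : ∀ j, (v (Fin.natAdd k j)).1 = 0) :
    wedge (A.compContinuousLinearMap (.fst ℝ E₁ E₂)) (B.compContinuousLinearMap (.snd ℝ E₁ E₂)) v =
      A (fun i => (v (Fin.castAdd l i)).1) * B (fun j => (v (Fin.natAdd k j)).2) := by
  rw [wedge_apply_of_vanish]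
  · rfl
  · intro w a j hw
    refine A.map_coord_zero a ?_
    simp [hw, hv]

open Classical in
/-- Fewer than `k` vectors with nonzero first component cannot fill the form of degree `k` on the
first factor. -/
theorem wedge_prod_eq_zero {k l : ℕ} (A : E₁ [⋀^Fin k]→L[ℝ] ℝ) (B : E₂ [⋀^Fin l]→L[ℝ] ℝ)
    (v : Fin (k + l) → E₁ × E₂) (hv : (Finset.univ.filter fun i => (v i).1 ≠ 0).card < k) :
    wedge (A.compContinuousLinearMap (.fst ℝ E₁ E₂)) (B.compContinuousLinearMap (.snd ℝ E₁ E₂)) v =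
      0 := by
  rw [wedge_apply, Finset.sum_eq_zero, mul_zero]
  intro σ _
  obtain ⟨a, ha⟩ : ∃ a : Fin k, (v (σ (Fin.castAdd l a))).1 = 0 := by
    by_contra! hcon
    have : (Finset.univ : Finset (Fin k)).card ≤
        (Finset.univ.filter fun i => (v i).1 ≠ 0).card :=
      Finset.card_le_card_of_injOn (fun a => σ (Fin.castAdd l a)) (fun a _ => by simp [hcon a])
        (fun a _ b _ hab => Fin.castAdd_injective k l (σ.injective hab))
    rw [Finset.card_univ, Fintype.card_fin] at this
    omega
  have : A.compContinuousLinearMap (.fst ℝ E₁ E₂) (fun i => v (σ (Fin.castAdd l i))) = 0 :=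
    A.map_coord_zero a ha
  rw [this, zero_mul, smul_zero]

/-- The property `vol² = |det g|` need only be checked on one basis. -/
theorem vol_sq_eq_of_basis {E : Type*} [NormedAddCommGroup E] [NormedSpace ℝ E]
    {n : ℕ} (g : E →L[ℝ] E →L[ℝ] ℝ) (vol : E [⋀^Fin n]→L[ℝ] ℝ) (b : Module.Basis (Fin n) ℝ E)
    (hb : (vol b) ^ 2 = |(Matrix.of fun i j => g (b i) (b j)).det|) (v : Fin n → E) :
    (vol v) ^ 2 = |(Matrix.of fun i j => g (v i) (v j)).det| := by
  have h1 : vol v = vol b * b.det v := by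
    have := congrArg (fun f => f v) (vol.toAlternatingMap.eq_smul_basis_det b)
    simpa using this
  have h2 : (Matrix.of fun i j => g (v i) (v j)) =
      (b.toMatrix v).transpose * (Matrix.of fun i j => g (b i) (b j)) * b.toMatrix v := by
    ext i j
    have hv : ∀ j, v j = ∑ a, b.toMatrix v a j • b a := fun j => (b.sum_toMatrix_smul_self v j).symm
    rw [Matrix.of_apply, hv i, hv j]
    simp only [map_sum, map_smul, Matrix.mul_apply, Matrix.transpose_apply, Matrix.of_apply,
      sum_apply, smul_apply, smul_eq_mul, Finset.sum_mul, Finset.mul_sum]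
    refine Finset.sum_congr rfl fun a _ => Finset.sum_congr rfl fun c _ => ?_
    ring
  rw [h2, Matrix.det_mul, Matrix.det_mul, Matrix.det_transpose, h1, Module.Basis.det_apply,
    mul_pow, hb, mul_comm (Matrix.det _), mul_assoc, abs_mul, ← pow_two, abs_pow, sq_abs]

/-- The product of two volume forms is a volume form of the orthogonal sum. -/
theorem vol_sq_eq_prod {k l : ℕ} {g₁ : E₁ →L[ℝ] E₁ →L[ℝ] ℝ} {g₂ : E₂ →L[ℝ] E₂ →L[ℝ] ℝ}
    (A : E₁ [⋀^Fin k]→L[ℝ] ℝ) (B : E₂ [⋀^Fin l]→L[ℝ] ℝ)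
    (hA : ∀ v, (A v) ^ 2 = |(Matrix.of fun i j => g₁ (v i) (v j)).det|)
    (hB : ∀ v, (B v) ^ 2 = |(Matrix.of fun i j => g₂ (v i) (v j)).det|)
    (b₁ : Module.Basis (Fin k) ℝ E₁) (b₂ : Module.Basis (Fin l) ℝ E₂) (v : Fin (k + l) → E₁ × E₂) :
    (wedge (A.compContinuousLinearMap (.fst ℝ E₁ E₂))
      (B.compContinuousLinearMap (.snd ℝ E₁ E₂)) v) ^ 2 =
      |(Matrix.of fun i j => prodScalar g₁ g₂ (v i) (v j)).det| := by
  revert v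
  have hl : ∀ i, (b₁.prod b₂).reindex finSumFinEquiv (Fin.castAdd l i) = (b₁ i, 0) := by
    intro i
    simp only [Module.Basis.reindex_apply, finSumFinEquiv_symm_apply_castAdd]
    ext <;> simp
  have hr : ∀ j, (b₁.prod b₂).reindex finSumFinEquiv (Fin.natAdd k j) = (0, b₂ j) := by
    intro i
    simp only [Module.Basis.reindex_apply, finSumFinEquiv_symm_apply_natAdd]
    ext <;> simp
  refine vol_sq_eq_of_basis _ _ ((b₁.prod b₂).reindex finSumFinEquiv) ?_
  rw [wedge_prod_apply _ _ _ (fun j => by rw [hr]), mul_pow]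
  simp only [hl, hr, hA, hB]
  rw [← abs_mul, ← Matrix.det_fromBlocks_zero₂₁ _ 0 _,
    ← Matrix.det_submatrix_equiv_self finSumFinEquiv
      (Matrix.of fun i j => prodScalar g₁ g₂ _ _)]
  congr 2
  ext i j
  rcases i with i | i <;> rcases j with j | j <;> simp [hl, hr, -Module.Basis.coe_reindex]

variable [FiniteDimensional ℝ E₁] [FiniteDimensional ℝ E₂]

theorem formInner_comp_snd {g₁ : E₁ →L[ℝ] E₁ →L[ℝ] ℝ} {g₂ : E₂ →L[ℝ] E₂ →L[ℝ] ℝ}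
    (h₁ : IsScalarProduct g₁) (h₂ : IsScalarProduct g₂) {k : ℕ} (α β : E₂ [⋀^Fin k]→L[ℝ] ℝ) :
    formInner (prodScalar g₁ g₂) (α.compContinuousLinearMap (.snd ℝ E₁ E₂))
      (β.compContinuousLinearMap (.snd ℝ E₁ E₂)) = formInner g₂ α β := by
  rw [formInner_eq_sum h₂.symm (h₁.prod h₂).isDualPair_raisedBasis.snd]
  rfl

theorem hodge_comp_snd {g₁ : E₁ →L[ℝ] E₁ →L[ℝ] ℝ} {g₂ : E₂ →L[ℝ] E₂ →L[ℝ] ℝ}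
    (h₁ : IsScalarProduct g₁) (h₂ : IsScalarProduct g₂) {m k : ℕ}
    (vol : (E₁ × E₂) [⋀^Fin (m + k)]→L[ℝ] ℝ) (β : E₂ [⋀^Fin k]→L[ℝ] ℝ) (w : Fin m → E₁ × E₂) :
    hodge (prodScalar g₁ g₂) vol (β.compContinuousLinearMap (.snd ℝ E₁ E₂)) w =
      (k.factorial : ℝ)⁻¹ * ∑ i : Fin k → Fin (Module.finrank ℝ E₂),
        β (fun a => raisedBasis g₂ (i a)) *
          insertVectors k vol (fun a => ((0 : E₁), Module.finBasis ℝ E₂ (i a))) w := by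
  obtain ⟨μ, hμ⟩ := exists_multilinear_appendVec vol w
  have := ((h₁.prod h₂).isDualPair_raisedBasis.sameTensor_snd h₂.symm
    h₂.isDualPair_raisedBasis).sum_mul μ β.toMultilinearMap
  rw [hodge_apply]
  congr 1
  simp only [hμ, ← insertVectors_apply] at this
  simp only [mul_comm (β _), mul_comm (ContinuousAlternatingMap.compContinuousLinearMap _ _ _)]
  exact this

end Product

/-! ### The Hodge star of a form pulled back from the second factor -/

section HodgeProduct

variable {E₁ : Type*} [NormedAddCommGroup E₁] [NormedSpace ℝ E₁]
  {E₂ : Type*} [NormedAddCommGroup E₂] [NormedSpace ℝ E₂]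

/-- The permutation of eleven vectors moving the first four behind the next five. -/
def blockPerm : Equiv.Perm (Fin 11) where
  toFun := ![4, 5, 6, 7, 8, 0, 1, 2, 3, 9, 10]
  invFun := ![5, 6, 7, 8, 0, 1, 2, 3, 4, 9, 10]
  left_inv := by decide
  right_inv := by decide

theorem eq_sign_mul_apply_comp {E : Type*} [NormedAddCommGroup E] [NormedSpace ℝ E] {n : ℕ}
    (τ : E [⋀^Fin n]→L[ℝ] ℝ) (y : Fin n → E) (σ : Equiv.Perm (Fin n)) :
    τ y = (Equiv.Perm.sign σ : ℤ) * τ (fun i => y (σ i)) := by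
  have h1 : τ (fun i => y (σ i)) = Equiv.Perm.sign σ • τ y := τ.toAlternatingMap.map_perm y σ
  rw [h1]
  rcases Int.units_eq_one_or (Equiv.Perm.sign σ) with h | h <;> simp [h]

/-- The product `vol₁ ∧ vol₂` of a form of degree five on the first factor with a form of degree
six on the second one. -/
noncomputable def prodVol (A : E₁ [⋀^Fin 5]→L[ℝ] ℝ) (B : E₂ [⋀^Fin 6]→L[ℝ] ℝ) :
    (E₁ × E₂) [⋀^Fin 11]→L[ℝ] ℝ :=
  wedge (k := 5) (l := 6) (A.compContinuousLinearMap (.fst ℝ E₁ E₂))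
    (B.compContinuousLinearMap (.snd ℝ E₁ E₂))

/-- Inserting four vectors of the second factor into `vol₁ ∧ vol₂`; the constant `κ` is the sign of
the permutation sorting the eleven arguments. -/
theorem exists_prodVol_appendVec : ∃ κ : ℝ, ∀ (A : E₁ [⋀^Fin 5]→L[ℝ] ℝ) (B : E₂ [⋀^Fin 6]→L[ℝ] ℝ)
    {ι : Type} (u : ι → E₂) (i : Fin 4 → ι) (z : Fin 7 → E₁ × E₂) (_ : (z 5).1 = 0)
    (_ : (z 6).1 = 0),
    insertVectors (m := 7) 4 (prodVol A B) (fun a => ((0 : E₁), u (i a))) z =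
      κ * (A ![(z 0).1, (z 1).1, (z 2).1, (z 3).1, (z 4).1] *
        insertVectors (m := 2) 4 B (fun a => u (i a)) ![(z 5).2, (z 6).2]) := by
  refine ⟨(Equiv.Perm.sign blockPerm : ℤ), fun A B ι u i z h5 h6 => ?_⟩
  rw [insertVectors_apply, insertVectors_apply,
    eq_sign_mul_apply_comp (n := 11) (prodVol A B) _ blockPerm]
  congr 1
  unfold prodVol
  rw [wedge_prod_apply]
  · congr 2
    · funext i; fin_cases i <;> rfl
    · funext i; fin_cases i <;> rfl
  · intro j
    fin_cases j
    · rfl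
    · rfl
    · rfl
    · rfl
    · exact h5
    · exact h6

open Classical in
theorem card_filter_appendVec_le {X Y : Type*} [Zero X] {m k : ℕ} (x : Fin k → Y)
    (z : Fin m → X × Y) :
    (Finset.univ.filter fun i =>
      (appendVec (fun a => ((0 : X), x a)) z i).1 ≠ 0).card ≤
    (Finset.univ.filter fun i => (z i).1 ≠ 0).card := by
  refine (Finset.card_le_card ?_).trans (Finset.card_image_le
    (f := fun j : Fin m => Fin.cast (Nat.add_comm k m) (Fin.natAdd k j)))
  intro i hi
  obtain ⟨i, rfl⟩ : ∃ i', i = Fin.cast (Nat.add_comm k m) i' :=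
    ⟨Fin.cast (Nat.add_comm m k) i, by simp⟩
  have hi : (Fin.append (fun a => ((0 : X), x a)) z i).1 ≠ 0 := (Finset.mem_filter.1 hi).2
  refine Fin.addCases (fun a ha => ?_) (fun a ha => ?_) i hi
  · exact absurd (by rw [Fin.append_left]) ha
  · rw [Fin.append_right] at ha
    exact Finset.mem_image.2 ⟨a, Finset.mem_filter.2 ⟨Finset.mem_univ _, ha⟩, rfl⟩

variable [FiniteDimensional ℝ E₁] [FiniteDimensional ℝ E₂]

/-- On five vectors tangent to the first factor and two tangent to the second, `⋆φ` is, up to a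
universal constant, the product of the volume form of the first factor with the Hodge star of `φ` on
the second one. -/
theorem exists_hodge_comp_snd_apply : ∃ κ : ℝ, ∀ {g₁ : E₁ →L[ℝ] E₁ →L[ℝ] ℝ}
    {g₂ : E₂ →L[ℝ] E₂ →L[ℝ] ℝ} (_ : IsScalarProduct g₁) (_ : IsScalarProduct g₂)
    (A : E₁ [⋀^Fin 5]→L[ℝ] ℝ) (B : E₂ [⋀^Fin 6]→L[ℝ] ℝ) (φ : E₂ [⋀^Fin 4]→L[ℝ] ℝ)
    (z : Fin 7 → E₁ × E₂) (_ : (z 5).1 = 0) (_ : (z 6).1 = 0),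
    hodge (m := 7) (k := 4) (prodScalar g₁ g₂)
        (prodVol A B) (φ.compContinuousLinearMap (.snd ℝ E₁ E₂)) z =
      κ * (A ![(z 0).1, (z 1).1, (z 2).1, (z 3).1, (z 4).1] *
        hodge (m := 2) (k := 4) g₂ B φ ![(z 5).2, (z 6).2]) := by
  obtain ⟨κ, hκ⟩ := exists_prodVol_appendVec (E₁ := E₁) (E₂ := E₂)
  refine ⟨κ, fun h₁ h₂ A B φ z h5 h6 => ?_⟩
  have key : ∀ (ι : Type) [Fintype ι] (f : ℝ) (u : ι → E₂) (p : (Fin 4 → ι) → ℝ),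
      f * ∑ i, p i * insertVectors (m := 7) 4 (prodVol A B) (fun a => ((0 : E₁), u (i a))) z =
        κ * (A ![(z 0).1, (z 1).1, (z 2).1, (z 3).1, (z 4).1] *
          (f * ∑ i, p i * insertVectors (m := 2) 4 B (fun a => u (i a)) ![(z 5).2, (z 6).2])) := by
    intro ι _ f u p
    rw [Finset.mul_sum, Finset.mul_sum, Finset.mul_sum, Finset.mul_sum]
    refine Finset.sum_congr rfl fun i _ => ?_
    rw [hκ A B u i z h5 h6]
    ring
  rw [hodge_comp_snd h₁ h₂, hodge_apply, key]

open Classical in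
/-- `⋆φ` contains the whole volume form of the first factor, so it vanishes on seven vectors fewer
than five of which have a component along that factor. -/
theorem hodge_comp_snd_eq_zero {g₁ : E₁ →L[ℝ] E₁ →L[ℝ] ℝ} {g₂ : E₂ →L[ℝ] E₂ →L[ℝ] ℝ}
    (h₁ : IsScalarProduct g₁) (h₂ : IsScalarProduct g₂)
    (A : E₁ [⋀^Fin 5]→L[ℝ] ℝ) (B : E₂ [⋀^Fin 6]→L[ℝ] ℝ) (φ : E₂ [⋀^Fin 4]→L[ℝ] ℝ)
    (z : Fin 7 → E₁ × E₂) (hz : (Finset.univ.filter fun i => (z i).1 ≠ 0).card < 5) :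
    hodge (m := 7) (k := 4) (prodScalar g₁ g₂)
        (prodVol A B) (φ.compContinuousLinearMap (.snd ℝ E₁ E₂)) z = 0 := by
  rw [hodge_comp_snd h₁ h₂]
  refine mul_eq_zero_of_right _ (Finset.sum_eq_zero fun i _ => mul_eq_zero_of_right _ ?_)
  rw [insertVectors_apply]
  exact wedge_prod_eq_zero _ _ _ ((card_filter_appendVec_le (m := 7) (k := 4) _ z).trans_lt hz)

end HodgeProduct

/-! ### Adapted bases of a Hermitian vector space -/

section AdaptedBasis

variable {E : Type*} [NormedAddCommGroup E] [NormedSpace ℝ E]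

/-- A negative definite scalar product and an orthogonal complex structure on a six-dimensional
space. -/
structure IsHermitian6 (g : E →L[ℝ] E →L[ℝ] ℝ) (J : E →L[ℝ] E) : Prop where
  finrank_eq : Module.finrank ℝ E = 6
  symm : ∀ x y, g x y = g y x
  neg : ∀ x, x ≠ 0 → g x x < 0
  sq_eq : ∀ x, J (J x) = -x
  herm : ∀ x y, g (J x) (J y) = g x y

variable {g : E →L[ℝ] E →L[ℝ] ℝ} {J : E →L[ℝ] E}

theorem IsHermitian6.skew (h : IsHermitian6 g J) (x y : E) : g x (J y) = -g (J x) y := by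
  have := h.herm x (J y)
  rw [h.sq_eq, map_neg] at this
  linarith

theorem IsHermitian6.apply_J_self (h : IsHermitian6 g J) (x : E) : g x (J x) = 0 := by
  have := h.skew x x
  rw [h.symm (J x) x] at this
  linarith

theorem IsHermitian6.isScalarProduct (h : IsHermitian6 g J) : IsScalarProduct g :=
  ⟨h.symm, fun x hx => by
    by_contra hne
    exact (h.neg x hne).ne (hx x)⟩

theorem IsHermitian6.exists_unit_orthogonal (h : IsHermitian6 g J) {n : ℕ} (hn : n < 6)
    (x : Fin n → E) : ∃ e, g e e = -1 ∧ ∀ i, g (x i) e = 0 := by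
  have : FiniteDimensional ℝ E := Module.finite_of_finrank_eq_succ h.finrank_eq
  let L : E →ₗ[ℝ] (Fin n → ℝ) := LinearMap.pi fun i => (g (x i) : E →ₗ[ℝ] ℝ)
  have hker : LinearMap.ker L ≠ ⊥ := LinearMap.ker_ne_bot_of_finrank_lt (by
    rw [h.finrank_eq, Module.finrank_fin_fun]; exact hn)
  obtain ⟨y, hy, hy0⟩ := (Submodule.ne_bot_iff _).1 hker
  have hyi : ∀ i, g (x i) y = 0 := fun i => congrFun (LinearMap.mem_ker.1 hy) i
  have hneg := h.neg y hy0
  refine ⟨(Real.sqrt (-g y y))⁻¹ • y, ?_, fun i => by simp [hyi i]⟩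
  have hs : Real.sqrt (-g y y) * Real.sqrt (-g y y) = -g y y :=
    Real.mul_self_sqrt (by linarith)
  have hs0 : Real.sqrt (-g y y) ≠ 0 := (Real.sqrt_pos.2 (by linarith)).ne'
  simp only [map_smul, smul_apply, smul_eq_mul]
  field_simp
  linarith

/-- The existence of a unitary basis `e₀, Je₀, e₂, Je₂, e₄, Je₄`. -/
theorem IsHermitian6.exists_basis (h : IsHermitian6 g J) :
    ∃ b : Module.Basis (Fin 6) ℝ E, (∀ i j, g (b i) (b j) = if i = j then -1 else 0) ∧
      J (b 0) = b 1 ∧ J (b 2) = b 3 ∧ J (b 4) = b 5 := by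
  obtain ⟨x, hx, -⟩ := h.exists_unit_orthogonal (n := 0) (by norm_num) Fin.elim0
  obtain ⟨y, hy, hxy⟩ := h.exists_unit_orthogonal (n := 2) (by norm_num) ![x, J x]
  obtain ⟨z, hz, hxyz⟩ := h.exists_unit_orthogonal (n := 4) (by norm_num) ![x, J x, y, J y]
  have xy : g x y = 0 := hxy 0
  have Jxy : g (J x) y = 0 := hxy 1
  have xz : g x z = 0 := hxyz 0
  have Jxz : g (J x) z = 0 := hxyz 1
  have yz : g y z = 0 := hxyz 2
  have Jyz : g (J y) z = 0 := hxyz 3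
  have hJy : g (J y) x = 0 := by rw [h.symm, h.skew, Jxy, neg_zero]
  have hJz : g (J z) x = 0 := by rw [h.symm, h.skew, Jxz, neg_zero]
  have hJz' : g (J z) y = 0 := by rw [h.symm, h.skew, Jyz, neg_zero]
  have hJx0 : g (J x) x = 0 := by rw [h.symm, h.apply_J_self]
  have hJy0 : g (J y) y = 0 := by rw [h.symm, h.apply_J_self]
  have hJz0 : g (J z) z = 0 := by rw [h.symm, h.apply_J_self]
  have hgram : ∀ i j, g ((![x, J x, y, J y, z, J z] : Fin 6 → E) i)
      ((![x, J x, y, J y, z, J z] : Fin 6 → E) j) = if i = j then -1 else 0 := by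
    intro i j
    fin_cases i <;> fin_cases j <;>
      simp [h.herm, h.skew, h.symm y x, h.symm z x, h.symm z y, *]
  have hli : LinearIndependent ℝ (![x, J x, y, J y, z, J z] : Fin 6 → E) := by
    rw [Fintype.linearIndependent_iff]
    intro c hc i
    have := congrArg (g ((![x, J x, y, J y, z, J z] : Fin 6 → E) i)) hc
    simp only [map_sum, map_smul, hgram, map_zero] at this
    simpa using this
  have hcard : Fintype.card (Fin 6) = Module.finrank ℝ E := by simp [h.finrank_eq]
  refine ⟨basisOfLinearIndependentOfCardEqFinrank hli hcard, ?_, ?_⟩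
  · simpa only [coe_basisOfLinearIndependentOfCardEqFinrank] using hgram
  · simp only [coe_basisOfLinearIndependentOfCardEqFinrank]
    exact ⟨rfl, rfl, rfl⟩

/-- The sign of the permutation taking `0, …, 5` to the given values, and zero if two of them
agree. -/
def sign6 (f : Fin 6 → Fin 6) : ℤ :=
  ∏ i, ∏ j ∈ Finset.Ioi i, if f i < f j then 1 else if f j < f i then -1 else 0

/-- A form of top degree on any six members of a basis. -/
theorem apply_comp_eq_sign6 (vol : E [⋀^Fin 6]→L[ℝ] ℝ) (b : Fin 6 → E) (f : Fin 6 → Fin 6) :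
    vol (fun i => b (f i)) = vol b * sign6 f := by
  by_cases hf : Function.Injective f
  · let σ : Equiv.Perm (Fin 6) := Equiv.ofBijective f (Finite.injective_iff_bijective.1 hf)
    have hσ : sign6 f = (Equiv.Perm.sign σ : ℤ) := by
      rw [Equiv.Perm.sign_eq_prod_prod_Ioi]
      push_cast
      refine Finset.prod_congr rfl fun i _ => Finset.prod_congr rfl fun j hj => ?_
      have hne : f i ≠ f j := fun h => (Finset.mem_Ioi.1 hj).ne (hf h)
      change _ = ((if f i < f j then (1 : ℤˣ) else -1 : ℤˣ) : ℤ)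
      rcases lt_or_gt_of_ne hne with h | h
      · simp [h]
      · simp [h, h.not_gt]
    have h1 : vol (fun i => b (f i)) = Equiv.Perm.sign σ • vol b := vol.toAlternatingMap.map_perm b σ
    rw [h1, hσ]
    rcases Int.units_eq_one_or (Equiv.Perm.sign σ) with h | h <;> simp [h]
  · have : ∃ i j, f i = f j ∧ i ≠ j := by
      simpa [Function.Injective] using hf
    obtain ⟨i, j, hij, hne⟩ := this
    have h1 : vol (fun i => b (f i)) = 0 := vol.map_eq_zero_of_eq _ (by simp [hij]) hne
    have h2 : sign6 f = 0 := by
      have key : ∀ i j, f i = f j → i < j → sign6 f = 0 := by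
        intro i j hij hlt
        refine Finset.prod_eq_zero (Finset.mem_univ i)
          (Finset.prod_eq_zero (Finset.mem_Ioi.2 hlt) ?_)
        simp [hij]
      rcases lt_or_gt_of_ne hne with h | h
      · exact key i j hij h
      · exact key j i hij.symm h
    rw [h1, h2, Int.cast_zero, mul_zero]

/-- The matrix `g(J bᵢ, bⱼ)` of the Kähler form in a unitary basis. -/
def kahlerMatrix (i j : Fin 6) : ℤ :=
  if j.val = i.val + 1 ∧ i.val % 2 = 0 then -1
  else if i.val = j.val + 1 ∧ j.val % 2 = 0 then 1 else 0

/-- The coefficients of `⋆ω` and of `½ ω ∧ ω` in a unitary basis agree: a finite computation over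
increasing tuples of indices. -/
theorem sum_sign6_eq : ∀ c d e f : Fin 6, c < d → d < e → e < f →
    sign6 ![0, 1, c, d, e, f] + sign6 ![2, 3, c, d, e, f] + sign6 ![4, 5, c, d, e, f] =
      kahlerMatrix c d * kahlerMatrix e f - kahlerMatrix c e * kahlerMatrix d f +
        kahlerMatrix c f * kahlerMatrix d e := by
  decide +kernel

/-- Alternating maps agree if they agree on increasing tuples of basis vectors. -/
theorem ext_alternating_strictMono {ι' : Type*} [Fintype ι'] [LinearOrder ι'] {n : ℕ}
    (b : Module.Basis ι' ℝ E) {α β : E [⋀^Fin n]→ₗ[ℝ] ℝ}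
    (h : ∀ I : Fin n → ι', StrictMono I → α (fun i => b (I i)) = β (fun i => b (I i))) :
    α = β := by
  refine b.ext_alternating fun I hI => ?_
  have hmono : StrictMono (I ∘ Tuple.sort I) :=
    (Tuple.monotone_sort I).strictMono_of_injective (hI.comp (Tuple.sort I).injective)
  have h1 := h _ hmono
  have h2 := α.map_perm (fun i => b (I i)) (Tuple.sort I)
  have h3 := β.map_perm (fun i => b (I i)) (Tuple.sort I)
  have h4 : Equiv.Perm.sign (Tuple.sort I) • α (fun i => b (I i)) =
      Equiv.Perm.sign (Tuple.sort I) • β (fun i => b (I i)) := by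
    rw [← h2, ← h3]; exact h1
  exact (MulAction.injective _) h4

end AdaptedBasis

/-! ### The Hodge star of the Kähler form -/

section PointwiseKahler

variable {E : Type*} [NormedAddCommGroup E] [NormedSpace ℝ E]

/-- The explicit expression of `½ ω ∧ ω` for a two-form `ω`. -/
def halfSq (w : E → E → ℝ) (a b c d : E) : ℝ :=
  w a b * w c d - w a c * w b d + w a d * w b c

theorem twoForm_add_left (W : E [⋀^Fin 2]→L[ℝ] ℝ) (x y z : E) :
    W ![x + y, z] = W ![x, z] + W ![y, z] := by
  have hu : ∀ x : E, Function.update ![0, z] 0 x = ![x, z] := fun x => by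
    funext k; fin_cases k <;> rfl
  simpa only [hu] using W.map_update_add ![0, z] 0 x y

theorem twoForm_smul_left (W : E [⋀^Fin 2]→L[ℝ] ℝ) (c : ℝ) (x z : E) :
    W ![c • x, z] = c * W ![x, z] := by
  have hu : ∀ x : E, Function.update ![0, z] 0 x = ![x, z] := fun x => by
    funext k; fin_cases k <;> rfl
  simpa only [hu, smul_eq_mul] using W.map_update_smul ![0, z] 0 c x

theorem twoForm_swap (W : E [⋀^Fin 2]→L[ℝ] ℝ) (x y : E) : W ![x, y] = -W ![y, x] := by
  have := W.toAlternatingMap.map_swap ![y, x] (i := 0) (j := 1) (by decide)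
  rw [ContinuousAlternatingMap.coe_toAlternatingMap] at this
  rw [← this]
  congr 1
  funext k
  fin_cases k <;> rfl

theorem twoForm_add_right (W : E [⋀^Fin 2]→L[ℝ] ℝ) (x y z : E) :
    W ![z, x + y] = W ![z, x] + W ![z, y] := by
  rw [twoForm_swap, twoForm_add_left, twoForm_swap W x, twoForm_swap W y]; ring

theorem twoForm_smul_right (W : E [⋀^Fin 2]→L[ℝ] ℝ) (c : ℝ) (x z : E) :
    W ![z, c • x] = c * W ![z, x] := by
  rw [twoForm_swap, twoForm_smul_left, twoForm_swap W x]; ring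

/-- `½ ω ∧ ω` as an alternating map. -/
def halfSqAlt (W : E [⋀^Fin 2]→L[ℝ] ℝ) : E [⋀^Fin 4]→ₗ[ℝ] ℝ where
  toFun v := halfSq (fun x y => W ![x, y]) (v 0) (v 1) (v 2) (v 3)
  map_update_add' := by
    intro inst v i x y
    obtain rfl : inst = instDecidableEqFin 4 := Subsingleton.elim _ _
    fin_cases i <;>
      simp [halfSq, twoForm_add_left, twoForm_add_right] <;> ring
  map_update_smul' := by
    intro inst v i x y
    obtain rfl : inst = instDecidableEqFin 4 := Subsingleton.elim _ _
    fin_cases i <;>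
      simp [halfSq, twoForm_smul_left, twoForm_smul_right] <;> ring
  map_eq_zero_of_eq' := by
    intro v i j hij hne
    have hd : ∀ x : E, W ![x, x] = 0 := fun x =>
      W.map_eq_zero_of_eq ![x, x] (i := 0) (j := 1) rfl (by decide)
    have hs := twoForm_swap W
    fin_cases i <;> fin_cases j <;> first | exact absurd rfl hne | skip
    all_goals
      simp only [Fin.zero_eta, Fin.mk_one, Fin.reduceFinMk] at hij
      simp only [halfSq, hij, hd, hs (v 1) (v 0), hs (v 2) (v 0), hs (v 2) (v 1),
        hs (v 3) (v 1), hs (v 3) (v 2)]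
      ring

/-- The Hodge star of the Kähler form is `±½ ω ∧ ω`, the sign depending on the orientation. -/
theorem exists_hodge_eq_halfSq [FiniteDimensional ℝ E] {g : E →L[ℝ] E →L[ℝ] ℝ} {J : E →L[ℝ] E}
    (h : IsHermitian6 g J)
    {W : E [⋀^Fin 2]→L[ℝ] ℝ} (hW : ∀ x y, W ![x, y] = g (J x) y) {vol : E [⋀^Fin 6]→L[ℝ] ℝ}
    (hvol : ∀ v, (vol v) ^ 2 = |(Matrix.of fun i j => g (v i) (v j)).det|) :
    ∃ ε : ℝ, ε * ε = 1 ∧ ∀ v : Fin 4 → E, hodge (m := 4) (k := 2) g vol W v =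
      ε * halfSq (fun x y => g (J x) y) (v 0) (v 1) (v 2) (v 3) := by
  obtain ⟨b, hb, h01, h23, h45⟩ := h.exists_basis
  have hpair : IsDualPair g b (fun i => g (b i) (b i) • b i) :=
    IsDualPair.of_orthonormal b (fun i j hij => by simp [hb, hij]) (fun i => by simp [hb])
  have hJ : ∀ i j, g (J (b i)) (b j) = kahlerMatrix i j := by
    have h10 : J (b 1) = -b 0 := by rw [← h01, h.sq_eq]
    have h32 : J (b 3) = -b 2 := by rw [← h23, h.sq_eq]
    have h54 : J (b 5) = -b 4 := by rw [← h45, h.sq_eq]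
    intro i j
    fin_cases i <;> simp [h01, h23, h45, h10, h32, h54, hb] <;> fin_cases j <;>
      simp [kahlerMatrix]
  -- the value of `vol` on the unitary basis is `±1`, and `ε` is its opposite
  set s := vol b with hs
  have hss : s * s = 1 := by
    have := hvol b
    rw [← pow_two, this]
    have : (Matrix.of fun i j => g (b i) (b j)) = (-1 : ℝ) • (1 : Matrix (Fin 6) (Fin 6) ℝ) := by
      ext i j
      simp [hb, Matrix.one_apply]
    rw [this, Matrix.det_smul]
    norm_num
  refine ⟨-s, by linarith [hss, neg_mul_neg s s], ?_⟩
  have hvol6 : ∀ (i j : Fin 6) (I : Fin 4 → Fin 6),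
      insertVectors (m := 4) 2 vol (fun a => b (![i, j] a)) (fun k => b (I k)) =
        s * sign6 ![i, j, I 0, I 1, I 2, I 3] := by
    intro i j I
    rw [insertVectors_apply, hs, ← apply_comp_eq_sign6]
    change vol _ = vol _
    congr 1
    funext k
    fin_cases k <;> rfl
  have hmain : (hodge (m := 4) (k := 2) g vol W).toAlternatingMap = (-s) • halfSqAlt W := by
    refine ext_alternating_strictMono b fun I hI => ?_
    change hodge (m := 4) (k := 2) g vol W (fun k => b (I k)) =
      -s * halfSq (fun x y => W ![x, y]) (b (I 0)) (b (I 1)) (b (I 2)) (b (I 3))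
    rw [hodge_eq_sum h.symm hpair]
    rw [sum_fin_two_fun]
    simp only [hvol6]
    have hWv : ∀ i j : Fin 6, W (fun a => g (b ((![i, j] : Fin 2 → Fin 6) a))
        (b ((![i, j] : Fin 2 → Fin 6) a)) • b ((![i, j] : Fin 2 → Fin 6) a)) =
        kahlerMatrix i j := by
      intro i j
      have : (fun a => g (b ((![i, j] : Fin 2 → Fin 6) a))
        (b ((![i, j] : Fin 2 → Fin 6) a)) • b ((![i, j] : Fin 2 → Fin 6) a)) =
        ![(-1 : ℝ) • b i, (-1 : ℝ) • b j] := by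
        funext a
        fin_cases a <;> simp [hb]
      rw [this, twoForm_smul_left, twoForm_smul_right, hW, hJ, neg_one_mul, neg_one_mul, neg_neg]
    simp only [hWv, halfSq, hW, hJ]
    have hswap : ∀ i j : Fin 6, (sign6 ![j, i, I 0, I 1, I 2, I 3] : ℝ) =
        -sign6 ![i, j, I 0, I 1, I 2, I 3] := by
      intro i j
      have h1 := hvol6 j i I
      have h2 := hvol6 i j I
      have h3 : insertVectors (m := 4) 2 vol (fun a => b (![j, i] a)) (fun k => b (I k)) =
          - insertVectors (m := 4) 2 vol (fun a => b (![i, j] a)) (fun k => b (I k)) := by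
        rw [insertVectors_apply, insertVectors_apply]
        rw [← ContinuousAlternatingMap.coe_toAlternatingMap,
          ← AlternatingMap.map_swap _ _ (i := (0 : Fin 6)) (j := (1 : Fin 6)) (by decide)]
        congr 1
        funext k
        fin_cases k <;> rfl
      rw [h1, h2] at h3
      have : s ≠ 0 := by rintro h0; rw [h0] at hss; norm_num at hss
      have h4 : s * ((sign6 ![j, i, I 0, I 1, I 2, I 3] : ℝ) +
        sign6 ![i, j, I 0, I 1, I 2, I 3]) = 0 := by linarith
      have := (mul_eq_zero.1 h4).resolve_left this
      linarith
    have hk := sum_sign6_eq (I 0) (I 1) (I 2) (I 3) (hI (by decide)) (hI (by decide))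
      (hI (by decide))
    have hk' := congrArg (fun z : ℤ => (z : ℝ)) hk
    push_cast at hk'
    rw [← hk']
    simp only [Fin.sum_univ_six]
    simp [kahlerMatrix]
    rw [hswap 0 1, hswap 2 3, hswap 4 5]
    ring
  intro v
  have := congrArg (fun f => f v) hmain
  simp only [ContinuousAlternatingMap.coe_toAlternatingMap] at this
  rw [this]
  change -s * halfSq (fun x y => W ![x, y]) _ _ _ _ = _
  simp only [hW]

end PointwiseKahler

/-! ### Contractions of the square of the Kähler form -/

section Contraction

variable {E : Type*} [NormedAddCommGroup E] [NormedSpace ℝ E] [FiniteDimensional ℝ E]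
  {g : E →L[ℝ] E →L[ℝ] ℝ} {J : E →L[ℝ] E}
  {ι : Type*} [Fintype ι] {u v : ι → E}

omit [FiniteDimensional ℝ E] in
theorem IsDualPair.contract_left (h : IsDualPair g u v) (f : E →L[ℝ] ℝ) (x : E) :
    ∑ i, g x (u i) * f (v i) = f x := by
  conv_rhs => rw [← h.sum_left x]
  simp [map_sum]

omit [FiniteDimensional ℝ E] in
theorem IsDualPair.contract_right (h : IsDualPair g u v) (f : E →L[ℝ] ℝ) (x : E) :
    ∑ i, g x (v i) * f (u i) = f x := h.swap.contract_left f x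

omit [FiniteDimensional ℝ E] in
theorem IsHermitian6.kahler_swap (hJ : IsHermitian6 g J) (x y : E) :
    g (J y) x = -g (J x) y := by
  rw [hJ.symm, hJ.skew]

omit [FiniteDimensional ℝ E] in
theorem IsHermitian6.contract_kahler (hJ : IsHermitian6 g J) (h : IsDualPair g u v) (x y : E) :
    ∑ i, g (J x) (u i) * g (J y) (v i) = g x y := by
  rw [h.contract_left, hJ.herm, hJ.symm]

omit [FiniteDimensional ℝ E] in
theorem IsHermitian6.contract_self (hJ : IsHermitian6 g J) (h : IsDualPair g u v) :
    ∑ i, g (u i) (v i) = 6 := by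
  obtain ⟨b, hb, -⟩ := hJ.exists_basis
  have hpair : IsDualPair g b (fun i => g (b i) (b i) • b i) :=
    IsDualPair.of_orthonormal b (fun i j hij => by simp [hb, hij]) (fun i => by simp [hb])
  have := (h.sameTensor hJ.symm hpair)
    (ContinuousLinearMap.coeLMₛₗ (RingHom.id ℝ) ∘ₗ (g : E →ₗ[ℝ] E →L[ℝ] ℝ))
  simp [hb] at this
  exact this

omit [FiniteDimensional ℝ E] in
/-- The contraction of two copies of `½ ω ∧ ω` in their last index. -/
theorem IsHermitian6.contract_halfSq_last (hJ : IsHermitian6 g J) (h : IsDualPair g u v)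
    (Y b c Z b' c' : E) :
    ∑ i, halfSq (fun x y => g (J x) y) Y b c (u i) * halfSq (fun x y => g (J x) y) Z b' c' (v i) =
      g (J Y) b * g (J Z) b' * g c c' - g (J Y) b * (g (J Z) c' * g b' c)
        + g (J Y) b * (g (J b') c' * g Z c) - g (J Z) b' * (g (J Y) c * g b c')
        + g b b' * (g (J Y) c * g (J Z) c') - g b Z * (g (J Y) c * g (J b') c')
        + g (J Z) b' * (g (J b) c * g Y c') - g Y b' * (g (J b) c * g (J Z) c')
        + g Y Z * (g (J b) c * g (J b') c') := by
  -- `½ ω ∧ ω` is `ω` of a combination of its first three arguments with its last one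
  have hlin : ∀ Y b c d : E, halfSq (fun x y => g (J x) y) Y b c d =
      g (J (g (J Y) b • c - g (J Y) c • b + g (J b) c • Y)) d := by
    intro Y b c d
    simp only [halfSq, map_add, map_sub, map_smul, add_apply, sub_apply, smul_apply, smul_eq_mul]
    ring
  simp only [hlin, hJ.contract_kahler h]
  simp only [map_add, map_sub, map_smul, add_apply, sub_apply, smul_apply, smul_eq_mul]
  rw [hJ.symm c b', hJ.symm c Z]
  ring

omit [FiniteDimensional ℝ E] in
/-- The contraction of two copies of `½ ω ∧ ω` in two indices. -/
theorem IsHermitian6.contract_halfSq_two (hJ : IsHermitian6 g J) (h : IsDualPair g u v)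
    (Y b Z b' : E) :
    ∑ i, ∑ j, halfSq (fun x y => g (J x) y) Y b (u i) (u j) *
        halfSq (fun x y => g (J x) y) Z b' (v i) (v j) =
      2 * (g (J Y) b * g (J Z) b') + 2 * (g b b' * g Y Z) - 2 * (g Y b' * g Z b) := by
  simp only [hJ.contract_halfSq_last h, Finset.sum_add_distrib, Finset.sum_sub_distrib,
    ← Finset.mul_sum, hJ.contract_self h, hJ.contract_kahler h]
  have e1 : ∑ i, g (J Z) (v i) * g b' (u i) = g (J Z) b' :=
    (h.contract_right (g b') (J Z)).trans (hJ.symm _ _)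
  have e2 : ∑ i, g (J b') (v i) * g Z (u i) = g (J b') Z :=
    (h.contract_right (g Z) (J b')).trans (hJ.symm _ _)
  have e3 : ∑ i, g (J Y) (u i) * g b (v i) = g (J Y) b :=
    (h.contract_left (g b) (J Y)).trans (hJ.symm _ _)
  have e4 : ∑ i, g (J b) (u i) * g Y (v i) = g (J b) Y :=
    (h.contract_left (g Y) (J b)).trans (hJ.symm _ _)
  rw [e1, e2, e3, e4]
  rw [hJ.kahler_swap Z b', hJ.kahler_swap Y b, hJ.symm b Z]
  ring

omit [FiniteDimensional ℝ E] in
/-- The contraction of two copies of `½ ω ∧ ω` in three indices. The trace of `g` in the remaining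
terms is the dimension six. -/
theorem IsHermitian6.contract_halfSq_three (hJ : IsHermitian6 g J) (h : IsDualPair g u v)
    (Y Z : E) :
    ∑ i, ∑ j, ∑ k, halfSq (fun x y => g (J x) y) Y (u i) (u j) (u k) *
        halfSq (fun x y => g (J x) y) Z (v i) (v j) (v k) = 12 * g Y Z := by
  have e : ∑ i, g Y (v i) * g Z (u i) = g Y Z :=
    (h.contract_right (g Z) Y).trans (hJ.symm _ _)
  simp only [hJ.contract_halfSq_two h, Finset.sum_add_distrib, Finset.sum_sub_distrib,
    ← Finset.mul_sum, ← Finset.sum_mul, hJ.contract_self h, hJ.contract_kahler h, e]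
  ring

variable {φ : E [⋀^Fin 4]→L[ℝ] ℝ} {ε : ℝ}

/-- For `φ = ±½ ω ∧ ω`, `⟨Y ⌟ φ, Z ⌟ φ⟩ = 2 g(Y, Z)`. -/
theorem IsHermitian6.formInner_contract (hJ : IsHermitian6 g J) (hε : ε * ε = 1)
    (hφ : ∀ v : Fin 4 → E, φ v = ε * halfSq (fun x y => g (J x) y) (v 0) (v 1) (v 2) (v 3))
    (Y Z : E) :
    formInner g (ContinuousAlternatingMap.curryLeft (n := 3) φ Y)
      (ContinuousAlternatingMap.curryLeft (n := 3) φ Z) = 2 * g Y Z := by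
  have h := hJ.isScalarProduct.isDualPair_raisedBasis
  have hc : ∀ Y a b c, ContinuousAlternatingMap.curryLeft (n := 3) φ Y ![a, b, c] =
      ε * halfSq (fun x y => g (J x) y) Y a b c := fun Y a b c => hφ (Fin.cons Y ![a, b, c])
  have hv : ∀ (w : Fin (Module.finrank ℝ E) → E) i j k,
      (fun a => w ((![i, j, k] : Fin 3 → _) a)) = ![w i, w j, w k] := by
    intro w i j k; funext a; fin_cases a <;> rfl
  rw [formInner_eq_sum hJ.symm h, sum_fin_three_fun]
  simp only [hv, hc]
  have : ∀ a b : ℝ, ε * a * (ε * b) = a * b := fun a b => by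
    linear_combination a * b * hε
  simp only [this, hJ.contract_halfSq_three h]
  norm_num [Nat.factorial]
  ring

/-- For `φ = ±½ ω ∧ ω`, `‖φ‖² = 3`. -/
theorem IsHermitian6.formInner_self (hJ : IsHermitian6 g J) (hε : ε * ε = 1)
    (hφ : ∀ v : Fin 4 → E, φ v = ε * halfSq (fun x y => g (J x) y) (v 0) (v 1) (v 2) (v 3)) :
    formInner g φ φ = 3 := by
  have h := hJ.isScalarProduct.isDualPair_raisedBasis
  have hc : ∀ Y a b c, φ ![Y, a, b, c] =
      ε * halfSq (fun x y => g (J x) y) Y a b c := fun Y a b c => hφ ![Y, a, b, c]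
  have hv : ∀ (w : Fin (Module.finrank ℝ E) → E) i j k l,
      (fun a => w ((![i, j, k, l] : Fin 4 → _) a)) = ![w i, w j, w k, w l] := by
    intro w i j k l; funext a; fin_cases a <;> rfl
  rw [formInner_eq_sum hJ.symm h, sum_fin_four_fun]
  simp only [hv, hc]
  have : ∀ a b : ℝ, ε * a * (ε * b) = a * b := fun a b => by
    linear_combination a * b * hε
  simp only [this, hJ.contract_halfSq_three h, ← Finset.mul_sum, hJ.contract_self h]
  norm_num [Nat.factorial]

/-- The Kähler form is recovered from its Hodge star. -/
theorem IsHermitian6.hodge_hodge (hJ : IsHermitian6 g J) (hε : ε * ε = 1)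
    {W : E [⋀^Fin 2]→L[ℝ] ℝ} (hW : ∀ x y, W ![x, y] = g (J x) y) {vol : E [⋀^Fin 6]→L[ℝ] ℝ}
    (hφ : ∀ v : Fin 4 → E, φ v = ε * halfSq (fun x y => g (J x) y) (v 0) (v 1) (v 2) (v 3))
    (hstar : hodge (m := 4) (k := 2) g vol W = φ) :
    hodge (m := 2) (k := 4) g vol φ = W := by
  obtain ⟨U, V, h⟩ : ∃ U V : Fin (Module.finrank ℝ E) → E, IsDualPair g U V :=
    ⟨_, _, hJ.isScalarProduct.isDualPair_raisedBasis⟩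
  ext z
  have hz : z = ![z 0, z 1] := by funext a; fin_cases a <;> rfl
  rw [hz]
  generalize z 0 = a
  generalize z 1 = b
  -- the volume form as a function of six vectors
  set D : E → E → E → E → ℝ := fun x y p q => vol ![x, y, p, q, a, b] with hD
  have hD1 : ∀ i j k l, insertVectors (m := 2) 4 vol (fun c => U ((![i, j, k, l] : Fin 4 → _) c))
      ![a, b] = D (U i) (U j) (U k) (U l) := by
    intro i j k l
    rw [insertVectors_apply]
    change vol _ = vol _
    congr 1
    funext c
    fin_cases c <;> rfl
  have hswap : ∀ x y p q, D x p y q = -D x y p q := by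
    intro x y p q
    simp only [hD]
    rw [← ContinuousAlternatingMap.coe_toAlternatingMap,
      ← AlternatingMap.map_swap _ _ (i := (1 : Fin 6)) (j := (2 : Fin 6)) (by decide)]
    congr 1
    funext k
    fin_cases k <;> rfl
  have hswap' : ∀ x y p q, D x y q p = -D x y p q := by
    intro x y p q
    simp only [hD]
    rw [← ContinuousAlternatingMap.coe_toAlternatingMap,
      ← AlternatingMap.map_swap _ _ (i := (2 : Fin 6)) (j := (3 : Fin 6)) (by decide)]
    congr 1
    funext k
    fin_cases k <;> rfl
  -- contracting two indices of the volume form with `ω` gives `φ`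
  have hφD : ∀ x y, ∑ i, ∑ j, g (J (V i)) (V j) * D (U i) (U j) x y =
      2 * (ε * halfSq (fun x y => g (J x) y) x y a b) := by
    intro x y
    have h1 : φ ![x, y, a, b] = ε * halfSq (fun x y => g (J x) y) x y a b := hφ _
    rw [← hstar, hodge_eq_sum hJ.symm h, sum_fin_two_fun] at h1
    have h2 : ∀ i j, insertVectors (m := 4) 2 vol (fun c => U ((![i, j] : Fin 2 → _) c))
        ![x, y, a, b] = D (U i) (U j) x y := by
      intro i j
      rw [insertVectors_apply]
      change vol _ = vol _
      congr 1
      funext c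
      fin_cases c <;> rfl
    have h3 : ∀ i j, W (fun c => V ((![i, j] : Fin 2 → _) c)) = g (J (V i)) (V j) := by
      intro i j
      rw [← hW]
      congr 1
      funext c
      fin_cases c <;> rfl
    simp only [h2, h3] at h1
    norm_num [Nat.factorial] at h1
    linarith
  rw [hodge_eq_sum hJ.symm h, sum_fin_four_fun]
  have h4 : ∀ i j k l, φ (fun c => V ((![i, j, k, l] : Fin 4 → _) c)) =
      ε * halfSq (fun x y => g (J x) y) (V i) (V j) (V k) (V l) := fun i j k l => hφ _
  simp only [hD1, h4]
  -- the three terms of `halfSq` give equal contributions, by antisymmetry of `D`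
  set T : (i j k l : Fin (Module.finrank ℝ E)) → ℝ := fun i j k l =>
    g (J (V i)) (V j) * g (J (V k)) (V l) * D (U i) (U j) (U k) (U l) with hT
  have hterm : ∀ i j k l, ε * halfSq (fun x y => g (J x) y) (V i) (V j) (V k) (V l) *
      D (U i) (U j) (U k) (U l) = ε * (T i j k l + T i k j l + T i l j k) := by
    intro i j k l
    simp only [hT, halfSq]
    rw [hswap (U i) (U j) (U k) (U l), hswap (U i) (U j) (U l) (U k),
      hswap' (U i) (U j) (U k) (U l)]
    ring
  have hT2 : ∀ i, ∑ j, ∑ k, ∑ l, T i k j l = ∑ j, ∑ k, ∑ l, T i j k l := fun i =>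
    Finset.sum_comm
  have hT3 : ∀ i, ∑ j, ∑ k, ∑ l, T i l j k = ∑ j, ∑ k, ∑ l, T i j k l := by
    intro i
    rw [Finset.sum_congr rfl fun j _ => Finset.sum_comm (f := fun k l => T i l j k),
      Finset.sum_comm]
  have hT4 : ∑ i, ∑ j, ∑ k, ∑ l, T i j k l = ∑ k, ∑ l, g (J (V k)) (V l) *
        ∑ i, ∑ j, g (J (V i)) (V j) * D (U i) (U j) (U k) (U l) := by
    simp only [Finset.mul_sum]
    rw [Finset.sum_congr rfl fun i _ => Finset.sum_comm (f := fun j k => ∑ l, T i j k l),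
      Finset.sum_comm]
    refine Finset.sum_congr rfl fun k _ => ?_
    rw [Finset.sum_congr rfl fun i _ => Finset.sum_comm (f := fun j l => T i j k l),
      Finset.sum_comm]
    refine Finset.sum_congr rfl fun l _ => Finset.sum_congr rfl fun i _ =>
      Finset.sum_congr rfl fun j _ => ?_
    simp only [hT]
    ring
  have hsplit : ∑ i, ∑ j, ∑ k, ∑ l, ε * halfSq (fun x y => g (J x) y) (V i) (V j) (V k) (V l) *
      D (U i) (U j) (U k) (U l) = 3 * ε * ∑ k, ∑ l, g (J (V k)) (V l) *
        ∑ i, ∑ j, g (J (V i)) (V j) * D (U i) (U j) (U k) (U l) := by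
    simp only [hterm, ← Finset.mul_sum, Finset.sum_add_distrib, hT2, hT3]
    rw [← hT4]
    ring
  rw [hsplit]
  simp only [hφD]
  have hinner : ∀ k, ∑ l, g (J (V k)) (V l) *
      (2 * (ε * halfSq (fun x y => g (J x) y) (U k) (U l) a b)) =
      2 * ε * (g (J a) b * g (U k) (V k) - g b (V k) * g (J a) (U k)
        + g a (V k) * g (J b) (U k)) := by
    intro k
    have e1 := h.contract_right (g (J (U k))) (J (V k))
    have e2 := h.contract_right (g (J b)) (J (V k))
    have e3 := h.contract_right (g (J a)) (J (V k))
    rw [hJ.herm] at e1 e2 e3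
    have : ∀ l, g (J (V k)) (V l) * (2 * (ε * halfSq (fun x y => g (J x) y) (U k) (U l) a b)) =
        2 * ε * (g (J a) b * (g (J (V k)) (V l) * g (J (U k)) (U l))
          - g (J a) (U k) * (g (J (V k)) (V l) * g (J b) (U l))
          + g (J b) (U k) * (g (J (V k)) (V l) * g (J a) (U l))) := by
      intro l
      simp only [halfSq]
      rw [hJ.kahler_swap a (U k), hJ.kahler_swap b (U l), hJ.kahler_swap b (U k),
        hJ.kahler_swap a (U l)]
      ring
    simp only [this, ← Finset.mul_sum, Finset.sum_add_distrib, Finset.sum_sub_distrib, e1, e2, e3]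
    ring
  have hfin : ∑ k, ∑ l, g (J (V k)) (V l) *
      (2 * (ε * halfSq (fun x y => g (J x) y) (U k) (U l) a b)) = 8 * ε * g (J a) b := by
    have e1 := h.contract_right (g (J a)) b
    have e2 := h.contract_right (g (J b)) a
    simp only [hinner, ← Finset.mul_sum, Finset.sum_add_distrib, Finset.sum_sub_distrib, e1, e2,
      hJ.contract_self h]
    rw [hJ.kahler_swap a b]
    ring
  rw [hfin, hW]
  norm_num [Nat.factorial]
  linear_combination (g (J a) b) * hε

end Contraction

/-! ### Exterior derivatives -/

section ExtDeriv

variable {E : Type*} [NormedAddCommGroup E] [NormedSpace ℝ E]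

theorem hasFDerivAt_apply_form {n : ℕ} {W : E → E [⋀^Fin n]→L[ℝ] ℝ} {p : E}
    (hW : DifferentiableAt ℝ W p) (v : Fin n → E) :
    HasFDerivAt (fun q => W q v) (fderiv ℝ (fun q => W q v) p) p :=
  (hW.continuousAlternatingMap_apply_const v).hasFDerivAt

/-- At a point where the form is not differentiable, `extDeriv` takes the junk value zero. -/
theorem extDeriv_of_not_differentiableAt {n : ℕ} {W : E → E [⋀^Fin n]→L[ℝ] ℝ} {p : E}
    (hW : ¬ DifferentiableAt ℝ W p) : extDeriv W p = 0 := by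
  ext v
  simp [extDeriv, fderiv_zero_of_not_differentiableAt hW,
    ContinuousAlternatingMap.alternatizeUncurryFin_apply]

/-- The exterior derivative of a two-form, written out. -/
theorem extDeriv_twoForm_apply {W : E → E [⋀^Fin 2]→L[ℝ] ℝ} {p : E}
    (hW : DifferentiableAt ℝ W p) (x y z : E) :
    extDeriv W p ![x, y, z] = fderiv ℝ (fun q => W q ![y, z]) p x -
      fderiv ℝ (fun q => W q ![x, z]) p y + fderiv ℝ (fun q => W q ![x, y]) p z := by
  have e0 : Fin.removeNth 0 ![x, y, z] = ![y, z] := by funext i; fin_cases i <;> rfl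
  have e1 : Fin.removeNth 1 ![x, y, z] = ![x, z] := by funext i; fin_cases i <;> rfl
  have e2 : Fin.removeNth 2 ![x, y, z] = ![x, y] := by funext i; fin_cases i <;> rfl
  rw [extDeriv_apply hW, Fin.sum_univ_three, e0, e1, e2]
  simp
  ring

theorem fderiv_halfSq {W : E → E [⋀^Fin 2]→L[ℝ] ℝ} {p : E} (hW : DifferentiableAt ℝ W p)
    (a b c d u : E) :
    fderiv ℝ (fun q => halfSq (fun x y => W q ![x, y]) a b c d) p u =
      (fderiv ℝ (fun q => W q ![a, b]) p u * W p ![c, d]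
        + W p ![a, b] * fderiv ℝ (fun q => W q ![c, d]) p u)
      - (fderiv ℝ (fun q => W q ![a, c]) p u * W p ![b, d]
        + W p ![a, c] * fderiv ℝ (fun q => W q ![b, d]) p u)
      + (fderiv ℝ (fun q => W q ![a, d]) p u * W p ![b, c]
        + W p ![a, d] * fderiv ℝ (fun q => W q ![b, c]) p u) := by
  have h := fun x y => hasFDerivAt_apply_form hW ![x, y]
  have := ((((h a b).mul (h c d)).sub ((h a c).mul (h b d))).add ((h a d).mul (h b c))).fderiv
  change fderiv ℝ ((fun q => W q ![a, b]) * (fun q => W q ![c, d]) -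
    (fun q => W q ![a, c]) * (fun q => W q ![b, d]) +
    (fun q => W q ![a, d]) * (fun q => W q ![b, c])) p u = _
  rw [this]
  simp only [add_apply, sub_apply, smul_apply, smul_eq_mul]
  ring

/-- If `ω` is closed at a point and `φ = ±½ ω ∧ ω` nearby, where `φ` does not
vanish at the point, then `φ` is closed at the point: the sign is locally constant. -/
theorem extDeriv_eq_zero_of_eq_halfSq {W : E → E [⋀^Fin 2]→L[ℝ] ℝ} {φ : E → E [⋀^Fin 4]→L[ℝ] ℝ}
    {p : E} (hW : DifferentiableAt ℝ W p) (hdW : extDeriv W p = 0) (hφ0 : φ p ≠ 0)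
    (hφ : ∀ᶠ q in 𝓝 p, ∃ ε : ℝ, ε * ε = 1 ∧ ∀ v : Fin 4 → E, φ q v =
      ε * halfSq (fun x y => W q ![x, y]) (v 0) (v 1) (v 2) (v 3)) :
    extDeriv φ p = 0 := by
  by_cases hφd : DifferentiableAt ℝ φ p
  swap
  · exact extDeriv_of_not_differentiableAt hφd
  obtain ⟨ε, hε, hφp⟩ := hφ.self_of_nhds
  obtain ⟨v₀, hv₀⟩ : ∃ v, φ p v ≠ 0 := by
    by_contra! hcon
    exact hφ0 (by ext v; exact hcon v)
  set Q : E → (Fin 4 → E) → ℝ := fun q v =>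
    halfSq (fun x y => W q ![x, y]) (v 0) (v 1) (v 2) (v 3) with hQ
  have hQ0 : Q p v₀ ≠ 0 := by
    intro h0
    apply hv₀
    rw [hφp v₀]
    exact mul_eq_zero_of_right _ h0
  have hWc : ∀ x y, ContinuousAt (fun q => W q ![x, y]) p := fun x y =>
    (hasFDerivAt_apply_form hW ![x, y]).continuousAt
  have hQc : ContinuousAt (fun q => Q q v₀) p :=
    (((hWc _ _).mul (hWc _ _)).sub ((hWc _ _).mul (hWc _ _))).add ((hWc _ _).mul (hWc _ _))
  have hφv : ContinuousAt (fun q => φ q v₀) p := (hasFDerivAt_apply_form hφd v₀).continuousAt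
  have hr : ContinuousAt (fun q => φ q v₀ / Q q v₀) p := hφv.div hQc hQ0
  have hrp : φ p v₀ / Q p v₀ = ε := by rw [hφp v₀]; exact mul_div_cancel_right₀ _ hQ0
  -- the sign is the quotient of two continuous functions, hence constant near `p`
  have hnear : ∀ᶠ q in 𝓝 p, |φ q v₀ / Q q v₀ - ε| < 1 := by
    have := Metric.tendsto_nhds.1 hr 1 one_pos
    simpa [Real.dist_eq, hrp] using this
  have hsign : ∀ᶠ q in 𝓝 p, ∀ v, φ q v = ε * Q q v := by
    filter_upwards [hnear, hφ, hQc.eventually_ne hQ0] with q hq1 hq2 hq3 v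
    obtain ⟨ε', hε', hq2⟩ := hq2
    have : φ q v₀ / Q q v₀ = ε' := by rw [hq2 v₀]; exact mul_div_cancel_right₀ _ hq3
    rw [this] at hq1
    rw [hq2 v]
    have : ε' = ε := by
      rcases mul_self_eq_one_iff.1 hε with rfl | rfl <;>
        rcases mul_self_eq_one_iff.1 hε' with rfl | rfl <;>
        first | rfl | (exfalso; norm_num at hq1)
    rw [this]
  have hfd : ∀ (v : Fin 4 → E) (u : E), fderiv ℝ (fun q => φ q v) p u =
      ε * fderiv ℝ (fun q => Q q v) p u := by
    intro v u
    have h1 : (fun q => φ q v) =ᶠ[𝓝 p] fun q => ε * Q q v := by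
      filter_upwards [hsign] with q hq using hq v
    rw [h1.fderiv_eq]
    have hd : DifferentiableAt ℝ (fun q => Q q v) p := by
      have h := fun x y => (hasFDerivAt_apply_form hW ![x, y]).differentiableAt
      exact (((h _ _).mul (h _ _)).sub ((h _ _).mul (h _ _))).add ((h _ _).mul (h _ _))
    rw [fderiv_const_mul hd]
    rfl
  have hC : ∀ x y z, fderiv ℝ (fun q => W q ![y, z]) p x -
      fderiv ℝ (fun q => W q ![x, z]) p y + fderiv ℝ (fun q => W q ![x, y]) p z = 0 := by
    intro x y z
    rw [← extDeriv_twoForm_apply hW, hdW]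
    rfl
  ext v
  change _ = (0 : ℝ)
  rw [extDeriv_apply hφd, Fin.sum_univ_five]
  simp only [hfd, hQ]
  simp only [fderiv_halfSq hW]
  have r0 : ∀ j, Fin.removeNth 0 v j = v (j.succ) := fun j => rfl
  have r10 : Fin.removeNth 1 v 0 = v 0 := rfl
  have r11 : Fin.removeNth 1 v 1 = v 2 := rfl
  have r12 : Fin.removeNth 1 v 2 = v 3 := rfl
  have r13 : Fin.removeNth 1 v 3 = v 4 := rfl
  have r20 : Fin.removeNth 2 v 0 = v 0 := rfl
  have r21 : Fin.removeNth 2 v 1 = v 1 := rfl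
  have r22 : Fin.removeNth 2 v 2 = v 3 := rfl
  have r23 : Fin.removeNth 2 v 3 = v 4 := rfl
  have r30 : Fin.removeNth 3 v 0 = v 0 := rfl
  have r31 : Fin.removeNth 3 v 1 = v 1 := rfl
  have r32 : Fin.removeNth 3 v 2 = v 2 := rfl
  have r33 : Fin.removeNth 3 v 3 = v 4 := rfl
  have r40 : Fin.removeNth 4 v 0 = v 0 := rfl
  have r41 : Fin.removeNth 4 v 1 = v 1 := rfl
  have r42 : Fin.removeNth 4 v 2 = v 2 := rfl
  have r43 : Fin.removeNth 4 v 3 = v 3 := rfl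
  simp only [r0, r10, r11, r12, r13, r20, r21, r22, r23, r30, r31, r32, r33, r40, r41, r42, r43]
  have s0 : (Fin.succ 0 : Fin 5) = 1 := rfl
  have s1 : (Fin.succ 1 : Fin 5) = 2 := rfl
  have s2 : (Fin.succ 2 : Fin 5) = 3 := rfl
  have s3 : (Fin.succ 3 : Fin 5) = 4 := rfl
  simp only [s0, s1, s2, s3]
  have m0 : ((-1 : ℤ)) ^ (0 : Fin 5).val = 1 := rfl
  have m1 : ((-1 : ℤ)) ^ (1 : Fin 5).val = -1 := rfl
  have m2 : ((-1 : ℤ)) ^ (2 : Fin 5).val = 1 := rfl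
  have m3 : ((-1 : ℤ)) ^ (3 : Fin 5).val = -1 := rfl
  have m4 : ((-1 : ℤ)) ^ (4 : Fin 5).val = 1 := rfl
  simp only [m0, m1, m2, m3, m4, one_smul, neg_smul]
  generalize v 0 = a
  generalize v 1 = b
  generalize v 2 = c
  generalize v 3 = d
  generalize v 4 = e
  -- the components of `dω ∧ ω`, one for each way of choosing three of the five vectors
  linear_combination ε * (hC a b c * W p ![d, e] - hC a b d * W p ![c, e]
    + hC a b e * W p ![c, d] + hC a c d * W p ![b, e] - hC a c e * W p ![b, d]
    + hC a d e * W p ![b, c] - hC b c d * W p ![a, e] + hC b c e * W p ![a, d]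
    - hC b d e * W p ![a, c] + hC c d e * W p ![a, b])

variable {E₁ : Type*} [NormedAddCommGroup E₁] [NormedSpace ℝ E₁]
  {E₂ : Type*} [NormedAddCommGroup E₂] [NormedSpace ℝ E₂]

theorem fderiv_mul_prod {f : E₁ → ℝ} {h : E₂ → ℝ} {p : E₁ × E₂} (hf : DifferentiableAt ℝ f p.1)
    (hh : DifferentiableAt ℝ h p.2) (x : E₂) :
    fderiv ℝ (fun q : E₁ × E₂ => f q.1 * h q.2) p (0, x) = f p.1 * fderiv ℝ h p.2 x := by
  have h1 : HasFDerivAt (fun q : E₁ × E₂ => f q.1) _ p :=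
    HasFDerivAt.comp p hf.hasFDerivAt hasFDerivAt_fst
  have h2 : HasFDerivAt (fun q : E₁ × E₂ => h q.2) _ p :=
    HasFDerivAt.comp p hh.hasFDerivAt hasFDerivAt_snd
  change fderiv ℝ ((fun q : E₁ × E₂ => f q.1) * fun q : E₁ × E₂ => h q.2) p _ = _
  rw [(h1.mul h2).fderiv]
  simp

open Classical in
/-- Seven-forms on a product which vanish on tuples with fewer than five vectors having a
component along the five-dimensional first factor, and whose remaining components are the product
of a volume form there and a closed two-form on the second factor, are closed. -/
theorem extDeriv_eq_zero_of_prod (hE₁ : Module.finrank ℝ E₁ = 5)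
    {G : E₁ × E₂ → (E₁ × E₂) [⋀^Fin 7]→L[ℝ] ℝ} {a : E₁ → (Fin 5 → E₁) → ℝ}
    {W : E₂ → E₂ [⋀^Fin 2]→L[ℝ] ℝ} {p : E₁ × E₂}
    (ha : ∀ n, DifferentiableAt ℝ (fun q => a q n) p.1) (hW : DifferentiableAt ℝ W p.2)
    (hdW : extDeriv W p.2 = 0)
    (hvan : ∀ᶠ q in 𝓝 p, ∀ z : Fin 7 → E₁ × E₂,
      (Finset.univ.filter fun i => (z i).1 ≠ 0).card < 5 → G q z = 0)
    (hval : ∀ᶠ q in 𝓝 p, ∀ z : Fin 7 → E₁ × E₂, (z 5).1 = 0 → (z 6).1 = 0 →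
      G q z = a q.1 ![(z 0).1, (z 1).1, (z 2).1, (z 3).1, (z 4).1] *
        W q.2 ![(z 5).2, (z 6).2]) :
    extDeriv G p = 0 := by
  by_cases hG : DifferentiableAt ℝ G p
  swap
  · exact extDeriv_of_not_differentiableAt hG
  have hzero : ∀ (z : Fin 7 → E₁ × E₂) (x : E₁ × E₂),
      (Finset.univ.filter fun i => (z i).1 ≠ 0).card < 5 → fderiv ℝ (fun q => G q z) p x = 0 := by
    intro z x hz
    have : (fun q => G q z) =ᶠ[𝓝 p] fun _ => (0 : ℝ) := by
      filter_upwards [hvan] with q hq using hq z hz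
    rw [this.fderiv_eq]
    simp
  have hremove : ∀ (w : Fin 8 → E₁ × E₂) (S : Finset (Fin 8)) (_ : ∀ i ∉ S, (w i).1 = 0)
      (i : Fin 8), (Finset.univ.filter fun j => (Fin.removeNth i w j).1 ≠ 0).card ≤
        (S.erase i).card := by
    intro w S hS i
    refine Finset.card_le_card_of_injOn i.succAbove (fun j hj => ?_)
      (Fin.succAbove_right_injective.injOn)
    have hj : (w (i.succAbove j)).1 ≠ 0 := (Finset.mem_filter.1 hj).2
    refine Finset.mem_coe.2 (Finset.mem_erase.2 ⟨Fin.succAbove_ne i j, ?_⟩)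
    by_contra hcon
    exact hj (hS _ hcon)
  -- tuples whose last three vectors are tangent to the second factor
  have hsorted : ∀ w : Fin 8 → E₁ × E₂, (w 5).1 = 0 → (w 6).1 = 0 → (w 7).1 = 0 →
      extDeriv G p w = 0 := by
    intro w h5 h6 h7
    have hS : ∀ i ∉ ({0, 1, 2, 3, 4} : Finset (Fin 8)), (w i).1 = 0 := by
      intro i hi
      fin_cases i <;> first | exact h5 | exact h6 | exact h7 | exact absurd (by decide) hi
    have hlow : ∀ (i : Fin 8) (x : E₁ × E₂), i ∈ ({0, 1, 2, 3, 4} : Finset (Fin 8)) →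
        fderiv ℝ (fun q => G q (Fin.removeNth i w)) p x = 0 := by
      intro i x hi
      refine hzero _ _ ((hremove w _ hS i).trans_lt ?_)
      rw [Finset.card_erase_of_mem hi]
      decide
    have hhigh : ∀ z : Fin 7 → E₁ × E₂, (z 5).1 = 0 → (z 6).1 = 0 → ∀ x : E₁ × E₂, x.1 = 0 →
        fderiv ℝ (fun q => G q z) p x =
          a p.1 ![(z 0).1, (z 1).1, (z 2).1, (z 3).1, (z 4).1] *
            fderiv ℝ (fun q => W q ![(z 5).2, (z 6).2]) p.2 x.2 := by
      intro z hz5 hz6 x hx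
      have : (fun q => G q z) =ᶠ[𝓝 p] fun q =>
          a q.1 ![(z 0).1, (z 1).1, (z 2).1, (z 3).1, (z 4).1] * W q.2 ![(z 5).2, (z 6).2] := by
        filter_upwards [hval] with q hq using hq z hz5 hz6
      rw [this.fderiv_eq]
      obtain ⟨x₁, x₂⟩ := x
      obtain rfl : x₁ = 0 := hx
      exact fderiv_mul_prod (ha _) (hasFDerivAt_apply_form hW _).differentiableAt _
    have e5 := hhigh (Fin.removeNth 5 w) h6 h7 (w 5) h5
    have e6 := hhigh (Fin.removeNth 6 w) h5 h7 (w 6) h6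
    have e7 := hhigh (Fin.removeNth 7 w) h5 h6 (w 7) h7
    have hC := extDeriv_twoForm_apply hW (w 5).2 (w 6).2 (w 7).2
    rw [hdW] at hC
    have hC : (0 : ℝ) = _ := hC
    rw [extDeriv_apply hG, Fin.sum_univ_eight]
    rw [hlow 0 _ (by decide), hlow 1 _ (by decide), hlow 2 _ (by decide), hlow 3 _ (by decide),
      hlow 4 _ (by decide), e5, e6, e7]
    have m5 : ((-1 : ℤ)) ^ (5 : Fin 8).val = -1 := rfl
    have m6 : ((-1 : ℤ)) ^ (6 : Fin 8).val = 1 := rfl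
    have m7 : ((-1 : ℤ)) ^ (7 : Fin 8).val = -1 := rfl
    simp only [m5, m6, m7, one_smul, neg_smul, smul_zero]
    change 0 + 0 + 0 + 0 + 0 + -(a p.1 ![(w 0).1, (w 1).1, (w 2).1, (w 3).1, (w 4).1] *
        fderiv ℝ (fun q => W q ![(w 6).2, (w 7).2]) p.2 (w 5).2) +
      a p.1 ![(w 0).1, (w 1).1, (w 2).1, (w 3).1, (w 4).1] *
        fderiv ℝ (fun q => W q ![(w 5).2, (w 7).2]) p.2 (w 6).2 +
      -(a p.1 ![(w 0).1, (w 1).1, (w 2).1, (w 3).1, (w 4).1] *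
        fderiv ℝ (fun q => W q ![(w 5).2, (w 6).2]) p.2 (w 7).2) = 0
    linear_combination (a p.1 ![(w 0).1, (w 1).1, (w 2).1, (w 3).1, (w 4).1]) * hC
  -- expand every vector into its two components; `S` is the set of places where the first is chosen
  ext v
  change _ = (0 : ℝ)
  have hsplit : v = (fun i => ((v i).1, (0 : E₂))) + fun i => ((0 : E₁), (v i).2) := by
    funext i; simp
  rw [hsplit]
  have := (extDeriv G p).toMultilinearMap.map_add_univ (fun i => ((v i).1, (0 : E₂)))
    (fun i => ((0 : E₁), (v i).2))
  refine this.trans (Finset.sum_eq_zero fun S _ => ?_)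
  set w : Fin 8 → E₁ × E₂ := S.piecewise (fun i => ((v i).1, (0 : E₂)))
    (fun i => ((0 : E₁), (v i).2)) with hw
  change extDeriv G p w = 0
  have hwS : ∀ i ∈ S, w i = ((v i).1, 0) := fun i hi => by simp [hw, hi]
  have hwS' : ∀ i ∉ S, (w i).1 = 0 := fun i hi => by simp [hw, hi]
  rcases lt_trichotomy S.card 5 with hlt | heq | hgt
  -- every term of the exterior derivative vanishes identically
  · rw [extDeriv_apply hG]
    refine Finset.sum_eq_zero fun i _ => ?_
    rw [hzero _ _ ((hremove w S hwS' i).trans_lt ((Finset.card_le_card (S.erase_subset i)).trans_lt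
      hlt)), smul_zero]
  -- a permutation moves the three vectors of the second factor to the end
  · have hcard : Fintype.card {x : Fin 8 // x.val < 5} = Fintype.card {x : Fin 8 // x ∈ S} := by
      rw [Fintype.card_coe, heq]; rfl
    set σ : Equiv.Perm (Fin 8) := (Fintype.equivOfCardEq hcard).extendSubtype with hσ
    have hσ' : ∀ i : Fin 8, ¬ i.val < 5 → (w (σ i)).1 = 0 := fun i hi =>
      hwS' _ (Equiv.extendSubtype_not_mem _ i hi)
    rw [eq_sign_mul_apply_comp _ w σ,
      hsorted _ (hσ' 5 (by decide)) (hσ' 6 (by decide)) (hσ' 7 (by decide)), mul_zero]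
  -- more than five vectors of a five-dimensional space are linearly dependent
  · refine (extDeriv G p).toAlternatingMap.map_linearDependent w fun hli => ?_
    have h1 : LinearIndependent ℝ (fun i : S => w i) :=
      hli.comp (fun i : S => (i : Fin 8)) Subtype.val_injective
    have h2 : LinearIndependent ℝ (fun i : S => (v i).1) := by
      refine LinearIndependent.of_comp (LinearMap.inl ℝ E₁ E₂) ?_
      convert h1 using 1
      funext i
      exact (hwS i i.2).symm
    have : FiniteDimensional ℝ E₁ := Module.finite_of_finrank_eq_succ hE₁
    have h3 := h2.fintype_card_le_finrank
    rw [hE₁, Fintype.card_coe] at h3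
    omega

end ExtDeriv

/-! ### Smoothness of form-valued functions -/

section Smooth

variable {X : Type*} [NormedAddCommGroup X] [NormedSpace ℝ X]
  {E : Type*} [NormedAddCommGroup E] [NormedSpace ℝ E] [FiniteDimensional ℝ E]

/-- On a finite-dimensional space, a function with values in forms is smooth as soon as its
evaluations on constant vectors are. -/
theorem contDiffOn_form {n : WithTop ℕ∞} {k : ℕ} {f : X → E [⋀^Fin k]→L[ℝ] ℝ} {s : Set X}
    (hf : ∀ v, ContDiffOn ℝ n (fun x => f x v) s) : ContDiffOn ℝ n f s := by
  let b := Module.finBasis ℝ E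
  let L : (E [⋀^Fin k]→L[ℝ] ℝ) →ₗ[ℝ] ((Fin k → Fin (Module.finrank ℝ E)) → ℝ) :=
    { toFun := fun α I => α (fun a => b (I a))
      map_add' := fun _ _ => rfl
      map_smul' := fun _ _ => rfl }
  have hL : LinearMap.ker L = ⊥ := by
    rw [LinearMap.ker_eq_bot']
    intro α hα
    have : α.toAlternatingMap = 0 := b.ext_alternating fun I _ => congrFun hα I
    ext v
    exact congrArg (fun f => f v) this
  obtain ⟨P, hP⟩ := LinearMap.exists_leftInverse_of_injective L hL
  have : f = fun x => LinearMap.toContinuousLinearMap P (fun I => f x (fun a => b (I a))) := by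
    funext x
    exact (LinearMap.congr_fun hP (f x)).symm
  rw [this]
  exact (ContinuousLinearMap.contDiff _).comp_contDiffOn (contDiffOn_pi.2 fun I => hf _)

omit [FiniteDimensional ℝ E] in
theorem contDiffOn_form_apply {n : WithTop ℕ∞} {k : ℕ} {f : X → E [⋀^Fin k]→L[ℝ] ℝ} {s : Set X}
    (hf : ContDiffOn ℝ n f s) (v : Fin k → E) : ContDiffOn ℝ n (fun x => f x v) s := by
  have : (fun x => f x v) = fun x => ContinuousMultilinearMap.apply ℝ (fun _ : Fin k => E) ℝ v
    (ContinuousAlternatingMap.toContinuousMultilinearMapCLM ℝ (f x)) := rfl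
  rw [this]
  exact (ContinuousLinearMap.contDiff _).comp_contDiffOn
    ((ContinuousLinearMap.contDiff _).comp_contDiffOn hf)

theorem contDiffOn_bilin {n : WithTop ℕ∞} {G : X → E →L[ℝ] E →L[ℝ] ℝ} {s : Set X}
    (hG : ∀ v w, ContDiffOn ℝ n (fun x => G x v w) s) : ContDiffOn ℝ n G s :=
  contDiffOn_clm_apply.2 fun v => contDiffOn_clm_apply.2 fun w => hG v w

omit [FiniteDimensional ℝ E] in
theorem contDiffOn_bilin_apply {n : WithTop ℕ∞} {G : X → E →L[ℝ] E →L[ℝ] ℝ} {s : Set X}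
    (hG : ContDiffOn ℝ n G s) (v w : E) : ContDiffOn ℝ n (fun x => G x v w) s :=
  (hG.clm_apply contDiffOn_const).clm_apply contDiffOn_const

theorem contDiffOn_det {n : WithTop ℕ∞} {m : ℕ} {A : X → Matrix (Fin m) (Fin m) ℝ} {s : Set X}
    (hA : ∀ i j, ContDiffOn ℝ n (fun x => A x i j) s) : ContDiffOn ℝ n (fun x => (A x).det) s := by
  simp only [Matrix.det_apply]
  refine ContDiffOn.sum fun σ _ => ?_
  have : ContDiffOn ℝ n (fun x => ∏ i, A x (σ i) i) s := contDiffOn_prod fun i _ => hA _ _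
  exact this.const_smul (Equiv.Perm.sign σ : ℤ)

theorem contDiffOn_matrix_inv {n : WithTop ℕ∞} {m : ℕ} {A : X → Matrix (Fin m) (Fin m) ℝ}
    {s : Set X} (hA : ∀ i j, ContDiffOn ℝ n (fun x => A x i j) s) (hdet : ∀ x ∈ s, (A x).det ≠ 0)
    (i j : Fin m) : ContDiffOn ℝ n (fun x => (A x)⁻¹ i j) s := by
  -- Cramer's rule
  have : (fun x => (A x)⁻¹ i j) =
      fun x => (A x).det⁻¹ * ((A x).updateRow j (Pi.single i 1)).det := by
    funext x
    rw [Matrix.inv_def, Ring.inverse_eq_inv', Matrix.smul_apply, smul_eq_mul,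
      Matrix.adjugate_apply]
  rw [this]
  refine ((contDiffOn_det hA).inv hdet).mul (contDiffOn_det fun a b => ?_)
  by_cases h : a = j
  · subst h
    simpa using contDiffOn_const
  · simpa [Matrix.updateRow_ne h] using hA a b

/-- The Hodge star of a smooth form with respect to a smooth metric is smooth. -/
theorem contDiffOn_hodge {n : WithTop ℕ∞} {m k : ℕ} {g : X → E →L[ℝ] E →L[ℝ] ℝ}
    {vol : X → E [⋀^Fin (m + k)]→L[ℝ] ℝ} {β : X → E [⋀^Fin k]→L[ℝ] ℝ} {s : Set X}
    (hg : ContDiffOn ℝ n g s) (hs : ∀ x ∈ s, IsScalarProduct (g x)) (hvol : ContDiffOn ℝ n vol s)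
    (hβ : ContDiffOn ℝ n β s) :
    ContDiffOn ℝ n (fun x => hodge (g x) (vol x) (β x)) s := by
  refine contDiffOn_form fun w => ?_
  simp only [hodge_apply]
  refine contDiffOn_const.mul (ContDiffOn.sum fun i _ => ContDiffOn.mul ?_ ?_)
  · have hexp : ∀ x, β x (fun a => raisedBasis (g x) (i a)) =
        ∑ J : Fin k → Fin (Module.finrank ℝ E), (∏ a, (Matrix.of fun a b =>
          g x (Module.finBasis ℝ E a) (Module.finBasis ℝ E b))⁻¹ (i a) (J a)) *
          β x (fun a => Module.finBasis ℝ E (J a)) := by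
      intro x
      have h1 := (β x).toMultilinearMap.map_sum (fun a (j : Fin (Module.finrank ℝ E)) =>
        (Matrix.of fun a b =>
          g x (Module.finBasis ℝ E a) (Module.finBasis ℝ E b))⁻¹ (i a) j • Module.finBasis ℝ E j)
      refine h1.trans (Finset.sum_congr rfl fun J _ => ?_)
      exact (β x).toMultilinearMap.map_smul_univ _ _
    simp only [hexp]
    refine ContDiffOn.sum fun J _ => ContDiffOn.mul ?_ (contDiffOn_form_apply hβ _)
    refine contDiffOn_prod fun a _ => contDiffOn_matrix_inv (fun c d => ?_)
      (fun x hx => (hs x hx).det_ne_zero) _ _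
    exact contDiffOn_bilin_apply hg _ _
  · simp only [insertVectors_apply]
    exact contDiffOn_form_apply hvol _

end Smooth

/-! ### The Ricci tensor of a product metric -/

section Ricci

variable {E : Type*} [NormedAddCommGroup E] [NormedSpace ℝ E] [FiniteDimensional ℝ E]

theorem IsScalarProduct.isInvertible {g : E →L[ℝ] E →L[ℝ] ℝ} (hg : IsScalarProduct g) :
    g.IsInvertible := by
  have hinj : Function.Injective (g : E →ₗ[ℝ] E →L[ℝ] ℝ) := by
    rw [injective_iff_map_eq_zero]
    intro x hx
    exact hg.nondeg x fun y => congrArg (fun f : E →L[ℝ] ℝ => f y) hx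
  have hfin : Module.finrank ℝ E = Module.finrank ℝ (E →L[ℝ] ℝ) := by
    rw [← (LinearMap.toContinuousLinearMap (𝕜 := ℝ) (E := E) (F' := ℝ)).finrank_eq]
    exact (Subspace.dual_finrank_eq).symm
  let e := LinearEquiv.ofBijective (g : E →ₗ[ℝ] E →L[ℝ] ℝ)
    ⟨hinj, (LinearMap.injective_iff_surjective_of_finrank_eq_finrank hfin).1 hinj⟩
  exact ⟨e.toContinuousLinearEquiv, by ext x y; rfl⟩

/-- For a nondegenerate metric, `christoffel` satisfies the equation which determines it. -/
theorem christoffel_apply_apply {G : E → E →L[ℝ] E →L[ℝ] ℝ} {p : E} (hG : IsScalarProduct (G p))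
    (u v w : E) : G p (christoffel G p u v) w = christoffelLower G p u v w := by
  have : G p (christoffel G p u v) = christoffelLower G p u v := by
    change G p ((G p).inverse (christoffelLower G p u v)) = _
    exact hG.isInvertible.self_apply_inverse _
  rw [this]

theorem contDiffAt_christoffel {G : E → E →L[ℝ] E →L[ℝ] ℝ} {p : E} (hG : ContDiffAt ℝ 2 G p)
    (hp : IsScalarProduct (G p)) : ContDiffAt ℝ 1 (christoffel G) p := by
  have hinv : ContDiffAt ℝ 1 (fun q => (G q).inverse) p := by
    obtain ⟨e, he⟩ := hp.isInvertible
    have h1 : ContDiffAt ℝ 1 ContinuousLinearMap.inverse (G p) := by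
      rw [← he]; exact contDiffAt_map_inverse e
    exact h1.comp p (hG.of_le (by norm_num))
  have hD : ContDiffAt ℝ 1 (fderiv ℝ G) p := hG.fderiv_right (by norm_num)
  have hflip : ContDiffAt ℝ 1 (fun q => (fderiv ℝ G q).flip) p :=
    ((ContinuousLinearMap.flipₗᵢ ℝ E E (E →L[ℝ] ℝ)).toContinuousLinearEquiv.contDiff).contDiffAt.comp
      p hD
  have hlow : ContDiffAt ℝ 1 (christoffelLower G) p := by
    unfold christoffelLower
    exact ((hD.add hflip).sub (contDiffAt_const.clm_comp hflip)).const_smul (1 / 2 : ℝ)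
  unfold christoffel
  exact ((ContinuousLinearMap.contDiff
    (ContinuousLinearMap.compL ℝ E (E →L[ℝ] ℝ) E)).contDiffAt.comp p hinv).clm_comp hlow

omit [FiniteDimensional ℝ E] in
theorem fderiv_clm_apply_apply {F : Type*} [NormedAddCommGroup F] [NormedSpace ℝ F]
    {G : E → E →L[ℝ] E →L[ℝ] F} {p : E} (hG : DifferentiableAt ℝ G p) (u v w : E) :
    fderiv ℝ G p u v w = fderiv ℝ (fun q => G q v w) p u := by
  have h := (hG.hasFDerivAt.clm_apply (hasFDerivAt_const v p)).clm_apply (hasFDerivAt_const w p)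
  rw [h.fderiv]
  simp

variable {E₁ : Type*} [NormedAddCommGroup E₁] [NormedSpace ℝ E₁] [FiniteDimensional ℝ E₁]
  {E₂ : Type*} [NormedAddCommGroup E₂] [NormedSpace ℝ E₂] [FiniteDimensional ℝ E₂]
  {G₁ : E₁ → E₁ →L[ℝ] E₁ →L[ℝ] ℝ} {G₂ : E₂ → E₂ →L[ℝ] E₂ →L[ℝ] ℝ}

theorem contDiffOn_prodScalar {n : WithTop ℕ∞} {s : Set E₁} {t : Set E₂}
    (h₁ : ContDiffOn ℝ n G₁ s) (h₂ : ContDiffOn ℝ n G₂ t) :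
    ContDiffOn ℝ n (fun q : E₁ × E₂ => prodScalar (G₁ q.1) (G₂ q.2)) (s ×ˢ t) := by
  refine contDiffOn_bilin fun v w => ?_
  simp only [prodScalar_apply]
  exact ((contDiffOn_bilin_apply h₁ _ _).comp contDiffOn_fst fun q hq => hq.1).add
    ((contDiffOn_bilin_apply h₂ _ _).comp contDiffOn_snd fun q hq => hq.2)

/-- The exclusion of `∞` comes from the definition of smoothness at a point, which for `n = ∞` does not
provide one neighbourhood for all finite orders. -/
theorem contDiffAt_prodScalar {n : WithTop ℕ∞} {p : E₁ × E₂} (hn : n ≠ ∞)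
    (h₁ : ContDiffAt ℝ n G₁ p.1) (h₂ : ContDiffAt ℝ n G₂ p.2) :
    ContDiffAt ℝ n (fun q : E₁ × E₂ => prodScalar (G₁ q.1) (G₂ q.2)) p := by
  obtain ⟨s, hs, h₁⟩ := h₁.contDiffOn le_rfl (fun h => absurd h hn)
  obtain ⟨t, ht, h₂⟩ := h₂.contDiffOn le_rfl (fun h => absurd h hn)
  exact (contDiffOn_prodScalar h₁ h₂).contDiffAt (prod_mem_nhds hs ht)

theorem christoffelLower_prodScalar {p : E₁ × E₂} (h₁ : ContDiffAt ℝ 1 G₁ p.1)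
    (h₂ : ContDiffAt ℝ 1 G₂ p.2) (u v w : E₁ × E₂) :
    christoffelLower (fun q : E₁ × E₂ => prodScalar (G₁ q.1) (G₂ q.2)) p u v w =
      christoffelLower G₁ p.1 u.1 v.1 w.1 + christoffelLower G₂ p.2 u.2 v.2 w.2 := by
  have hd := (contDiffAt_prodScalar (by norm_num) h₁ h₂).differentiableAt one_ne_zero
  have hd₁ := h₁.differentiableAt one_ne_zero
  have hd₂ := h₂.differentiableAt one_ne_zero
  have key : ∀ u v w : E₁ × E₂,
      fderiv ℝ (fun q : E₁ × E₂ => prodScalar (G₁ q.1) (G₂ q.2)) p u v w =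
        fderiv ℝ G₁ p.1 u.1 v.1 w.1 + fderiv ℝ G₂ p.2 u.2 v.2 w.2 := by
    intro u v w
    rw [fderiv_clm_apply_apply hd, fderiv_clm_apply_apply hd₁, fderiv_clm_apply_apply hd₂]
    have e₁ : HasFDerivAt (fun q : E₁ × E₂ => G₁ q.1 v.1 w.1) _ p :=
      HasFDerivAt.comp (g := fun q => G₁ q v.1 w.1) p
        (((hd₁.clm_apply (differentiableAt_const v.1)).clm_apply
          (differentiableAt_const w.1)).hasFDerivAt) hasFDerivAt_fst
    have e₂ : HasFDerivAt (fun q : E₁ × E₂ => G₂ q.2 v.2 w.2) _ p :=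
      HasFDerivAt.comp (g := fun q => G₂ q v.2 w.2) p
        (((hd₂.clm_apply (differentiableAt_const v.2)).clm_apply
          (differentiableAt_const w.2)).hasFDerivAt) hasFDerivAt_snd
    change fderiv ℝ ((fun q : E₁ × E₂ => G₁ q.1 v.1 w.1) + fun q => G₂ q.2 v.2 w.2) p u = _
    rw [(e₁.add e₂).fderiv]
    rfl
  simp only [christoffelLower_apply, key]
  ring

/-- The Levi-Civita connection of a product metric is the product of the connections. -/
theorem christoffel_prodScalar {p : E₁ × E₂} (h₁ : ContDiffAt ℝ 1 G₁ p.1)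
    (h₂ : ContDiffAt ℝ 1 G₂ p.2) (hs₁ : IsScalarProduct (G₁ p.1)) (hs₂ : IsScalarProduct (G₂ p.2))
    (u v : E₁ × E₂) :
    christoffel (fun q : E₁ × E₂ => prodScalar (G₁ q.1) (G₂ q.2)) p u v =
      (christoffel G₁ p.1 u.1 v.1, christoffel G₂ p.2 u.2 v.2) := by
  have hs := hs₁.prod hs₂
  rw [← sub_eq_zero]
  refine hs.nondeg _ fun w => ?_
  have e := christoffel_apply_apply (G := fun q : E₁ × E₂ => prodScalar (G₁ q.1) (G₂ q.2))
    (p := p) hs u v w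
  rw [map_sub, sub_apply, e, christoffelLower_prodScalar h₁ h₂, prodScalar_apply,
    christoffel_apply_apply hs₁, christoffel_apply_apply hs₂, sub_self]

/-- The Ricci tensor of a product metric is the sum of the Ricci tensors of the factors: the curvature
endomorphism is block diagonal, and its trace the sum of the traces of the blocks. -/
theorem ricciFlat_prodScalar {p : E₁ × E₂} (h₁ : ContDiffAt ℝ 2 G₁ p.1)
    (h₂ : ContDiffAt ℝ 2 G₂ p.2) (hs₁ : ∀ᶠ q in 𝓝 p.1, IsScalarProduct (G₁ q))
    (hs₂ : ∀ᶠ q in 𝓝 p.2, IsScalarProduct (G₂ q)) (v w : E₁ × E₂) :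
    ricciFlat (fun q : E₁ × E₂ => prodScalar (G₁ q.1) (G₂ q.2)) p v w =
      ricciFlat G₁ p.1 v.1 w.1 + ricciFlat G₂ p.2 v.2 w.2 := by
  set G := fun q : E₁ × E₂ => prodScalar (G₁ q.1) (G₂ q.2) with hG
  have hs : IsScalarProduct (G p) := hs₁.self_of_nhds.prod hs₂.self_of_nhds
  have hΓ : DifferentiableAt ℝ (christoffel G) p :=
    (contDiffAt_christoffel (contDiffAt_prodScalar (by norm_num) h₁ h₂) hs).differentiableAt
      one_ne_zero
  have hΓ₁ : DifferentiableAt ℝ (christoffel G₁) p.1 :=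
    (contDiffAt_christoffel h₁ hs₁.self_of_nhds).differentiableAt one_ne_zero
  have hΓ₂ : DifferentiableAt ℝ (christoffel G₂) p.2 :=
    (contDiffAt_christoffel h₂ hs₂.self_of_nhds).differentiableAt one_ne_zero
  have hblock : ∀ᶠ q in 𝓝 p, ∀ u v, christoffel G q u v =
      (christoffel G₁ q.1 u.1 v.1, christoffel G₂ q.2 u.2 v.2) := by
    have c₁ := (h₁.eventually (by norm_num)).and hs₁
    have c₂ := (h₂.eventually (by norm_num)).and hs₂
    filter_upwards [continuousAt_fst.eventually c₁, continuousAt_snd.eventually c₂]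
      with q hq₁ hq₂ u v
    exact christoffel_prodScalar (hq₁.1.of_le (by norm_num)) (hq₂.1.of_le (by norm_num))
      hq₁.2 hq₂.2 u v
  have hfd : ∀ u v w : E₁ × E₂, fderiv ℝ (christoffel G) p u v w =
      (fderiv ℝ (christoffel G₁) p.1 u.1 v.1 w.1, fderiv ℝ (christoffel G₂) p.2 u.2 v.2 w.2) := by
    intro u v w
    rw [fderiv_clm_apply_apply hΓ, fderiv_clm_apply_apply hΓ₁, fderiv_clm_apply_apply hΓ₂]
    have e₁ : HasFDerivAt (fun q : E₁ × E₂ => christoffel G₁ q.1 v.1 w.1) _ p :=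
      HasFDerivAt.comp (g := fun q => christoffel G₁ q v.1 w.1) p
        (((hΓ₁.clm_apply (differentiableAt_const v.1)).clm_apply
          (differentiableAt_const w.1)).hasFDerivAt) hasFDerivAt_fst
    have e₂ : HasFDerivAt (fun q : E₁ × E₂ => christoffel G₂ q.2 v.2 w.2) _ p :=
      HasFDerivAt.comp (g := fun q => christoffel G₂ q v.2 w.2) p
        (((hΓ₂.clm_apply (differentiableAt_const v.2)).clm_apply
          (differentiableAt_const w.2)).hasFDerivAt) hasFDerivAt_snd
    have e : (fun q => christoffel G q v w) =ᶠ[𝓝 p]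
        fun q => (christoffel G₁ q.1 v.1 w.1, christoffel G₂ q.2 v.2 w.2) := by
      filter_upwards [hblock] with q hq using hq v w
    rw [e.fderiv_eq, (e₁.prodMk e₂).fderiv]
    rfl
  have hcurv : curvatureEnd G p v w =
      (curvatureEnd G₁ p.1 v.1 w.1).prodMap (curvatureEnd G₂ p.2 v.2 w.2) := by
    refine LinearMap.ext fun u => ?_
    change fderiv ℝ (christoffel G) p u v w - fderiv ℝ (christoffel G) p v u w
      + christoffel G p u (christoffel G p v w) - christoffel G p v (christoffel G p u w) = _
    simp only [hfd, hblock.self_of_nhds]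
    rfl
  unfold ricciFlat
  rw [hcurv, LinearMap.trace_prodMap']

end Ricci

/-! ### Tensor fields in charts -/

section Chart

variable {E : Type*} [NormedAddCommGroup E] [NormedSpace ℝ E]
  {H : Type*} [TopologicalSpace H] {I : ModelWithCorners ℝ E H}
  {M : Type*} [TopologicalSpace M] [ChartedSpace H M]

variable (I) in
/-- The derivative at `p` of the inverse of the chart around `x`, as an endomorphism of the model
space. -/
noncomputable def chartSymmDeriv (x : M) (p : E) : E →L[ℝ] E :=
  mfderiv 𝓘(ℝ, E) I (extChartAt I x).symm p

/-- The value of a form at a point, as a form on the model space. -/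
def DiffForm.toModel {k : ℕ} (α : DiffForm I M k) (x : M) : E [⋀^Fin k]→L[ℝ] ℝ := α x

/-- The value of a 2-tensor field at a point, as a bilinear form on the model space. -/
def BilinField.toModel (g : BilinField I M) (x : M) : E →L[ℝ] E →L[ℝ] ℝ := g x

theorem DiffForm.toModel_star [FiniteDimensional ℝ E] {m k : ℕ} (g : BilinField I M)
    (vol : DiffForm I M (m + k)) (β : DiffForm I M k) (x : M) :
    (DiffForm.star g vol β).toModel x = hodge (g.toModel x) (vol.toModel x) (β.toModel x) := rfl

theorem DiffForm.toModel_wedge {k l : ℕ} (α : DiffForm I M k) (β : DiffForm I M l) (x : M) :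
    (DiffForm.wedge α β).toModel x = Sugra.wedge (α.toModel x) (β.toModel x) := rfl

theorem DiffForm.inChart_apply {k : ℕ} (α : DiffForm I M k) (x : M) (p : E) (v : Fin k → E) :
    α.inChart x p v = α.toModel ((extChartAt I x).symm p) (fun i => chartSymmDeriv I x p (v i)) := rfl

theorem BilinField.inChart_apply (g : BilinField I M) (x : M) (p v w : E) :
    g.inChart x p v w =
      g.toModel ((extChartAt I x).symm p) (chartSymmDeriv I x p v) (chartSymmDeriv I x p w) := rfl

variable [I.Boundaryless] [IsManifold I 1 M]

/-- Mathlib identifies the tangent space at `x` with the model space through the chart around `x`, so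
this derivative is the identity. -/
theorem chartSymmDeriv_self (x : M) :
    chartSymmDeriv I x (extChartAt I x x) = ContinuousLinearMap.id ℝ E := by
  have h := mfderivWithin_range_extChartAt_symm (I := I) (x := x)
  rw [I.range_eq_univ, mfderivWithin_univ] at h
  exact h

theorem exists_equiv_chartSymmDeriv {x : M} {p : E} (hp : p ∈ (extChartAt I x).target) :
    ∃ L : E ≃L[ℝ] E, (L : E →L[ℝ] E) = chartSymmDeriv I x p := by
  have h := isInvertible_mfderivWithin_extChartAt_symm (I := I) hp
  rw [I.range_eq_univ, mfderivWithin_univ] at h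
  exact h

theorem mdifferentiableAt_extChartAt_symm_of_boundaryless {x : M} {p : E}
    (hp : p ∈ (extChartAt I x).target) :
    MDifferentiableAt 𝓘(ℝ, E) I (extChartAt I x).symm p := by
  have h := mdifferentiableWithinAt_extChartAt_symm (I := I) hp
  rwa [I.range_eq_univ, mdifferentiableWithinAt_univ] at h

theorem DiffForm.inChart_self_apply {k : ℕ} (α : DiffForm I M k) (x : M) (v : Fin k → E) :
    α.inChart x (extChartAt I x x) v = α.toModel x v := by
  rw [DiffForm.inChart_apply, chartSymmDeriv_self]
  have : ∀ y : M, y = x → α.toModel y v = α.toModel x v := by rintro y rfl; rfl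
  exact this _ (extChartAt_to_inv x)

theorem BilinField.inChart_self_apply (g : BilinField I M) (x : M) (v w : E) :
    g.inChart x (extChartAt I x x) v w = g.toModel x v w := by
  rw [BilinField.inChart_apply, chartSymmDeriv_self]
  have : ∀ y : M, y = x → g.toModel y v w = g.toModel x v w := by rintro y rfl; rfl
  exact this _ (extChartAt_to_inv x)

omit [I.Boundaryless] in
theorem DiffForm.d_apply {k : ℕ} (α : DiffForm I M k) (x : M) (v : Fin (k + 1) → E) :
    α.d.toModel x v = extDeriv (α.inChart x) (extChartAt I x x) v := by
  unfold DiffForm.toModel DiffForm.d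
  rw [mfderiv_extChartAt_self]
  rfl

omit [I.Boundaryless] in
theorem BilinField.ricci_eq (g : BilinField I M) (x : M) (v w : E) :
    g.ricci x v w = ricciFlat (g.inChart x) (extChartAt I x x) v w := by
  unfold BilinField.ricci
  rw [mfderiv_extChartAt_self]
  rfl

theorem isScalarProduct_inChart {g : BilinField I M}
    (hg : ∀ x, IsScalarProduct (g.toModel x)) {x : M} {p : E}
    (hp : p ∈ (extChartAt I x).target) : IsScalarProduct (g.inChart x p) := by
  obtain ⟨L, hL⟩ := exists_equiv_chartSymmDeriv hp
  refine ⟨fun v w => (hg _).symm _ _, fun v hv => L.injective ?_⟩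
  rw [map_zero]
  refine (hg ((extChartAt I x).symm p)).nondeg _ fun y => ?_
  have := hv (L.symm y)
  rw [BilinField.inChart_apply, ← hL] at this
  simpa using this

theorem DiffForm.star_inChart [FiniteDimensional ℝ E] {g : BilinField I M}
    (hg : ∀ x, IsScalarProduct (g.toModel x)) {m k : ℕ} (vol : DiffForm I M (m + k))
    (β : DiffForm I M k) {x : M} {p : E} (hp : p ∈ (extChartAt I x).target) :
    (DiffForm.star g vol β).inChart x p =
      hodge (g.inChart x p) (vol.inChart x p) (β.inChart x p) := by
  obtain ⟨L, hL⟩ := exists_equiv_chartSymmDeriv hp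
  have h := hodge_comp (g := g.inChart x p) (hg ((extChartAt I x).symm p)) L
    (fun v w => by rw [BilinField.inChart_apply, ← hL]; rfl)
    (vol.toModel ((extChartAt I x).symm p)) (β.toModel ((extChartAt I x).symm p))
  rw [hL] at h
  exact h

end Chart

/-! ### Charts of a product -/

section ProdChart

variable {E₁ : Type*} [NormedAddCommGroup E₁] [NormedSpace ℝ E₁]
  {H₁ : Type*} [TopologicalSpace H₁] {I₁ : ModelWithCorners ℝ E₁ H₁} [I₁.Boundaryless]
  {N : Type*} [TopologicalSpace N] [ChartedSpace H₁ N] [IsManifold I₁ 1 N]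
  {E₂ : Type*} [NormedAddCommGroup E₂] [NormedSpace ℝ E₂]
  {H₂ : Type*} [TopologicalSpace H₂] {I₂ : ModelWithCorners ℝ E₂ H₂} [I₂.Boundaryless]
  {M : Type*} [TopologicalSpace M] [ChartedSpace H₂ M] [IsManifold I₂ 1 M]

omit [I₁.Boundaryless] [I₂.Boundaryless] [IsManifold I₁ 1 N] [IsManifold I₂ 1 M] in
theorem extChartAt_prod_target (x : N × M) : (extChartAt (I₁.prod I₂) x).target =
    (extChartAt I₁ x.1).target ×ˢ (extChartAt I₂ x.2).target := by
  rw [extChartAt_prod]; rfl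

omit [I₁.Boundaryless] [I₂.Boundaryless] [IsManifold I₁ 1 N] [IsManifold I₂ 1 M] in
theorem extChartAt_prod_apply (x y : N × M) : extChartAt (I₁.prod I₂) x y =
    (extChartAt I₁ x.1 y.1, extChartAt I₂ x.2 y.2) := by
  rw [extChartAt_prod]; rfl

omit [I₁.Boundaryless] [I₂.Boundaryless] [IsManifold I₁ 1 N] [IsManifold I₂ 1 M] in
theorem extChartAt_prod_symm_apply (x : N × M) (p : E₁ × E₂) :
    (extChartAt (I₁.prod I₂) x).symm p =
      ((extChartAt I₁ x.1).symm p.1, (extChartAt I₂ x.2).symm p.2) := by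
  rw [extChartAt_prod]; rfl

theorem chartSymmDeriv_prod {x : N × M} {p : E₁ × E₂}
    (hp : p ∈ (extChartAt (I₁.prod I₂) x).target) :
    chartSymmDeriv (I₁.prod I₂) x p =
      (chartSymmDeriv I₁ x.1 p.1).prodMap (chartSymmDeriv I₂ x.2 p.2) := by
  rw [extChartAt_prod_target] at hp
  have h : ((extChartAt (I₁.prod I₂) x).symm : E₁ × E₂ → N × M) =
      Prod.map (extChartAt I₁ x.1).symm (extChartAt I₂ x.2).symm := by
    funext q; exact extChartAt_prod_symm_apply x q
  unfold chartSymmDeriv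
  rw [h, modelWithCornersSelf_prod, ← chartedSpaceSelf_prod]
  exact ((mdifferentiableAt_extChartAt_symm_of_boundaryless hp.1).hasMFDerivAt.prodMap
    (mdifferentiableAt_extChartAt_symm_of_boundaryless hp.2).hasMFDerivAt).mfderiv

omit [I₁.Boundaryless] [I₂.Boundaryless] [IsManifold I₁ 1 N] [IsManifold I₂ 1 M] in
theorem DiffForm.toModel_pullback_fst {k : ℕ} (α : DiffForm I₁ N k) (x : N × M) :
    (DiffForm.pullback (I := I₁.prod I₂) (Prod.fst : N × M → N) α).toModel x =
      (α.toModel x.1).compContinuousLinearMap (.fst ℝ E₁ E₂) := by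
  unfold DiffForm.toModel DiffForm.pullback
  rw [mfderiv_fst]
  rfl

omit [I₁.Boundaryless] [I₂.Boundaryless] [IsManifold I₁ 1 N] [IsManifold I₂ 1 M] in
theorem DiffForm.toModel_pullback_snd {k : ℕ} (α : DiffForm I₂ M k) (x : N × M) :
    (DiffForm.pullback (I := I₁.prod I₂) (Prod.snd : N × M → M) α).toModel x =
      (α.toModel x.2).compContinuousLinearMap (.snd ℝ E₁ E₂) := by
  unfold DiffForm.toModel DiffForm.pullback
  rw [mfderiv_snd]
  rfl

omit [I₁.Boundaryless] [I₂.Boundaryless] [IsManifold I₁ 1 N] [IsManifold I₂ 1 M] in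
theorem BilinField.toModel_pullback_add_pullback (g₁ : BilinField I₁ N) (g₂ : BilinField I₂ M)
    (x : N × M) :
    (BilinField.pullback (I := I₁.prod I₂) (Prod.fst : N × M → N) g₁ +
      BilinField.pullback (I := I₁.prod I₂) (Prod.snd : N × M → M) g₂).toModel x =
      prodScalar (g₁.toModel x.1) (g₂.toModel x.2) := by
  change BilinField.pullback (I := I₁.prod I₂) (Prod.fst : N × M → N) g₁ x +
      BilinField.pullback (I := I₁.prod I₂) (Prod.snd : N × M → M) g₂ x = _
  unfold BilinField.toModel BilinField.pullback
  rw [mfderiv_fst, mfderiv_snd]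
  rfl

theorem BilinField.inChart_pullback_add_pullback (g₁ : BilinField I₁ N) (g₂ : BilinField I₂ M)
    {x : N × M} {p : E₁ × E₂} (hp : p ∈ (extChartAt (I₁.prod I₂) x).target) :
    (BilinField.pullback (I := I₁.prod I₂) (Prod.fst : N × M → N) g₁ +
      BilinField.pullback (I := I₁.prod I₂) (Prod.snd : N × M → M) g₂).inChart x p =
      prodScalar (g₁.inChart x.1 p.1) (g₂.inChart x.2 p.2) := by
  refine ContinuousLinearMap.ext fun v => ContinuousLinearMap.ext fun w => ?_
  rw [BilinField.inChart_apply, BilinField.toModel_pullback_add_pullback, chartSymmDeriv_prod hp,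
    extChartAt_prod_symm_apply]
  rfl

theorem DiffForm.inChart_pullback_fst {k : ℕ} (α : DiffForm I₁ N k)
    {x : N × M} {p : E₁ × E₂} (hp : p ∈ (extChartAt (I₁.prod I₂) x).target) :
    (DiffForm.pullback (I := I₁.prod I₂) (Prod.fst : N × M → N) α).inChart x p =
      (α.inChart x.1 p.1).compContinuousLinearMap (.fst ℝ E₁ E₂) := by
  ext v
  rw [DiffForm.inChart_apply, DiffForm.toModel_pullback_fst, chartSymmDeriv_prod hp,
    extChartAt_prod_symm_apply]
  rfl

theorem DiffForm.inChart_pullback_snd {k : ℕ} (α : DiffForm I₂ M k)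
    {x : N × M} {p : E₁ × E₂} (hp : p ∈ (extChartAt (I₁.prod I₂) x).target) :
    (DiffForm.pullback (I := I₁.prod I₂) (Prod.snd : N × M → M) α).inChart x p =
      (α.inChart x.2 p.2).compContinuousLinearMap (.snd ℝ E₁ E₂) := by
  ext v
  rw [DiffForm.inChart_apply, DiffForm.toModel_pullback_snd, chartSymmDeriv_prod hp,
    extChartAt_prod_symm_apply]
  rfl

end ProdChart

/-! ### Elementary properties of forms and of the Ricci tensor -/

section FormAlgebra

variable {E : Type*} [NormedAddCommGroup E] [NormedSpace ℝ E] [FiniteDimensional ℝ E]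

theorem formInner_smul_smul (g : E →L[ℝ] E →L[ℝ] ℝ) {k : ℕ} (c : ℝ) (α β : E [⋀^Fin k]→L[ℝ] ℝ) :
    formInner g (c • α) (c • β) = c ^ 2 * formInner g α β := by
  simp only [formInner, ContinuousAlternatingMap.smul_apply, smul_eq_mul, Finset.mul_sum]
  exact Finset.sum_congr rfl fun i _ => by ring

theorem hodge_smul (g : E →L[ℝ] E →L[ℝ] ℝ) {m k : ℕ} (vol : E [⋀^Fin (m + k)]→L[ℝ] ℝ) (c : ℝ)
    (β : E [⋀^Fin k]→L[ℝ] ℝ) : hodge g vol (c • β) = c • hodge g vol β := by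
  ext v
  simp only [hodge_apply, ContinuousAlternatingMap.smul_apply, smul_eq_mul, Finset.mul_sum]
  exact Finset.sum_congr rfl fun i _ => by ring

theorem form_eq_zero_of_finrank_lt {k : ℕ} (hk : Module.finrank ℝ E < k)
    (α : E [⋀^Fin k]→L[ℝ] ℝ) : α = 0 := by
  ext v
  refine α.toAlternatingMap.map_linearDependent v fun h => ?_
  have := h.fintype_card_le_finrank
  simp only [Fintype.card_fin] at this
  omega

omit [FiniteDimensional ℝ E] in
theorem wedge_comp {E' : Type*} [NormedAddCommGroup E'] [NormedSpace ℝ E'] {k l : ℕ}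
    (α : E [⋀^Fin k]→L[ℝ] ℝ) (β : E [⋀^Fin l]→L[ℝ] ℝ) (L : E' →L[ℝ] E) :
    wedge (α.compContinuousLinearMap L) (β.compContinuousLinearMap L) =
      (wedge α β).compContinuousLinearMap L := by
  ext v
  rw [ContinuousAlternatingMap.compContinuousLinearMap_apply, wedge_apply, wedge_apply]
  rfl

omit [FiniteDimensional ℝ E] in
theorem ricciFlat_congr {G G' : E → E →L[ℝ] E →L[ℝ] ℝ} {p : E} (h : G =ᶠ[𝓝 p] G') (v w : E) :
    ricciFlat G p v w = ricciFlat G' p v w := by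
  have hc : christoffel G =ᶠ[𝓝 p] christoffel G' := by
    filter_upwards [h, h.fderiv (𝕜 := ℝ)] with q h1 h2
    unfold christoffel christoffelLower
    rw [h1, h2]
  unfold ricciFlat
  congr 1
  ext u
  simp only [curvatureEnd, LinearMap.coe_mk, AddHom.coe_mk, hc.fderiv_eq, hc.self_of_nhds]

omit [FiniteDimensional ℝ E] in
theorem ricciFlat_zero (G : E → E →L[ℝ] E →L[ℝ] ℝ) (p v : E) : ricciFlat G p v 0 = 0 := by
  have : curvatureEnd G p v 0 = 0 := by
    ext u
    simp [curvatureEnd]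
  rw [ricciFlat, this, map_zero]

end FormAlgebra

/-! ### Metrics and Kähler structures, pointwise -/

section Pointwise

variable {E : Type*} [NormedAddCommGroup E] [NormedSpace ℝ E]
  {H : Type*} [TopologicalSpace H] {I : ModelWithCorners ℝ E H}
  {M : Type*} [TopologicalSpace M] [ChartedSpace H M]
  {g : BilinField I M} {p q : ℕ}

theorem IsMetric.exists_basis (hg : IsMetric g p q) (x : M) :
    ∃ b : Module.Basis (Fin p ⊕ Fin q) ℝ E,
      (∀ i j, i ≠ j → g.toModel x (b i) (b j) = 0) ∧
      (∀ i, g.toModel x (b (Sum.inl i)) (b (Sum.inl i)) = 1) ∧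
      (∀ i, g.toModel x (b (Sum.inr i)) (b (Sum.inr i)) = -1) :=
  hg.orthonormal x

theorem IsMetric.isScalarProduct (hg : IsMetric g p q) (x : M) :
    IsScalarProduct (g.toModel x) := by
  obtain ⟨b, h0, h1, h2⟩ := hg.exists_basis x
  refine IsDualPair.isScalarProduct (fun v w => ?_) (IsDualPair.of_orthonormal b h0 ?_)
  · have : (g.toModel x).toLinearMap₁₂ = (g.toModel x).flip.toLinearMap₁₂ := by
      refine b.ext fun i => b.ext fun j => ?_
      by_cases hij : i = j
      · subst hij; rfl
      · change g.toModel x (b i) (b j) = g.toModel x (b j) (b i)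
        rw [h0 i j hij, h0 j i (Ne.symm hij)]
    exact congrArg (fun f => f v w) this
  · rintro (i | i)
    · simp [h1]
    · simp [h2]

theorem IsMetric.apply_self_neg (hg : IsMetric g 0 q) (x : M) {v : E} (hv : v ≠ 0) :
    g.toModel x v v < 0 := by
  obtain ⟨b, h0, -, h2⟩ := hg.exists_basis x
  have h2' : ∀ i, g.toModel x (b i) (b i) = -1 := by
    rintro (i | i)
    · exact i.elim0
    · exact h2 i
  have h : ∀ i, g.toModel x (b i) v = -b.repr v i := by
    intro i
    conv_lhs => rw [← b.sum_repr v]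
    rw [map_sum, Finset.sum_eq_single i (fun j _ hj => by simp [h0 i j (Ne.symm hj)]) (by simp)]
    simp [h2']
  have h' := congrArg (fun u => g.toModel x u v) (b.sum_repr v)
  simp only [map_sum, map_smul, sum_apply, smul_apply,
    smul_eq_mul, h, mul_neg, Finset.sum_neg_distrib] at h'
  rw [← h', neg_lt_zero]
  obtain ⟨i, hi⟩ : ∃ i, b.repr v i ≠ 0 := by
    by_contra! hcon
    exact hv (b.repr.map_eq_zero_iff.1 (Finsupp.ext hcon))
  exact Finset.sum_pos' (fun j _ => mul_self_nonneg _)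
    ⟨i, Finset.mem_univ _, mul_self_pos.2 hi⟩

/-- The value of a field of endomorphisms at a point, as an endomorphism of the model space. -/
def EndField.toModel (J : EndField I M) (x : M) : E →L[ℝ] E := J x

theorem IsMetric.isHermitian6 {J : EndField I M} {ωM : DiffForm I M 2} (hg : IsMetric g 0 6)
    (hK : IsKahler g J ωM) (x : M) : IsHermitian6 (g.toModel x) (J.toModel x) where
  finrank_eq := by
    obtain ⟨b, -⟩ := hg.exists_basis x
    simpa using Module.finrank_eq_card_basis b
  symm := (hg.isScalarProduct x).symm
  neg _ := hg.apply_self_neg x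
  sq_eq := hK.complex.sq_eq x
  herm := hK.hermitian x

/-- Since `J² = -1`, the relation `ω(u, J v) = g(u, v)` says that `ω(u, v) = g(J u, v)`. -/
theorem IsKahler.form_apply {J : EndField I M} {ωM : DiffForm I M 2} (hg : IsMetric g 0 6)
    (hK : IsKahler g J ωM) (x : M) (u v : E) :
    ωM.toModel x ![u, v] = g.toModel x (J.toModel x u) v := by
  have hJ := hg.isHermitian6 hK x
  have h := hK.form_eq x u (-J.toModel x v)
  have h2 : J.toModel x (-J.toModel x v) = v := by
    rw [map_neg]
    exact neg_eq_iff_eq_neg.2 (hK.complex.sq_eq x v)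
  have h3 := hJ.skew u v
  calc ωM.toModel x ![u, v] = ωM.toModel x ![u, J.toModel x (-J.toModel x v)] := by
        rw [h2]
    _ = g.toModel x u (-J.toModel x v) := h
    _ = _ := by rw [map_neg, h3, neg_neg]

variable [FiniteDimensional ℝ E]

/-- On a Kähler manifold `⋆ω = ±½ ω ∧ ω`, where the sign may a priori depend on the point. -/
theorem IsKahler.exists_star_eq {J : EndField I M} {ωM : DiffForm I M 2} (hg : IsMetric g 0 6)
    (hK : IsKahler g J ωM) {vol : DiffForm I M 6} (hvol : IsVolumeForm g vol) (x : M) :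
    ∃ ε : ℝ, ε * ε = 1 ∧ ∀ v : Fin 4 → E, (DiffForm.star (m := 4) (k := 2) g vol ωM).toModel x v =
      ε * halfSq (fun u w => ωM.toModel x ![u, w]) (v 0) (v 1) (v 2) (v 3) := by
  obtain ⟨ε, hε, h⟩ := exists_hodge_eq_halfSq (hg.isHermitian6 hK x) (hK.form_apply hg x)
    (vol := vol.toModel x) (hvol.sq_eq x)
  refine ⟨ε, hε, fun v => ?_⟩
  simp only [hK.form_apply hg x]
  exact h v

/-- `⟨Y ⌟ ⋆ω, Z ⌟ ⋆ω⟩ = 2 g(Y, Z)`. -/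
theorem IsKahler.inner_contract {J : EndField I M} {ωM : DiffForm I M 2} (hg : IsMetric g 0 6)
    (hK : IsKahler g J ωM) {vol : DiffForm I M 6} (hvol : IsVolumeForm g vol) (x : M) (Y Z : E) :
    formInner (g.toModel x)
      (ContinuousAlternatingMap.curryLeft (n := 3)
        ((DiffForm.star (m := 4) (k := 2) g vol ωM).toModel x) Y)
      (ContinuousAlternatingMap.curryLeft (n := 3)
        ((DiffForm.star (m := 4) (k := 2) g vol ωM).toModel x) Z) = 2 * g.toModel x Y Z := by
  obtain ⟨ε, hε, h⟩ := hK.exists_star_eq hg hvol x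
  simp only [hK.form_apply hg x] at h
  exact (hg.isHermitian6 hK x).formInner_contract hε h Y Z

/-- `‖⋆ω‖² = 3`. -/
theorem IsKahler.inner_star {J : EndField I M} {ωM : DiffForm I M 2} (hg : IsMetric g 0 6)
    (hK : IsKahler g J ωM) {vol : DiffForm I M 6} (hvol : IsVolumeForm g vol) (x : M) :
    formInner (g.toModel x) ((DiffForm.star (m := 4) (k := 2) g vol ωM).toModel x)
      ((DiffForm.star (m := 4) (k := 2) g vol ωM).toModel x) = 3 := by
  obtain ⟨ε, hε, h⟩ := hK.exists_star_eq hg hvol x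
  simp only [hK.form_apply hg x] at h
  exact (hg.isHermitian6 hK x).formInner_self hε h

theorem IsKahler.star_ne_zero {J : EndField I M} {ωM : DiffForm I M 2} (hg : IsMetric g 0 6)
    (hK : IsKahler g J ωM) {vol : DiffForm I M 6} (hvol : IsVolumeForm g vol) (x : M) :
    (DiffForm.star (m := 4) (k := 2) g vol ωM).toModel x ≠ 0 := by
  intro h0
  have h := hK.inner_star hg hvol x
  simp [h0, formInner] at h

theorem IsKahler.star_star {J : EndField I M} {ωM : DiffForm I M 2} (hg : IsMetric g 0 6)
    (hK : IsKahler g J ωM) {vol : DiffForm I M 6} (hvol : IsVolumeForm g vol) (x : M) :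
    hodge (m := 2) (k := 4) (g.toModel x) (vol.toModel x)
      ((DiffForm.star (m := 4) (k := 2) g vol ωM).toModel x) = ωM.toModel x := by
  obtain ⟨ε, hε, h⟩ := hK.exists_star_eq hg hvol x
  simp only [hK.form_apply hg x] at h
  exact (hg.isHermitian6 hK x).hodge_hodge hε (hK.form_apply hg x) h rfl

variable [I.Boundaryless] [IsManifold I 1 M]

omit [FiniteDimensional ℝ E] [I.Boundaryless] [IsManifold I 1 M] in
theorem DiffForm.inChart_smul {k : ℕ} (c : ℝ) (α : DiffForm I M k) (x : M) :
    DiffForm.inChart (c • α) x = c • α.inChart x := rfl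

omit [FiniteDimensional ℝ E] [I.Boundaryless] [IsManifold I 1 M] in
theorem DiffForm.Smooth.const_smul {k : ℕ} {α : DiffForm I M k} (hα : α.Smooth) (c : ℝ) :
    DiffForm.Smooth (c • α) := fun x => by
  rw [DiffForm.inChart_smul]
  exact ContDiffOn.const_smul c (hα x)

theorem DiffForm.Smooth.star (hg : IsMetric g p q) {m k : ℕ} {vol : DiffForm I M (m + k)}
    (hvol : vol.Smooth) {β : DiffForm I M k} (hβ : β.Smooth) :
    (DiffForm.star g vol β).Smooth := fun x =>
  (contDiffOn_hodge (hg.smooth x)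
    (fun _ hp => isScalarProduct_inChart hg.isScalarProduct hp) (hvol x) (hβ x)).congr
    fun _ hp => DiffForm.star_inChart hg.isScalarProduct vol β hp

omit [FiniteDimensional ℝ E] [I.Boundaryless] in
theorem extDeriv_inChart_eq_zero {k : ℕ} {α : DiffForm I M k} (h : α.d = 0) (x : M) :
    extDeriv (α.inChart x) (extChartAt I x x) = 0 := by
  ext v
  rw [← DiffForm.d_apply, DiffForm.toModel, h]
  rfl

omit [FiniteDimensional ℝ E] [IsManifold I 1 M] in
theorem DiffForm.Smooth.differentiableAt {k : ℕ} {α : DiffForm I M k} (h : α.Smooth) (x : M) :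
    DifferentiableAt ℝ (α.inChart x) (extChartAt I x x) :=
  ((h x).contDiffAt (extChartAt_target_mem_nhds x)).differentiableAt (by simp)

/-- The form `⋆ωM` is closed on a Kähler manifold: in a chart it is `±ωM ∧ ωM / 2`. -/
theorem IsKahler.extDeriv_star {J : EndField I M} {ωM : DiffForm I M 2} (hg : IsMetric g 0 6)
    (hK : IsKahler g J ωM) {vol : DiffForm I M 6} (hvol : IsVolumeForm g vol) (x : M) :
    extDeriv ((DiffForm.star (m := 4) (k := 2) g vol ωM).inChart x) (extChartAt I x x) = 0 := by
  have hval : ∀ p, ∃ ε : ℝ, ε * ε = 1 ∧ ∀ v : Fin 4 → E,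
      (DiffForm.star (m := 4) (k := 2) g vol ωM).inChart x p v =
        ε * halfSq (fun u w => ωM.inChart x p ![u, w]) (v 0) (v 1) (v 2) (v 3) := by
    intro p
    obtain ⟨ε, hε, h⟩ := hK.exists_star_eq hg hvol ((extChartAt I x).symm p)
    have hω : ∀ u w, ωM.inChart x p ![u, w] = ωM.toModel ((extChartAt I x).symm p)
        ![chartSymmDeriv I x p u, chartSymmDeriv I x p w] := by
      intro u w
      rw [DiffForm.inChart_apply]
      congr 1
      funext i
      fin_cases i <;> rfl
    refine ⟨ε, hε, fun v => ?_⟩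
    rw [DiffForm.inChart_apply, h]
    simp only [halfSq, hω]
  refine extDeriv_eq_zero_of_eq_halfSq (hK.form_smooth.differentiableAt x)
    (extDeriv_inChart_eq_zero hK.closed x) (fun h0 => ?_) (.of_forall hval)
  refine hK.star_ne_zero hg hvol x ?_
  ext v
  rw [← DiffForm.inChart_self_apply, h0]

end Pointwise

/-! ### Forms and metrics on a product of manifolds -/

section Wedge

variable {E : Type*} [NormedAddCommGroup E] [NormedSpace ℝ E] [FiniteDimensional ℝ E]
  {H : Type*} [TopologicalSpace H] {I : ModelWithCorners ℝ E H}
  {M : Type*} [TopologicalSpace M] [ChartedSpace H M]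

theorem DiffForm.Smooth.wedge {k l : ℕ} {α : DiffForm I M k} {β : DiffForm I M l}
    (hα : α.Smooth) (hβ : β.Smooth) : (DiffForm.wedge α β).Smooth := by
  intro x
  refine contDiffOn_form fun v => ?_
  have h : ∀ p, (DiffForm.wedge α β).inChart x p v =
      Sugra.wedge (α.inChart x p) (β.inChart x p) v := fun p =>
    congrArg (fun f => f v) (wedge_comp (α.toModel ((extChartAt I x).symm p))
      (β.toModel ((extChartAt I x).symm p)) (chartSymmDeriv I x p)).symm
  simp only [h, wedge_apply]
  refine contDiffOn_const.mul (ContDiffOn.sum fun σ _ => ?_)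
  exact ((contDiffOn_form_apply (hα x) _).mul (contDiffOn_form_apply (hβ x) _)).const_smul
    (Equiv.Perm.sign σ)

end Wedge

section Product

variable {E₁ : Type*} [NormedAddCommGroup E₁] [NormedSpace ℝ E₁] [FiniteDimensional ℝ E₁]
  {H₁ : Type*} [TopologicalSpace H₁] {I₁ : ModelWithCorners ℝ E₁ H₁} [I₁.Boundaryless]
  {N : Type*} [TopologicalSpace N] [ChartedSpace H₁ N] [IsManifold I₁ 1 N]
  {E₂ : Type*} [NormedAddCommGroup E₂] [NormedSpace ℝ E₂] [FiniteDimensional ℝ E₂]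
  {H₂ : Type*} [TopologicalSpace H₂] {I₂ : ModelWithCorners ℝ E₂ H₂} [I₂.Boundaryless]
  {M : Type*} [TopologicalSpace M] [ChartedSpace H₂ M] [IsManifold I₂ 1 M]
  {g₁ : BilinField I₁ N} {g₂ : BilinField I₂ M}

theorem DiffForm.Smooth.pullback_fst {k : ℕ} {α : DiffForm I₁ N k} (hα : α.Smooth) :
    (DiffForm.pullback (I := I₁.prod I₂) (Prod.fst : N × M → N) α).Smooth := by
  intro x
  refine ContDiffOn.congr (f := fun p => (α.inChart x.1 p.1).compContinuousLinearMap
    (.fst ℝ E₁ E₂)) (contDiffOn_form fun v => ?_) fun p hp => DiffForm.inChart_pullback_fst α hp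
  exact (contDiffOn_form_apply (hα x.1) (fun i => (v i).1)).comp contDiffOn_fst
    fun p hp => ((extChartAt_prod_target (I₁ := I₁) (I₂ := I₂) x).subset hp).1

theorem DiffForm.Smooth.pullback_snd {k : ℕ} {α : DiffForm I₂ M k} (hα : α.Smooth) :
    (DiffForm.pullback (I := I₁.prod I₂) (Prod.snd : N × M → M) α).Smooth := by
  intro x
  refine ContDiffOn.congr (f := fun p => (α.inChart x.2 p.2).compContinuousLinearMap
    (.snd ℝ E₁ E₂)) (contDiffOn_form fun v => ?_) fun p hp => DiffForm.inChart_pullback_snd α hp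
  exact (contDiffOn_form_apply (hα x.2) (fun i => (v i).2)).comp contDiffOn_snd
    fun p hp => ((extChartAt_prod_target (I₁ := I₁) (I₂ := I₂) x).subset hp).2

variable (g₁ g₂) in
/-- The product metric. -/
noncomputable abbrev prodMetric : BilinField (I₁.prod I₂) (N × M) :=
  BilinField.pullback Prod.fst g₁ + BilinField.pullback Prod.snd g₂

theorem IsMetric.prod {p q p' q' : ℕ} (h₁ : IsMetric g₁ p q) (h₂ : IsMetric g₂ p' q') :
    IsMetric (prodMetric g₁ g₂) (p + p') (q + q') where
  smooth x := by
    rw [extChartAt_prod_target]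
    refine (contDiffOn_prodScalar (h₁.smooth x.1) (h₂.smooth x.2)).congr fun y hy => ?_
    exact BilinField.inChart_pullback_add_pullback g₁ g₂ (by rwa [extChartAt_prod_target])
  orthonormal x := by
    obtain ⟨b₁, h10, h11, h12⟩ := h₁.exists_basis x.1
    obtain ⟨b₂, h20, h21, h22⟩ := h₂.exists_basis x.2
    let e : (Fin p ⊕ Fin q) ⊕ (Fin p' ⊕ Fin q') ≃ Fin (p + p') ⊕ Fin (q + q') :=
      (Equiv.sumSumSumComm _ _ _ _).trans (Equiv.sumCongr finSumFinEquiv finSumFinEquiv)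
    have key : ∃ b : Module.Basis (Fin (p + p') ⊕ Fin (q + q')) ℝ (E₁ × E₂),
        (∀ i j, i ≠ j → prodScalar (g₁.toModel x.1) (g₂.toModel x.2) (b i) (b j) = 0) ∧
        (∀ i, prodScalar (g₁.toModel x.1) (g₂.toModel x.2) (b (.inl i)) (b (.inl i)) = 1) ∧
        (∀ i, prodScalar (g₁.toModel x.1) (g₂.toModel x.2) (b (.inr i)) (b (.inr i)) = -1) := by
      refine ⟨(b₁.prod b₂).reindex e, fun i j hij => ?_, fun i => ?_, fun i => ?_⟩
      · obtain ⟨i, rfl⟩ := e.surjective i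
        obtain ⟨j, rfl⟩ := e.surjective j
        rw [Module.Basis.reindex_apply, Module.Basis.reindex_apply, e.symm_apply_apply,
          e.symm_apply_apply]
        have hij' : i ≠ j := fun h => hij (congrArg e h)
        rcases i with i | i <;> rcases j with j | j
        · simpa using h10 i j fun h => hij' (congrArg _ h)
        · simp
        · simp
        · simpa using h20 i j fun h => hij' (congrArg _ h)
      · obtain ⟨i, rfl⟩ := finSumFinEquiv.surjective i
        rcases i with i | i
        · simpa [e] using h11 i
        · simpa [e] using h21 i
      · obtain ⟨i, rfl⟩ := finSumFinEquiv.surjective i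
        rcases i with i | i
        · simpa [e] using h12 i
        · simpa [e] using h22 i
    have hx := BilinField.toModel_pullback_add_pullback g₁ g₂ x
    rw [← hx] at key
    exact key

/-- The volume form `vol₁ ∧ vol₂` of the product of a 5-dimensional and a 6-dimensional manifold. -/
noncomputable abbrev prodVolForm (vol₁ : DiffForm I₁ N 5) (vol₂ : DiffForm I₂ M 6) :
    DiffForm (I₁.prod I₂) (N × M) 11 :=
  DiffForm.wedge (k := 5) (l := 6) (DiffForm.pullback Prod.fst vol₁)
    (DiffForm.pullback Prod.snd vol₂)

theorem IsVolumeForm.prod {p q p' q' k l : ℕ} (h₁ : IsMetric g₁ p q) (h₂ : IsMetric g₂ p' q')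
    (hk : p + q = k) (hl : p' + q' = l)
    {vol₁ : DiffForm I₁ N k} {vol₂ : DiffForm I₂ M l} (hv₁ : IsVolumeForm g₁ vol₁)
    (hv₂ : IsVolumeForm g₂ vol₂) :
    IsVolumeForm (prodMetric g₁ g₂)
      (DiffForm.wedge (DiffForm.pullback (I := I₁.prod I₂) (Prod.fst : N × M → N) vol₁)
        (DiffForm.pullback (I := I₁.prod I₂) (Prod.snd : N × M → M) vol₂)) where
  smooth := hv₁.smooth.pullback_fst.wedge hv₂.smooth.pullback_snd
  sq_eq x v := by
    obtain ⟨b₁, -⟩ := h₁.exists_basis x.1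
    obtain ⟨b₂, -⟩ := h₂.exists_basis x.2
    have h := vol_sq_eq_prod (g₁ := g₁.toModel x.1) (g₂ := g₂.toModel x.2)
      (vol₁.toModel x.1) (vol₂.toModel x.2)
      (hv₁.sq_eq x.1) (hv₂.sq_eq x.2)
      (b₁.reindex (finSumFinEquiv.trans (finCongr hk)))
      (b₂.reindex (finSumFinEquiv.trans (finCongr hl))) v
    rw [← DiffForm.toModel_pullback_fst (I₂ := I₂) (M := M),
      ← DiffForm.toModel_pullback_snd (I₁ := I₁) (N := N),
      ← BilinField.toModel_pullback_add_pullback] at h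
    exact h

omit [FiniteDimensional ℝ E₁] [FiniteDimensional ℝ E₂] in
theorem DiffForm.d_pullback_snd {k : ℕ} {α : DiffForm I₂ M k} (hα : α.Smooth) (hd : α.d = 0) :
    (DiffForm.pullback (I := I₁.prod I₂) (Prod.snd : N × M → M) α).d = 0 := by
  funext x
  have key : (DiffForm.pullback (I := I₁.prod I₂) (Prod.snd : N × M → M) α).d.toModel x = 0 := by
    ext v
    rw [DiffForm.d_apply]
    have hev : (DiffForm.pullback (I := I₁.prod I₂) (Prod.snd : N × M → M) α).inChart x
        =ᶠ[𝓝 (extChartAt (I₁.prod I₂) x x)] fun p => (α.inChart x.2 p.2).compContinuousLinearMap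
          (fderiv ℝ (Prod.snd : E₁ × E₂ → E₂) p) := by
      filter_upwards [extChartAt_target_mem_nhds x] with p hp
      rw [DiffForm.inChart_pullback_snd α hp, fderiv_snd]
    rw [hev.extDeriv_eq, extChartAt_prod_apply, extDeriv_pullback (r := minSmoothness ℝ 2)
      (x := (extChartAt I₁ x.1 x.1, extChartAt I₂ x.2 x.2)) (f := Prod.snd)
      (hα.differentiableAt x.2) contDiffAt_snd le_rfl, extDeriv_inChart_eq_zero hd]
    rfl
  exact key

theorem BilinField.ricci_prodMetric {p q p' q' : ℕ} (h₁ : IsMetric g₁ p q)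
    (h₂ : IsMetric g₂ p' q') (x : N × M) (v w : E₁ × E₂) :
    (prodMetric g₁ g₂).ricci x v w = g₁.ricci x.1 v.1 w.1 + g₂.ricci x.2 v.2 w.2 := by
  rw [BilinField.ricci_eq, BilinField.ricci_eq, BilinField.ricci_eq]
  have hev : (prodMetric g₁ g₂).inChart x =ᶠ[𝓝 (extChartAt (I₁.prod I₂) x x)] fun p =>
      prodScalar (g₁.inChart x.1 p.1) (g₂.inChart x.2 p.2) := by
    filter_upwards [extChartAt_target_mem_nhds x] with p hp
    exact BilinField.inChart_pullback_add_pullback g₁ g₂ hp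
  rw [ricciFlat_congr hev, extChartAt_prod_apply]
  refine ricciFlat_prodScalar ?_ ?_ ?_ ?_ v w
  · exact ((h₁.smooth x.1).contDiffAt (extChartAt_target_mem_nhds x.1)).of_le
      (WithTop.coe_le_coe.2 le_top : ((2 : ℕ∞) : WithTop ℕ∞) ≤ ∞)
  · exact ((h₂.smooth x.2).contDiffAt (extChartAt_target_mem_nhds x.2)).of_le
      (WithTop.coe_le_coe.2 le_top : ((2 : ℕ∞) : WithTop ℕ∞) ≤ ∞)
  · filter_upwards [extChartAt_target_mem_nhds x.1] with p hp
    exact isScalarProduct_inChart h₁.isScalarProduct hp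
  · filter_upwards [extChartAt_target_mem_nhds x.2] with p hp
    exact isScalarProduct_inChart h₂.isScalarProduct hp

omit [FiniteDimensional ℝ E₁] [I₁.Boundaryless] [I₂.Boundaryless] [IsManifold I₁ 1 N]
  [IsManifold I₂ 1 M] in
/-- Forms pulled back from the second factor vanish in degrees above its dimension. -/
theorem DiffForm.wedge_pullback_snd_eq_zero {k l : ℕ} (hkl : Module.finrank ℝ E₂ < k + l)
    (α : DiffForm I₂ M k) (β : DiffForm I₂ M l) :
    DiffForm.wedge (DiffForm.pullback (I := I₁.prod I₂) (Prod.snd : N × M → M) α)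
      (DiffForm.pullback (I := I₁.prod I₂) (Prod.snd : N × M → M) β) = 0 := by
  funext x
  have h := wedge_comp (α.toModel x.2) (β.toModel x.2) (.snd ℝ E₁ E₂)
  rw [form_eq_zero_of_finrank_lt hkl (Sugra.wedge (α.toModel x.2) (β.toModel x.2)),
    ← DiffForm.toModel_pullback_snd (I₁ := I₁) (N := N),
    ← DiffForm.toModel_pullback_snd (I₁ := I₁) (N := N)] at h
  exact h

end Product

/-! ### The field equations on a product -/

section Background

variable {E₁ : Type*} [NormedAddCommGroup E₁] [NormedSpace ℝ E₁] [FiniteDimensional ℝ E₁]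
  {H₁ : Type*} [TopologicalSpace H₁] {I₁ : ModelWithCorners ℝ E₁ H₁} [I₁.Boundaryless]
  {N : Type*} [TopologicalSpace N] [ChartedSpace H₁ N] [IsManifold I₁ 1 N]
  {E₂ : Type*} [NormedAddCommGroup E₂] [NormedSpace ℝ E₂] [FiniteDimensional ℝ E₂]
  {H₂ : Type*} [TopologicalSpace H₂] {I₂ : ModelWithCorners ℝ E₂ H₂} [I₂.Boundaryless]
  {M : Type*} [TopologicalSpace M] [ChartedSpace H₂ M] [IsManifold I₂ 1 M]
  {gN : BilinField I₁ N} {volN : DiffForm I₁ N 5}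
  {g : BilinField I₂ M} {volM : DiffForm I₂ M 6} {J : EndField I₂ M} {ωM : DiffForm I₂ M 2}

omit [I₁.Boundaryless] [I₂.Boundaryless] [IsManifold I₁ 1 N] [IsManifold I₂ 1 M]
  [FiniteDimensional ℝ E₁] [FiniteDimensional ℝ E₂] in
theorem toModel_prodVolForm (x : N × M) :
    (prodVolForm volN volM : DiffForm (I₁.prod I₂) (N × M) 11).toModel x =
      prodVol (volN.toModel x.1) (volM.toModel x.2) := by
  refine (DiffForm.toModel_wedge (k := 5) (l := 6) _ _ x).trans ?_
  rw [DiffForm.toModel_pullback_fst, DiffForm.toModel_pullback_snd, prodVol]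

omit [I₁.Boundaryless] [I₂.Boundaryless] [IsManifold I₁ 1 N] [IsManifold I₂ 1 M] in
theorem toModel_star_pullback_snd (φ : DiffForm I₂ M 4) (x : N) (y : M) :
    (DiffForm.star (m := 7) (k := 4) (prodMetric gN g) (prodVolForm volN volM)
      (DiffForm.pullback Prod.snd φ)).toModel (x, y) =
    hodge (m := 7) (k := 4) (prodScalar (gN.toModel x) (g.toModel y))
      (prodVol (volN.toModel x) (volM.toModel y))
      ((φ.toModel y).compContinuousLinearMap (.snd ℝ E₁ E₂)) := by
  rw [DiffForm.toModel_star, toModel_prodVolForm, DiffForm.toModel_pullback_snd,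
    BilinField.toModel_pullback_add_pullback]

/-- The coordinate expression of `⋆F` on seven vectors `z`, where `z'` are the corresponding tangent
vectors. -/
theorem inChart_star_pullback_snd_apply (φ : DiffForm I₂ M 4) {x : N × M} {q : E₁ × E₂}
    (hq : q ∈ (extChartAt (I₁.prod I₂) x).target) {z z' : Fin 7 → E₁ × E₂}
    (hz' : ∀ i, z' i = (chartSymmDeriv I₁ x.1 q.1 (z i).1, chartSymmDeriv I₂ x.2 q.2 (z i).2)) :
    (DiffForm.star (m := 7) (k := 4) (prodMetric gN g) (prodVolForm volN volM)
      (DiffForm.pullback Prod.snd φ)).inChart x q z = hodge (m := 7) (k := 4)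
        (prodScalar (gN.toModel ((extChartAt I₁ x.1).symm q.1))
          (g.toModel ((extChartAt I₂ x.2).symm q.2)))
        (prodVol (volN.toModel ((extChartAt I₁ x.1).symm q.1))
          (volM.toModel ((extChartAt I₂ x.2).symm q.2)))
        ((φ.toModel ((extChartAt I₂ x.2).symm q.2)).compContinuousLinearMap (.snd ℝ E₁ E₂)) z' := by
  have hz : (fun i => chartSymmDeriv (I₁.prod I₂) x q (z i)) = z' := by
    funext i
    rw [hz', chartSymmDeriv_prod hq]
    rfl
  rw [DiffForm.inChart_apply, hz, extChartAt_prod_symm_apply, toModel_star_pullback_snd]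

/-- `d ⋆ F = 0`: with `⋆₆ ⋆₆ ω = ω`, the form `⋆F` is a constant multiple of `vol₁ ∧ ω`, and both
factors are closed. -/
theorem d_star_pullback_snd (hgN : IsMetric gN 1 4) (hvolN : volN.Smooth)
    (hg : IsMetric g 0 6) (hvolM : IsVolumeForm g volM) (hK : IsKahler g J ωM) (c : ℝ) :
    (DiffForm.star (m := 7) (k := 4) (prodMetric gN g) (prodVolForm volN volM)
      (DiffForm.pullback Prod.snd (c • DiffForm.star (m := 4) (k := 2) g volM ωM))).d = 0 := by
  classical
  funext x
  obtain ⟨κ, hκ⟩ := exists_hodge_comp_snd_apply (E₁ := E₁) (E₂ := E₂)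
  obtain ⟨b, -⟩ := hgN.exists_basis x.1
  have hE₁ : Module.finrank ℝ E₁ = 5 := by simpa using Module.finrank_eq_card_basis b
  let S := DiffForm.star (m := 7) (k := 4) (prodMetric gN g) (prodVolForm volN volM)
      (DiffForm.pullback Prod.snd (c • DiffForm.star (m := 4) (k := 2) g volM ωM))
  have key : S.d.toModel x = 0 := by
    ext v
    have hzero : extDeriv (S.inChart x) (extChartAt (I₁.prod I₂) x x) = 0 := ?_
    · rw [DiffForm.d_apply, hzero]
    refine extDeriv_eq_zero_of_prod hE₁
      (a := fun q n => κ * c * volN.inChart x.1 q n) (W := ωM.inChart x.2) ?_ ?_ ?_ ?_ ?_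
    · intro n
      rw [extChartAt_prod_apply]
      exact ((((contDiffOn_form_apply (hvolN x.1) n).contDiffAt
        (extChartAt_target_mem_nhds x.1)).differentiableAt (by simp))).const_mul _
    · rw [extChartAt_prod_apply]
      exact hK.form_smooth.differentiableAt x.2
    · rw [extChartAt_prod_apply]
      exact extDeriv_inChart_eq_zero hK.closed x.2
    · filter_upwards [extChartAt_target_mem_nhds x] with q hq z hz
      obtain ⟨z', hz'⟩ : ∃ z' : Fin 7 → E₁ × E₂, ∀ i, z' i =
        (chartSymmDeriv I₁ x.1 q.1 (z i).1, chartSymmDeriv I₂ x.2 q.2 (z i).2) :=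
        ⟨_, fun i => rfl⟩
      refine (inChart_star_pullback_snd_apply _ hq hz').trans ?_
      refine hodge_comp_snd_eq_zero (hgN.isScalarProduct _) (hg.isScalarProduct _) _ _ _ _
        (lt_of_le_of_lt (Finset.card_le_card fun i => ?_) hz)
      simp only [Finset.mem_filter, Finset.mem_univ, true_and]
      exact fun h h0 => h (by rw [hz', h0, map_zero])
    · filter_upwards [extChartAt_target_mem_nhds x] with q hq z h5 h6
      obtain ⟨z', hz'⟩ : ∃ z' : Fin 7 → E₁ × E₂, ∀ i, z' i =
        (chartSymmDeriv I₁ x.1 q.1 (z i).1, chartSymmDeriv I₂ x.2 q.2 (z i).2) :=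
        ⟨_, fun i => rfl⟩
      refine (inChart_star_pullback_snd_apply _ hq hz').trans ?_
      rw [hκ (hgN.isScalarProduct _) (hg.isScalarProduct _) _ _ _ _
        (by rw [hz', h5, map_zero]) (by rw [hz', h6, map_zero])]
      have hφ : (c • DiffForm.star (m := 4) (k := 2) g volM ωM : DiffForm I₂ M 4).toModel
          ((extChartAt I₂ x.2).symm q.2) = c • (DiffForm.star (m := 4) (k := 2) g volM ωM).toModel
          ((extChartAt I₂ x.2).symm q.2) := rfl
      rw [hφ, hodge_smul, hK.star_star hg hvolM, DiffForm.inChart_apply, DiffForm.inChart_apply,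
        ContinuousAlternatingMap.smul_apply, smul_eq_mul]
      have e1 : (fun i => chartSymmDeriv I₁ x.1 q.1
          (![(z 0).1, (z 1).1, (z 2).1, (z 3).1, (z 4).1] i)) = ![chartSymmDeriv I₁ x.1 q.1 (z 0).1,
          chartSymmDeriv I₁ x.1 q.1 (z 1).1, chartSymmDeriv I₁ x.1 q.1 (z 2).1,
          chartSymmDeriv I₁ x.1 q.1 (z 3).1, chartSymmDeriv I₁ x.1 q.1 (z 4).1] := by
        funext i; fin_cases i <;> rfl
      have e2 : (fun i => chartSymmDeriv I₂ x.2 q.2 (![(z 5).2, (z 6).2] i)) =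
          ![chartSymmDeriv I₂ x.2 q.2 (z 5).2, chartSymmDeriv I₂ x.2 q.2 (z 6).2] := by
        funext i; fin_cases i <;> rfl
      simp only [hz', e1, e2]
      ring
  exact key

omit [I₁.Boundaryless] [I₂.Boundaryless] [IsManifold I₁ 1 N] [IsManifold I₂ 1 M] in
/-- The right-hand side of the Einstein equation: `-½ · 2c² g + ⅙ · 3c² (gN + g) = ½c² (gN - g)`. -/
theorem einstein_rhs (hgN : IsMetric gN 1 4) (hg : IsMetric g 0 6) (hvolM : IsVolumeForm g volM)
    (hK : IsKahler g J ωM) (c : ℝ) (x : N × M) (X Y : E₁ × E₂) :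
    -(1 / 2) * (prodMetric gN g).inner x
        ((DiffForm.pullback (I := I₁.prod I₂) (Prod.snd : N × M → M)
          (c • DiffForm.star (m := 4) (k := 2) g volM ωM)).contract x X)
        ((DiffForm.pullback (I := I₁.prod I₂) (Prod.snd : N × M → M)
          (c • DiffForm.star (m := 4) (k := 2) g volM ωM)).contract x Y) +
      1 / 6 * prodMetric gN g x X Y * (prodMetric gN g).inner x
        (DiffForm.pullback (I := I₁.prod I₂) (Prod.snd : N × M → M)
          (c • DiffForm.star (m := 4) (k := 2) g volM ωM) x)
        (DiffForm.pullback (I := I₁.prod I₂) (Prod.snd : N × M → M)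
          (c • DiffForm.star (m := 4) (k := 2) g volM ωM) x) =
      c ^ 2 / 2 * gN.toModel x.1 X.1 Y.1 + -(c ^ 2 / 2) * g.toModel x.2 X.2 Y.2 := by
  set φ := (DiffForm.star (m := 4) (k := 2) g volM ωM).toModel x.2 with hφ
  have hF : (DiffForm.pullback (I := I₁.prod I₂) (Prod.snd : N × M → M)
      (c • DiffForm.star (m := 4) (k := 2) g volM ωM)).toModel x =
      (c • φ).compContinuousLinearMap (.snd ℝ E₁ E₂) := DiffForm.toModel_pullback_snd _ x
  have hh : (prodMetric gN g).toModel x = prodScalar (gN.toModel x.1) (g.toModel x.2) :=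
    BilinField.toModel_pullback_add_pullback gN g x
  have hs₁ := hgN.isScalarProduct x.1
  have hs₂ := hg.isScalarProduct x.2
  have h1 := formInner_comp_snd hs₁ hs₂ (c • ContinuousAlternatingMap.curryLeft (n := 3) φ X.2)
    (c • ContinuousAlternatingMap.curryLeft (n := 3) φ Y.2)
  have h2 := formInner_comp_snd hs₁ hs₂ (c • φ) (c • φ)
  rw [formInner_smul_smul, hK.inner_contract hg hvolM] at h1
  rw [formInner_smul_smul, hK.inner_star hg hvolM, ← hF] at h2
  have h3 : ∀ Z : E₁ × E₂, (c • ContinuousAlternatingMap.curryLeft (n := 3) φ Z.2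
      ).compContinuousLinearMap (.snd ℝ E₁ E₂) = ContinuousAlternatingMap.curryLeft (n := 3)
      ((DiffForm.pullback (I := I₁.prod I₂) (Prod.snd : N × M → M)
      (c • DiffForm.star (m := 4) (k := 2) g volM ωM)).toModel x) Z := by
    intro Z
    rw [hF]
    ext v
    change c * φ _ = c * φ _
    congr 2
    funext i
    refine Fin.cases rfl (fun j => rfl) i
  rw [h3, h3] at h1
  rw [← hh] at h1 h2
  have h4 : (prodMetric gN g).toModel x X Y =
      gN.toModel x.1 X.1 Y.1 + g.toModel x.2 X.2 Y.2 := by rw [hh, prodScalar_apply]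
  calc _ = -(1 / 2) * (c ^ 2 * (2 * g.toModel x.2 X.2 Y.2)) +
        1 / 6 * (gN.toModel x.1 X.1 Y.1 + g.toModel x.2 X.2 Y.2) * (c ^ 2 * 3) := by
        rw [← h1, ← h2, ← h4]; rfl
    _ = _ := by ring

end Background

end Sugra

open Sugra in
theorem mainTheorem1
    {N M : Type*}
    [TopologicalSpace N] [ChartedSpace (EuclideanSpace ℝ (Fin 5)) N] [IsManifold (𝓡 5) ∞ N]
    [Nonempty N]
    [TopologicalSpace M] [ChartedSpace (EuclideanSpace ℝ (Fin 6)) M] [IsManifold (𝓡 6) ∞ M]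
    [Nonempty M]
    (gN : BilinField (𝓡 5) N) (hgN : IsMetric gN 1 4)
    (volN : DiffForm (𝓡 5) N 5) (hvolN : IsVolumeForm gN volN)
    (g : BilinField (𝓡 6) M) (hg : IsMetric g 0 6)
    (volM : DiffForm (𝓡 6) M 6) (hvolM : IsVolumeForm g volM)
    (J : EndField (𝓡 6) M) (ωM : DiffForm (𝓡 6) M 2) (hK : IsKahler g J ωM)
    (c : ℝ) :
    IsBosonicBackground (I := (𝓡 5).prod (𝓡 6)) (M := N × M)
      (BilinField.pullback Prod.fst gN + BilinField.pullback Prod.snd g)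
      (DiffForm.wedge (DiffForm.pullback Prod.fst volN) (DiffForm.pullback Prod.snd volM))
      (DiffForm.pullback Prod.snd (c • DiffForm.star (m := 4) (k := 2) g volM ωM)) ↔
    IsEinstein gN (c ^ 2 / 2) ∧ IsEinstein g (-(c ^ 2 / 2)) := by
  have _ : IsManifold (𝓡 5) 1 N := IsManifold.of_le (n := ∞) (by simp)
  have _ : IsManifold (𝓡 6) 1 M := IsManifold.of_le (n := ∞) (by simp)
  have hric := BilinField.ricci_prodMetric hgN hg
  have hrhs := einstein_rhs hgN hg hvolM hK c
  constructor
  · intro h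
    have hE := fun (x : N × M) X Y => ((hric x X Y).symm.trans (h.einstein x X Y)).trans (hrhs x X Y)
    constructor
    -- test on vectors tangent to one factor, at an arbitrary point of the other factor
    · intro x v w
      obtain ⟨y⟩ := ‹Nonempty M›
      have hxy := hE (x, y) (v, 0) (w, 0)
      have h0 : g.ricci y (0 : EuclideanSpace ℝ (Fin 6)) (0 : EuclideanSpace ℝ (Fin 6)) = 0 := by
        rw [BilinField.ricci_eq, ricciFlat_zero]
      simpa [h0] using! hxy
    · intro y v w
      obtain ⟨x⟩ := ‹Nonempty N›
      have hxy := hE (x, y) (0, v) (0, w)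
      have h0 : gN.ricci x (0 : EuclideanSpace ℝ (Fin 5)) (0 : EuclideanSpace ℝ (Fin 5)) = 0 := by
        rw [BilinField.ricci_eq, ricciFlat_zero]
      simpa [h0] using! hxy
  · rintro ⟨hN, hM⟩
    have hφs := DiffForm.Smooth.star hg hvolM.smooth hK.form_smooth
    have hFs := hφs.const_smul c
    refine ⟨hgN.prod hg, IsVolumeForm.prod hgN hg rfl rfl hvolN hvolM, hFs.pullback_snd, ?_, ?_, ?_⟩
    · refine DiffForm.d_pullback_snd hFs (funext fun x => ?_)
      refine ContinuousAlternatingMap.ext (M := EuclideanSpace ℝ (Fin 6)) fun v => ?_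
      refine (DiffForm.d_apply _ x v).trans ?_
      rw [DiffForm.inChart_smul, extDeriv_smul, hK.extDeriv_star hg hvolM, smul_zero]
      rfl
    · have hd := d_star_pullback_snd hgN hvolN.smooth hg hvolM hK c
      refine hd.trans ?_
      rw [DiffForm.wedge_pullback_snd_eq_zero (by simp), smul_zero]
    · intro x X Y
      refine Eq.trans (hric x X Y) (Eq.trans ?_ (hrhs x X Y).symm)
      exact congrArg₂ (· + ·) (hN x.1 X.1 Y.1) (hM x.2 X.2 Y.2)
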